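/- Let $H$ and $F$ be real separable Hilbert spaces, let $\mathcal L_{\rm HS}(H,G)$ denote the Hilbert–Schmidt operators from $H$ to $G$, let $(\Omega,\mathcal F,\mathbb Q)$ be a probability space carrying a cylindrical Wiener process $W$ over $H$, and let $\{\mathcal F_t\}_{t\ge0}$ be the filtration generated by $W$, augmented by the null sets. Let $\sigma:\mathbb R_+\times F\to\mathcal L_{\rm HS}(H,F)$ and $C>0$ satisfy $$\|\sigma(t,x)-\sigma(t,y)\|_{\mathcal L_{\rm HS}(H,F)}\le C\|x-y\|_F\qquad\text{for all }t\ge 0,\ x,y\in F,\tag{26}$$ and let $P$ be a continuous adapted $F$-valued process with $P_t=P_0+\int_0^t\sigma(s,P_s)\,dW_s$ for all $t\ge0$, with $P_0\in F$ deterministic and $\mathbb E\int_0^t\|\sigma(s,P_s)\|^2_{\mathcal L_{\rm HS}(H,F)}\,ds<\infty$. Fix $T\ge0$, and let $D$ be the Malliavin derivative on $[0,T]$, i.e. the closure of its restriction to the smooth random variables $\kappa(\int_0^T\langle h^1_t,dW_t\rangle,\dots,\int_0^T\langle h^n_t,dW_t\rangle)$, where $h^i\in L^2([0,T];H)$ and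 $\kappa$ is differentiable with partial derivatives of polynomial growth. Let $\{\nabla\sigma_u\}_{u\in[0,T]}$ be an adapted, measurable (strongly, i.e. after evaluation at each $x\in F$), $\mathcal L(F,\mathcal L_{\rm HS}(H,F))$-valued process such that for each $u\in[0,T]$ the random operator $\nabla\sigma_u$ is a derivative of $\sigma(u,\cdot)$ at $P_u$ in the sense of the chain rule: almost surely $\|\nabla\sigma_u\|$ is at most any Lipschitz constant of $\sigma(u,\cdot)$, and $D[\sigma(u,P_u)]=\nabla\sigma_u\,DP_u$ whenever $P_u$ is Malliavin differentiable. Then for every $t\in[0,T]$ the linear equation $$Y_{t,s}=I+\int_t^s\nabla\sigma_u\,Y_{t,u}\,dW_u,\qquad s\in[t,T],$$ has a martingale solution $\{Y_{t,s}\}_{s\in[t,T]}$ consisting of strong random operators on $F$. That is: for each $x\in F$ there is an $F$-valued process $\{Y_{t,s}x\}_{s\in[t,T]}$, linear in $x$, such that $x\mapsto Y_{t,s}x$ is bounded from $F$ to $L^2(\Omega;F)$ uniformly in $s\in[t,T]$, such that for each $x$ the process $s\mapsto Y_{t,s}x$ is an $\{\mathcal F_s\}$-martingale with almost surely continuous paths,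 and such that for all $x\in F$ and $s\in[t,T]$ the process $\nabla\sigma_uY_{t,u}x$ is adapted, measurable and square-integrable on $[t,s]$ with $$Y_{t,s}x=x+\int_t^s\nabla\sigma_u\,Y_{t,u}x\,dW_u\quad\text{almost surely.}$$ Furthermore, for every $x\in F$, almost surely, $$\mathbb E\{\|Y_{t,T}x\|_F^2\mid\mathcal F_t\}\le\|x\|_F^2\,e^{C^2(T-t)}.$$ -/

import Mathlib

open MeasureTheory ProbabilityTheory Filter Topology Set
open scoped NNReal ENNReal

noncomputable section

namespace HJM

/-! ### Hilbert–Schmidt operators -/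

section HilbertSchmidt

/-- Index set of a fixed orthonormal (Hilbert) basis of `H`. -/
def basisIndex (H : Type*) [NormedAddCommGroup H] [InnerProductSpace ℝ H] [CompleteSpace H] :
    Set H :=
  Classical.choose (exists_hilbertBasis ℝ H)

/-- A fixed orthonormal (Hilbert) basis of `H`. -/
def stdBasis (H : Type*) [NormedAddCommGroup H] [InnerProductSpace ℝ H] [CompleteSpace H] :
    HilbertBasis (basisIndex H) ℝ H :=
  Classical.choose (Classical.choose_spec (exists_hilbertBasis ℝ H))

/-- The bounded operators `A : H → G` with `∑ i, ‖A eᵢ‖² < ∞`. -/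
def hsSubmodule (H G : Type*) [NormedAddCommGroup H] [InnerProductSpace ℝ H] [CompleteSpace H]
    [NormedAddCommGroup G] [NormedSpace ℝ G] : Submodule ℝ (H →L[ℝ] G) where
  carrier := {A | Memℓp (fun i => A (stdBasis H i)) 2}
  add_mem' ha hb := Memℓp.add ha hb
  zero_mem' := zero_memℓp
  smul_mem' c _ ha := Memℓp.const_smul ha c

/-- The space `L_HS(H, G)` of Hilbert–Schmidt operators (a type synonym, so that it carries the
Hilbert–Schmidt norm and not the operator norm). -/
def HS (H G : Type*) [NormedAddCommGroup H] [InnerProductSpace ℝ H] [CompleteSpace H]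
    [NormedAddCommGroup G] [NormedSpace ℝ G] : Type _ :=
  hsSubmodule H G

variable {H G K : Type*} [NormedAddCommGroup H] [InnerProductSpace ℝ H] [CompleteSpace H]
  [NormedAddCommGroup G] [NormedSpace ℝ G] [NormedAddCommGroup K] [NormedSpace ℝ K]

instance : AddCommGroup (HS H G) := inferInstanceAs (AddCommGroup (hsSubmodule H G))

instance : Module ℝ (HS H G) := inferInstanceAs (Module ℝ (hsSubmodule H G))

/-- A Hilbert–Schmidt operator as a bounded operator. -/
def HS.toCLM (A : HS H G) : H →L[ℝ] G := Subtype.val A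

/-- `A ↦ (A eᵢ)ᵢ ∈ ℓ²`. -/
def HS.toLp : HS H G →ₗ[ℝ] lp (fun _ : basisIndex H => G) 2 where
  toFun A := ⟨fun i => A.toCLM (stdBasis H i), A.2⟩
  map_add' _ _ := rfl
  map_smul' _ _ := rfl

theorem HS.toLp_injective : Function.Injective (HS.toLp : HS H G →ₗ[ℝ] _) := by
  intro A B h
  apply Subtype.ext
  have h' : ∀ i, A.toCLM (stdBasis H i) = B.toCLM (stdBasis H i) := fun i =>
    congrFun (congrArg Subtype.val h) i
  refine ContinuousLinearMap.ext_on (s := Set.range (stdBasis H)) ?_ ?_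
  · have := (stdBasis H).dense_span
    rw [Submodule.dense_iff_topologicalClosure_eq_top]
    exact this
  · rintro _ ⟨i, rfl⟩
    exact h' i

/-- The Hilbert–Schmidt norm, i.e. the `ℓ²` norm of `(A eᵢ)ᵢ`. -/
instance : NormedAddCommGroup (HS H G) :=
  NormedAddCommGroup.induced (HS H G) (lp (fun _ : basisIndex H => G) 2) HS.toLp HS.toLp_injective

instance : NormedSpace ℝ (HS H G) :=
  NormedSpace.induced ℝ (HS H G) (lp (fun _ : basisIndex H => G) 2) HS.toLp

/-- `‖A‖² = ∑ i, ‖A eᵢ‖²`. -/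
theorem HS.hasSum_norm_sq (A : HS H G) :
    HasSum (fun i => ‖A.toCLM (stdBasis H i)‖ ^ 2) (‖A‖ ^ 2) := by
  have h := lp.hasSum_norm (p := 2) (by norm_num) (HS.toLp A)
  have h' : HasSum (fun i => ‖HS.toLp A i‖ ^ 2) (‖HS.toLp A‖ ^ 2) := by simpa using h
  exact h'

/-- The rank-one operator `h ⊗ y : v ↦ ⟨h, v⟩ y`. -/
def HS.rankOne (h : H) (y : G) : HS H G :=
  ⟨(innerSL ℝ h).smulRight y, by
    have h1 : Memℓp (fun i => ((stdBasis H).repr h : basisIndex H → ℝ) i) 2 :=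
      ((stdBasis H).repr h).2
    have h2 : Summable fun i => ‖((stdBasis H).repr h : basisIndex H → ℝ) i‖ ^ (2 : ℝ) := by
      simpa using h1.summable (by norm_num)
    refine memℓp_gen ?_
    have h3 := h2.mul_right (‖y‖ ^ (2 : ℝ))
    refine h3.congr fun i => ?_
    rw [(stdBasis H).repr_apply_apply, real_inner_comm]
    simp [norm_smul, mul_pow]⟩

/-- The composition `A ∘ B` of a Hilbert–Schmidt operator `B` with a bounded operator `A`. -/
def HS.comp (A : G →L[ℝ] K) (B : HS H G) : HS H K :=
  ⟨A.comp B.toCLM, by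
    have h2 : Summable fun i => ‖B.toCLM (stdBasis H i)‖ ^ (2 : ℝ) := by
      simpa using B.hasSum_norm_sq.summable
    refine memℓp_gen ?_
    refine Summable.of_nonneg_of_le (fun i => by positivity) (fun i => ?_)
      (h2.mul_left (‖A‖ ^ (2 : ℝ)))
    have h4 := A.le_opNorm (B.toCLM (stdBasis H i))
    have h5 := pow_le_pow_left₀ (norm_nonneg _) h4 2
    rw [mul_pow] at h5
    simpa using h5⟩

end HilbertSchmidt

/-! ### Cylindrical Wiener process and stochastic integral -/

/-- A cylindrical Wiener process over `H` on `(Ω, μ)`: a family of real Brownian motions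
`(W_t h)_{t ≥ 0}` of variance `t ‖h‖²`, linear in `h ∈ H`, whose increments after time `s` are
independent of the whole family up to time `s`. -/
structure CylindricalWiener {Ω : Type*} [MeasurableSpace Ω] (H : Type*) [NormedAddCommGroup H]
    [InnerProductSpace ℝ H] (μ : Measure Ω) where
  toFun : ℝ≥0 → H → Ω → ℝ
  measurable : ∀ t h, Measurable (toFun t h)
  linear : ∀ t (a b : ℝ) (g h : H), ∀ᵐ ω ∂μ,
    toFun t (a • g + b • h) ω = a * toFun t g ω + b * toFun t h ω
  zero : ∀ h, ∀ᵐ ω ∂μ, toFun 0 h ω = 0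
  continuous : ∀ h, ∀ᵐ ω ∂μ, Continuous fun t => toFun t h ω
  law : ∀ s t h, s ≤ t →
    HasLaw (fun ω => toFun t h ω - toFun s h ω) (gaussianReal 0 ((t - s) * ‖h‖₊ ^ 2)) μ
  indep : ∀ s t h, s ≤ t →
    Indep (⨆ r ≤ s, ⨆ g, MeasurableSpace.comap (toFun r g) inferInstance)
      (MeasurableSpace.comap (fun ω => toFun t h ω - toFun s h ω) inferInstance) μ

/-- Lebesgue measure on `ℝ₊`. -/
def leb : Measure ℝ≥0 := Measure.comap ((↑) : ℝ≥0 → ℝ) volume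

/-- The product measure `du ⊗ dμ` on `(a, b] × Ω`. -/
def timeProd {Ω : Type*} [MeasurableSpace Ω] (μ : Measure Ω) (a b : ℝ≥0) : Measure (ℝ≥0 × Ω) :=
  (leb.restrict (Ioc a b)).prod μ

section Stochastic

variable {Ω : Type*} [mΩ : MeasurableSpace Ω] {μ : Measure Ω}
  {H : Type*} [NormedAddCommGroup H] [InnerProductSpace ℝ H]

/-- The filtration generated by `W`, augmented by the null sets. -/
def CylindricalWiener.filtration (W : CylindricalWiener H μ) : Filtration ℝ≥0 mΩ where
  seq t := (⨆ r ≤ t, ⨆ g, MeasurableSpace.comap (W.toFun r g) inferInstance) ⊔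
    MeasurableSpace.generateFrom {N | MeasurableSet N ∧ μ N = 0}
  mono' _ _ hst := sup_le_sup_right (biSup_mono fun _ hr => hr.trans hst) _
  le' _ := sup_le (iSup₂_le fun r _ => iSup_le fun g => (W.measurable r g).comap_le)
    (MeasurableSpace.generateFrom_le fun _ hN => hN.1)

/-- The same filtration, with time restricted to a set `S`. -/
def CylindricalWiener.filtrationOn (W : CylindricalWiener H μ) (S : Set ℝ≥0) :
    Filtration S mΩ where
  seq s := W.filtration s
  mono' _ _ hst := W.filtration.mono hst
  le' s := W.filtration.le s

variable [CompleteSpace H] {G : Type*} [NormedAddCommGroup G] [NormedSpace ℝ G]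

/-- An elementary integrand `1_{(left, right]}(u) · coef(ω) · (dir ⊗ val)` with `coef` bounded and
`ℱ_left`-measurable. -/
structure ElemTerm (W : CylindricalWiener H μ) (G : Type*) where
  left : ℝ≥0
  right : ℝ≥0
  left_le_right : left ≤ right
  coef : Ω → ℝ
  coef_measurable : StronglyMeasurable[W.filtration left] coef
  coef_bounded : ∃ K, ∀ ω, |coef ω| ≤ K
  dir : H
  val : G

/-- The `L_HS(H, G)`-valued process defined by an elementary integrand. -/
def ElemTerm.integrand {W : CylindricalWiener H μ} (e : ElemTerm W G) (u : ℝ≥0) (ω : Ω) :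
    HS H G :=
  (Ioc e.left e.right).indicator (fun _ => e.coef ω • HS.rankOne e.dir e.val) u

/-- The stochastic integral of an elementary integrand. -/
def ElemTerm.integral {W : CylindricalWiener H μ} (e : ElemTerm W G) (ω : Ω) : G :=
  (e.coef ω * (W.toFun e.right e.dir ω - W.toFun e.left e.dir ω)) • e.val

/-- The admissible integrands on `(a, b]`: adapted, measurable, square-integrable processes. -/
structure ItoIntegrable (W : CylindricalWiener H μ) (Φ : ℝ≥0 → Ω → HS H G) (a b : ℝ≥0) :
    Prop where
  adapted : ∀ u ∈ Icc a b, StronglyMeasurable[W.filtration u] (Φ u)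
  memLp : MemLp (fun p : ℝ≥0 × Ω => Φ p.1 p.2) 2 (timeProd μ a b)

/-- `I = ∫_a^b Φ_u dW_u` almost surely: `I` is the `L²(Ω; G)` limit of the stochastic integrals of
finite sums of elementary integrands (on `(a, b]`) that converge to `Φ` in
`L²((a, b] × Ω; L_HS(H, G))`. -/
def IsItoIntegral (W : CylindricalWiener H μ) (Φ : ℝ≥0 → Ω → HS H G) (a b : ℝ≥0) (I : Ω → G) :
    Prop :=
  ItoIntegrable W Φ a b ∧ AEStronglyMeasurable I μ ∧
    ∃ L : ℕ → List (ElemTerm W G),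
      (∀ n, ∀ e ∈ L n, a ≤ e.left ∧ e.right ≤ b) ∧
      Tendsto (fun n => eLpNorm (fun p : ℝ≥0 × Ω =>
          ((L n).map fun e => e.integrand p.1 p.2).sum - Φ p.1 p.2) 2 (timeProd μ a b))
        atTop (𝓝 0) ∧
      Tendsto (fun n => eLpNorm (fun ω => ((L n).map fun e => e.integral ω).sum - I ω) 2 μ)
        atTop (𝓝 0)

/-! ### Malliavin derivative on `[0, T]` -/

/-- `X = κ(∫_0^T ⟨h¹, dW⟩, …, ∫_0^T ⟨hⁿ, dW⟩)` is a smooth random variable, with Malliavin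
derivative `D_t X = ∑ i, ∂ᵢκ(…) ⊗ hⁱ_t`; here `hⁱ ∈ L²([0, T]; H)` is deterministic, and the
partial derivatives of `κ` have polynomial growth. -/
def IsSmoothWithDeriv (W : CylindricalWiener H μ) (T : ℝ≥0) (X : Ω → G)
    (DX : ℝ≥0 → Ω → HS H G) : Prop :=
  ∃ (n : ℕ) (h : Fin n → ℝ≥0 → H) (ξ : Fin n → Ω → ℝ) (κ : EuclideanSpace ℝ (Fin n) → G),
    (∀ i, IsItoIntegral W (fun u _ => HS.rankOne (h i u) (1 : ℝ)) 0 T (ξ i)) ∧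
    Differentiable ℝ κ ∧
    (∃ p C : ℝ, 0 < p ∧ 0 < C ∧ ∀ x,
      ∑ i, ‖fderiv ℝ κ x (EuclideanSpace.single i 1)‖ < C * (1 + ‖x‖ ^ p)) ∧
    (∀ ω, X ω = κ (WithLp.toLp 2 fun i => ξ i ω)) ∧
    ∀ t ω, DX t ω = ∑ i, HS.rankOne (h i t)
      (fderiv ℝ κ (WithLp.toLp 2 fun j => ξ j ω) (EuclideanSpace.single i 1))

/-- `X ∈ ℍ¹(G)` with Malliavin derivative `DX`: the pair `(X, DX)` is in the closure, in
`L²(Ω; G) × L²([0, T] × Ω; L_HS(H, G))`, of the graph of the derivative on smooth random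
variables. -/
def IsMalliavinDeriv (W : CylindricalWiener H μ) (T : ℝ≥0) (X : Ω → G)
    (DX : ℝ≥0 → Ω → HS H G) : Prop :=
  MemLp X 2 μ ∧ MemLp (fun p : ℝ≥0 × Ω => DX p.1 p.2) 2 (timeProd μ 0 T) ∧
    ∃ (Xn : ℕ → Ω → G) (DXn : ℕ → ℝ≥0 → Ω → HS H G),
      (∀ n, IsSmoothWithDeriv W T (Xn n) (DXn n)) ∧
      Tendsto (fun n => eLpNorm (fun ω => Xn n ω - X ω) 2 μ) atTop (𝓝 0) ∧
      Tendsto (fun n => eLpNorm (fun p : ℝ≥0 × Ω => DXn n p.1 p.2 - DX p.1 p.2) 2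
        (timeProd μ 0 T)) atTop (𝓝 0)

variable {F : Type*} [NormedAddCommGroup F] [NormedSpace ℝ F]

/-- `A = ∇κ(X)`: the random operator `A`, with values in `L(F, G)`, is a derivative of the Lipschitz
function `κ : F → G` at the random variable `X` in the sense of the Malliavin chain rule: its norm
is at most any Lipschitz constant of `κ`, and `D κ(X) = ∇κ(X) D X`. -/
structure IsMalliavinGradient (W : CylindricalWiener H μ) (T : ℝ≥0) (κ : F → G) (X : Ω → F)
    (A : Ω → F →L[ℝ] G) : Prop where
  measurable : ∀ x, AEStronglyMeasurable (fun ω => A ω x) μ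
  norm_le : ∀ K : ℝ≥0, LipschitzWith K κ → ∀ᵐ ω ∂μ, ‖A ω‖ ≤ K
  chain_rule : ∀ DX, IsMalliavinDeriv W T X DX →
    IsMalliavinDeriv W T (fun ω => κ (X ω)) fun t ω => HS.comp (A ω) (DX t ω)

/-! ### The model and the linear equation -/

/-- `P` is a continuous adapted solution of `dP_t = σ(t, P_t) dW_t`, `P_0 = p₀`, in `F`. -/
structure IsPriceProcess (W : CylindricalWiener H μ) (σ : ℝ≥0 → F → HS H F) (p₀ : F)
    (P : ℝ≥0 → Ω → F) : Prop where
  adapted : StronglyAdapted W.filtration P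
  continuous : ∀ᵐ ω ∂μ, Continuous fun t => P t ω
  equation : ∀ t, IsItoIntegral W (fun u ω => σ u (P u ω)) 0 t (fun ω => P t ω - p₀)

/-- `A_u = ∇σ_u`, `u ∈ [0, T]`, is an adapted measurable version of the derivatives of `σ(u, ·)` at
`P_u`. -/
structure IsGradientProcess (W : CylindricalWiener H μ) (T : ℝ≥0) (σ : ℝ≥0 → F → HS H F)
    (P : ℝ≥0 → Ω → F) (A : ℝ≥0 → Ω → F →L[ℝ] HS H F) : Prop where
  gradient : ∀ u ∈ Icc 0 T, IsMalliavinGradient W T (σ u) (P u) (A u)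
  adapted : ∀ u ∈ Icc 0 T, ∀ x, StronglyMeasurable[W.filtration u] fun ω => A u ω x
  measurable : ∀ x, AEStronglyMeasurable (fun p : ℝ≥0 × Ω => A p.1 p.2 x) (timeProd μ 0 T)

/-- `Y_s = Y_{t,s}`, `s ∈ [t, T]`, is a process of strong random operators on `F` (for each `x`, an
`F`-valued process `Y_s x`, linear in `x`, and bounded as a map `F → L²(Ω; F)`) that is a
continuous martingale and solves `Y_{t,s} = I + ∫_t^s A_u Y_{t,u} dW_u`, in the sense of equality
of strong random operators. -/
structure IsStrongMartingaleSolution [CompleteSpace F] (W : CylindricalWiener H μ)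
    (A : ℝ≥0 → Ω → F →L[ℝ] HS H F) (t T : ℝ≥0) (Y : ℝ≥0 → Ω → F →ₗ[ℝ] F) : Prop where
  bounded : ∃ K : ℝ≥0, ∀ s ∈ Icc t T, ∀ x, eLpNorm (fun ω => Y s ω x) 2 μ ≤ K * ‖x‖ₑ
  continuous : ∀ x, ∀ᵐ ω ∂μ, ContinuousOn (fun s => Y s ω x) (Icc t T)
  martingale : ∀ x, Martingale (fun (s : Icc t T) ω => Y s ω x) (W.filtrationOn (Icc t T)) μ
  equation : ∀ x, ∀ s ∈ Icc t T,
    IsItoIntegral W (fun u ω => A u ω (Y u ω x)) t s (fun ω => Y s ω x - x)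

end Stochastic

end HJM

end

/-! As `C` is a Lipschitz constant of each σ(u, ·), the coefficient satisfies ‖∇σ_u‖ ≤ C almost
surely for each u, so the equation is a linear stochastic equation with a bounded adapted
coefficient. The Itô isometry gives E‖∫_t^s ∇σ_u Z_u dW_u‖² ≤ C² ∫_t^s E‖Z_u‖² du. Measured against
the weight e^{mC²(s-t)}, the Volterra operator on the right gains a factor 1/m (`volterra_step`).
With m = 4, successive Picard iterates approach each other at least geometrically with ratio 1/2 in
L². Their values at T converge in L²(Ω); conditional expectation carries this to earlier times, and
Doob's inequality with Borel–Cantelli gives a continuous version (`IsL2Martingale.exists_limit`).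

For the conditional estimate, let B ∈ ℱ_t. Orthogonality of martingale increments gives E[1_B‖Y_s‖²]
= P(B)‖x‖² + E[1_B‖Y_s - x‖²]. The last term is at most C² ∫_t^s E[1_B‖Y_u‖²] du, by the isometry
for the integrand 1_B ∇σ_u Y_u x. Gronwall's inequality bounds the left side by P(B)‖x‖²
e^{C²(s-t)}, and since B is arbitrary this is the conditional bound.

Linearity in x is wanted for every ω, whereas solving separately for each x determines nothing on
null sets. So the equation is solved on an algebraic basis of F and extended linearly. Every `Y x`
is then again a solution, and the a priori estimate gives boundedness in L² uniformly in s.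

The stochastic integral is only defined as an L² limit, so its existence has to be proved. The two
pillars are the isometry for elementary integrands (`eLpNorm_elemIntegral`), from independence of
increments, and the density of elementary integrands among adapted square-integrable ones
(`ElemApprox.of_adapted`). For density, a process is replaced on each cell of a time grid by its
average over the preceding cell, which is known, up to null sets, when the cell begins. -/

noncomputable section

namespace HJM

set_option linter.unusedSectionVars false

/-! ### Hilbert–Schmidt operators as a Hilbert space with basis eᵢ ⊗ fⱼ -/

section HilbertSchmidtInner

variable {H F : Type*} [NormedAddCommGroup H] [InnerProductSpace ℝ H] [CompleteSpace H]
  [NormedAddCommGroup F] [InnerProductSpace ℝ F]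

/-- The Hilbert–Schmidt inner product `⟪A, B⟫ = ∑ i, ⟪A eᵢ, B eᵢ⟫`. -/
instance HS.instInnerProductSpace : InnerProductSpace ℝ (HS H F) where
  inner A B := inner ℝ (HS.toLp A) (HS.toLp B)
  norm_sq_eq_re_inner A := norm_sq_eq_re_inner (𝕜 := ℝ) (HS.toLp A)
  conj_inner_symm A B := inner_conj_symm (𝕜 := ℝ) (HS.toLp A) (HS.toLp B)
  add_left A B D := by
    simp only [map_add]
    exact inner_add_left (𝕜 := ℝ) (HS.toLp A) (HS.toLp B) (HS.toLp D)
  smul_left A B r := by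
    simp only [map_smul]
    exact inner_smul_left (𝕜 := ℝ) (HS.toLp A) (HS.toLp B) r

theorem HS.hasSum_inner (A B : HS H F) :
    HasSum (fun i => inner ℝ (A.toCLM (stdBasis H i)) (B.toCLM (stdBasis H i))) (inner ℝ A B) :=
  lp.hasSum_inner (𝕜 := ℝ) (HS.toLp A) (HS.toLp B)

theorem HS.rankOne_toCLM_apply (h v : H) (y : F) :
    (HS.rankOne h y).toCLM v = inner ℝ h v • y := rfl

/-- Apply the continuous functional v ↦ ⟪y, B v⟫ to the basis expansion of `h`. -/
theorem HS.inner_rankOne_left (h : H) (y : F) (B : HS H F) :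
    inner ℝ (HS.rankOne h y) B = inner ℝ y (B.toCLM h) := by
  have h1 := ((stdBasis H).hasSum_repr h).mapL ((innerSL ℝ y).comp B.toCLM)
  have h2 := HS.hasSum_inner (HS.rankOne h y) B
  have h3 : (fun i => inner ℝ ((HS.rankOne h y).toCLM (stdBasis H i))
      (B.toCLM (stdBasis H i))) = fun i => ((innerSL ℝ y).comp B.toCLM)
      ((stdBasis H).repr h i • stdBasis H i) := by
    funext i
    simp [HS.rankOne_toCLM_apply, inner_smul_left, HilbertBasis.repr_apply_apply,
      real_inner_comm]
  rw [h3] at h2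
  exact h2.unique h1

theorem HS.inner_rankOne_rankOne (h h' : H) (y y' : F) :
    inner ℝ (HS.rankOne h y) (HS.rankOne h' y') = inner ℝ h h' * inner ℝ y y' := by
  rw [HS.inner_rankOne_left, HS.rankOne_toCLM_apply, inner_smul_right, real_inner_comm]

/-- Orthonormal vectors are √2 apart, so balls of radius 1/2 around them are disjoint open sets, of
which a separable space has only countably many. Countability later lets a sequence of finite sets
exhaust the basis. -/
theorem Orthonormal.countable_index [TopologicalSpace.SeparableSpace F] {ι : Type*} {v : ι → F}
    (hv : Orthonormal ℝ v) : Countable ι := by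
  rw [← Set.countable_univ_iff]
  have hdist : ∀ i j, i ≠ j → 1 < dist (v i) (v j) := by
    intro i j hij
    have h1 : ‖v i - v j‖ ^ 2 = 2 := by
      rw [@norm_sub_sq_real, hv.1 i, hv.1 j, hv.2 hij]; norm_num
    rw [dist_eq_norm]
    nlinarith [norm_nonneg (v i - v j)]
  refine Set.PairwiseDisjoint.countable_of_isOpen (s := fun i => Metric.ball (v i) (1 / 2)) ?_
    (fun i _ => Metric.isOpen_ball) (fun i _ => ⟨v i, by simp⟩)
  intro i _ j _ hij
  refine Metric.ball_disjoint_ball ?_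
  linarith [hdist i j hij]

theorem basisIndex_countable [CompleteSpace F] [TopologicalSpace.SeparableSpace F] :
    Countable (basisIndex F) :=
  Orthonormal.countable_index (stdBasis F).orthonormal

variable [CompleteSpace F]

/-- The orthonormal family `eᵢ ⊗ fⱼ`. -/
def HS.basisVec (p : basisIndex H × basisIndex F) : HS H F :=
  HS.rankOne (stdBasis H p.1) (stdBasis F p.2)

theorem HS.orthonormal_basisVec : Orthonormal ℝ (HS.basisVec (H := H) (F := F)) := by
  classical
  rw [orthonormal_iff_ite]
  rintro ⟨i, j⟩ ⟨i', j'⟩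
  rw [HS.basisVec, HS.basisVec, HS.inner_rankOne_rankOne,
    (orthonormal_iff_ite.1 (stdBasis H).orthonormal) i i',
    (orthonormal_iff_ite.1 (stdBasis F).orthonormal) j j']
  by_cases h1 : i = i' <;> by_cases h2 : j = j' <;> simp [h1, h2]

/-- Completeness of the family eᵢ ⊗ fⱼ: Parseval in F for each vector A eᵢ, then summation over i.
-/
theorem HS.hasSum_inner_basisVec_sq (A : HS H F) :
    HasSum (fun p => inner ℝ (HS.basisVec p) A ^ 2) (‖A‖ ^ 2) := by
  have hs : Summable fun p => inner ℝ (HS.basisVec p) A ^ 2 := by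
    simpa using (HS.orthonormal_basisVec (H := H) (F := F)).inner_products_summable A
  have h1 : ∀ i, HasSum (fun j => inner ℝ (HS.basisVec (i, j)) A ^ 2)
      (‖A.toCLM (stdBasis H i)‖ ^ 2) := by
    intro i
    have := (stdBasis F).hasSum_inner_mul_inner (A.toCLM (stdBasis H i)) (A.toCLM (stdBasis H i))
    rw [real_inner_self_eq_norm_sq] at this
    have h3 : (fun j => inner ℝ (HS.basisVec (i, j)) A ^ 2) = fun j =>
        inner ℝ (A.toCLM (stdBasis H i)) (stdBasis F j) *
          inner ℝ (stdBasis F j) (A.toCLM (stdBasis H i)) := by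
      funext j
      rw [show HS.basisVec (i, j) = HS.rankOne (stdBasis H i) (stdBasis F j) from rfl,
        HS.inner_rankOne_left, real_inner_comm (stdBasis F j), sq]
    rw [h3]
    exact this
  have h2 := hs.hasSum.prod_fiberwise h1
  rw [← h2.unique A.hasSum_norm_sq]
  exact hs.hasSum

theorem HS.norm_sub_sum_sq_le (A : HS H F) (S : Finset (basisIndex H × basisIndex F)) :
    ‖A - ∑ p ∈ S, inner ℝ (HS.basisVec p) A • HS.basisVec p‖ ^ 2
      = ‖A‖ ^ 2 - ∑ p ∈ S, inner ℝ (HS.basisVec p) A ^ 2 := by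
  have h1 : inner ℝ A (∑ p ∈ S, inner ℝ (HS.basisVec p) A • HS.basisVec p)
      = ∑ p ∈ S, inner ℝ (HS.basisVec p) A ^ 2 := by
    rw [inner_sum]
    refine Finset.sum_congr rfl fun p _ => ?_
    rw [inner_smul_right, real_inner_comm, sq]
  have h2 : ‖∑ p ∈ S, inner ℝ (HS.basisVec p) A • HS.basisVec p‖ ^ 2
      = ∑ p ∈ S, inner ℝ (HS.basisVec p) A ^ 2 := by
    rw [← real_inner_self_eq_norm_sq,
      (HS.orthonormal_basisVec (H := H) (F := F)).inner_sum]
    simp [sq]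
  rw [@norm_sub_sq_real, h1, h2]
  ring

theorem HS.tendsto_sum_basisVec (A : HS H F) :
    Tendsto (fun S : Finset (basisIndex H × basisIndex F) =>
      ∑ p ∈ S, inner ℝ (HS.basisVec p) A • HS.basisVec p) atTop (𝓝 A) := by
  rw [tendsto_iff_norm_sub_tendsto_zero]
  have h1 : Tendsto (fun S : Finset (basisIndex H × basisIndex F) =>
      ‖A - ∑ p ∈ S, inner ℝ (HS.basisVec p) A • HS.basisVec p‖ ^ 2) atTop (𝓝 0) := by
    simp_rw [HS.norm_sub_sum_sq_le]
    have := (tendsto_const_nhds (x := ‖A‖ ^ 2)).sub (HS.hasSum_inner_basisVec_sq A)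
    simpa using this
  have h2 := h1.sqrt
  simpa [Real.sqrt_sq, norm_sub_rev] using h2

/-- Provides the dominating function when a process is approximated by its partial expansions. -/
theorem HS.norm_sub_sum_le (A : HS H F) (S : Finset (basisIndex H × basisIndex F)) :
    ‖A - ∑ p ∈ S, inner ℝ (HS.basisVec p) A • HS.basisVec p‖ ≤ ‖A‖ := by
  refine (sq_le_sq₀ (norm_nonneg _) (norm_nonneg _)).1 ?_
  rw [HS.norm_sub_sum_sq_le]
  have : 0 ≤ ∑ p ∈ S, inner ℝ (HS.basisVec p) A ^ 2 := Finset.sum_nonneg fun p _ => sq_nonneg _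
  linarith

end HilbertSchmidtInner

/-! ### Lebesgue measure on ℝ₊ and the product measure -/

section Time

theorem measurableEmbedding_coe_nnreal : MeasurableEmbedding ((↑) : ℝ≥0 → ℝ) :=
  MeasurableEmbedding.subtype_coe (measurableSet_Ici (a := (0 : ℝ)))

theorem image_coe_Ioc (a b : ℝ≥0) : ((↑) : ℝ≥0 → ℝ) '' Ioc a b = Ioc (a : ℝ) b := by
  ext x
  constructor
  · rintro ⟨y, hy, rfl⟩
    exact ⟨NNReal.coe_lt_coe.2 hy.1, NNReal.coe_le_coe.2 hy.2⟩
  · rintro ⟨h1, h2⟩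
    exact ⟨⟨x, a.2.trans h1.le⟩, ⟨NNReal.coe_lt_coe.1 h1, NNReal.coe_le_coe.1 h2⟩, rfl⟩

theorem leb_Ioc (a b : ℝ≥0) : leb (Ioc a b) = ENNReal.ofReal (b - a) := by
  rw [leb, measurableEmbedding_coe_nnreal.comap_apply, image_coe_Ioc, Real.volume_Ioc]

instance isFiniteMeasure_leb_restrict (a b : ℝ≥0) : IsFiniteMeasure (leb.restrict (Ioc a b)) :=
  ⟨by rw [Measure.restrict_apply_univ, leb_Ioc]; exact ENNReal.ofReal_lt_top⟩

/-- The bridge to ℝ, where Lebesgue differentiation and the fundamental theorem of calculus are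
available. -/
theorem map_coe_leb_restrict (a b : ℝ≥0) :
    (leb.restrict (Ioc a b)).map ((↑) : ℝ≥0 → ℝ) = volume.restrict (Ioc (a : ℝ) b) := by
  have h1 : Ioc a b = ((↑) : ℝ≥0 → ℝ) ⁻¹' Ioc (a : ℝ) b := by
    ext x; simp
  have h2 : Ioc (a : ℝ) b ⊆ range ((↑) : ℝ≥0 → ℝ) :=
    fun x hx => ⟨⟨x, a.2.trans hx.1.le⟩, rfl⟩
  rw [h1, ← measurableEmbedding_coe_nnreal.restrict_map, leb,
    measurableEmbedding_coe_nnreal.map_comap, Measure.restrict_restrict measurableSet_Ioc,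
    inter_eq_left.2 h2]

theorem setLIntegral_leb (a b : ℝ≥0) (f : ℝ → ℝ≥0∞) :
    ∫⁻ u in Ioc a b, f u ∂leb = ∫⁻ x in Ioc (a : ℝ) b, f x := by
  rw [← map_coe_leb_restrict, measurableEmbedding_coe_nnreal.lintegral_map]

variable {Ω : Type*} [MeasurableSpace Ω] {μ : Measure Ω}

instance isFiniteMeasure_timeProd [IsFiniteMeasure μ] (a b : ℝ≥0) :
    IsFiniteMeasure (timeProd μ a b) := by
  unfold timeProd; infer_instance

theorem timeProd_eq_restrict [SFinite μ] {a b a' b' : ℝ≥0} (ha : a ≤ a') (hb : b' ≤ b) :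
    timeProd μ a' b' = (timeProd μ a b).restrict (Ioc a' b' ×ˢ univ) := by
  rw [timeProd, timeProd, ← Measure.prod_restrict, Measure.restrict_univ,
    Measure.restrict_restrict measurableSet_Ioc, inter_eq_left.2 (Ioc_subset_Ioc ha hb)]

theorem timeProd_mono [SFinite μ] {a b a' b' : ℝ≥0} (ha : a ≤ a') (hb : b' ≤ b) :
    timeProd μ a' b' ≤ timeProd μ a b := by
  rw [timeProd_eq_restrict ha hb]
  exact Measure.restrict_le_self

end Time

/-! ### Moments of Wiener increments and independence of the past -/

section Filtration

variable {Ω : Type*} [mΩ : MeasurableSpace Ω] {μ : Measure Ω}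
  {H : Type*} [NormedAddCommGroup H] [InnerProductSpace ℝ H]

theorem measurableSet_filtration_of_null (W : CylindricalWiener H μ) (t : ℝ≥0) {N : Set Ω}
    (hN : MeasurableSet N) (h0 : μ N = 0) : MeasurableSet[W.filtration t] N :=
  le_sup_right (a := ⨆ r ≤ t, ⨆ g, MeasurableSpace.comap (W.toFun r g) inferInstance) _
    (MeasurableSpace.measurableSet_generateFrom ⟨hN, h0⟩)

theorem stronglyMeasurable_toFun (W : CylindricalWiener H μ) {s t : ℝ≥0} (hst : s ≤ t) (h : H) :
    StronglyMeasurable[W.filtration t] (W.toFun s h) := by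
  have h1 : Measurable[W.filtration t] (W.toFun s h) := by
    rw [measurable_iff_comap_le]
    exact le_sup_of_le_left (le_iSup₂_of_le s hst
      (le_iSup (fun g => MeasurableSpace.comap (W.toFun s g) inferInstance) h))
  exact h1.stronglyMeasurable

/-- Increments of `W` after time `s` are independent of the augmented filtration at time `s`. -/
theorem indep_filtration_increment (W : CylindricalWiener H μ) {s t : ℝ≥0} (hst : s ≤ t) (h : H) :
    Indep (W.filtration s)
      (MeasurableSpace.comap (fun ω => W.toFun t h ω - W.toFun s h ω) inferInstance) μ := by
  have h1 := W.indep s t h hst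
  rw [Indep_iff] at h1 ⊢
  intro A B hA hB
  -- An event of the augmented σ-algebra agrees almost surely with one of the unaugmented σ-algebra,
  -- and independence does not see null sets.
  have hle : (W.filtration s : MeasurableSpace Ω) ≤ eventuallyMeasurableSpace
      (⨆ r ≤ s, ⨆ g, MeasurableSpace.comap (W.toFun r g) inferInstance) (ae μ) := by
    refine sup_le (fun A hA => ⟨A, hA, ae_eq_refl _⟩) (MeasurableSpace.generateFrom_le ?_)
    rintro N ⟨-, hN⟩
    exact ⟨∅, @MeasurableSet.empty _ (_), ae_eq_empty.2 hN⟩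
  obtain ⟨A', hA', hAA'⟩ := hle A hA
  rw [measure_congr hAA', measure_congr (hAA'.inter (ae_eq_refl B)), h1 A' B hA' hB]

variable (W : CylindricalWiener H μ)

theorem memLp_increment {s t : ℝ≥0} (hst : s ≤ t) (h : H) {p : ℝ≥0∞} (hp : p ≠ ∞) :
    MemLp (fun ω => W.toFun t h ω - W.toFun s h ω) p μ := by
  have h1 := (W.law s t h hst)
  have h2 := memLp_id_gaussianReal' (μ := 0) (v := (t - s) * ‖h‖₊ ^ 2) p hp
  rw [← h1.map_eq] at h2
  exact (memLp_map_measure_iff aestronglyMeasurable_id h1.aemeasurable).1 h2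

theorem integral_increment {s t : ℝ≥0} (hst : s ≤ t) (h : H) :
    ∫ ω, (W.toFun t h ω - W.toFun s h ω) ∂μ = 0 := by
  have h1 := (W.law s t h hst).integral_eq
  rw [h1]
  exact integral_id_gaussianReal

theorem integral_increment_sq {s t : ℝ≥0} (hst : s ≤ t) (h : H) :
    ∫ ω, (W.toFun t h ω - W.toFun s h ω) ^ 2 ∂μ = (t - s) * ‖h‖ ^ 2 := by
  have h1 := (W.law s t h hst).variance_eq
  rw [variance_of_integral_eq_zero (W.law s t h hst).aemeasurable (integral_increment W hst h),
    variance_id_gaussianReal] at h1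
  rw [h1]
  push_cast [NNReal.coe_sub hst]
  simp

/-- The product formula for independent variables requires no integrability, so `Z` may itself
contain earlier increments, which are unbounded. -/
theorem integral_mul_increment {s t : ℝ≥0} (hst : s ≤ t) (h : H) {Z : Ω → ℝ}
    (hZ : StronglyMeasurable[W.filtration s] Z) :
    ∫ ω, Z ω * (W.toFun t h ω - W.toFun s h ω) ∂μ = 0 := by
  have hi : IndepFun Z (fun ω => W.toFun t h ω - W.toFun s h ω) μ :=
    indep_of_indep_of_le_left (indep_filtration_increment W hst h)
      (measurable_iff_comap_le.1 hZ.measurable)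
  have h1 := hi.integral_mul_eq_mul_integral (hZ.mono (W.filtration.le s)).aestronglyMeasurable
    ((W.measurable t h).sub (W.measurable s h)).aestronglyMeasurable
  have h2 := integral_increment W hst h
  simp only [Pi.mul_apply] at h1
  rw [h1, h2, mul_zero]

theorem integral_mul_increment_sq {s t : ℝ≥0} (hst : s ≤ t) (h : H) {Z : Ω → ℝ}
    (hZ : StronglyMeasurable[W.filtration s] Z) :
    ∫ ω, Z ω * (W.toFun t h ω - W.toFun s h ω) ^ 2 ∂μ = (∫ ω, Z ω ∂μ) * ((t - s) * ‖h‖ ^ 2) := by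
  have hi : IndepFun Z (fun ω => W.toFun t h ω - W.toFun s h ω) μ :=
    indep_of_indep_of_le_left (indep_filtration_increment W hst h)
      (measurable_iff_comap_le.1 hZ.measurable)
  have hi2 : IndepFun Z (fun ω => (W.toFun t h ω - W.toFun s h ω) ^ 2) μ :=
    hi.comp (φ := id) (ψ := fun x : ℝ => x ^ 2) measurable_id (by fun_prop)
  have h1 := hi2.integral_mul_eq_mul_integral (hZ.mono (W.filtration.le s)).aestronglyMeasurable
    (((W.measurable t h).sub (W.measurable s h)).pow_const 2).aestronglyMeasurable
  simp only [Pi.mul_apply] at h1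
  rw [h1, integral_increment_sq W hst h]

theorem toFun_add (t : ℝ≥0) (g h : H) :
    ∀ᵐ ω ∂μ, W.toFun t (g + h) ω = W.toFun t g ω + W.toFun t h ω := by
  filter_upwards [W.linear t 1 1 g h] with ω hω
  simpa using hω

theorem integrable_mul_increment_sq {s t : ℝ≥0} (hst : s ≤ t) (h : H) {Z : Ω → ℝ}
    (hZ : AEStronglyMeasurable Z μ) {K : ℝ} (hK : ∀ ω, |Z ω| ≤ K) :
    Integrable (fun ω => Z ω * (W.toFun t h ω - W.toFun s h ω) ^ 2) μ :=
  ((memLp_increment W hst h (p := 2) (by norm_num)).integrable_sq).bdd_mul hZ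
    (Eventually.of_forall hK)

/-- Polarization of `integral_mul_increment_sq`, using that W is almost surely additive in its
direction. -/
theorem integral_mul_increment_mul_increment {s t : ℝ≥0} (hst : s ≤ t) (g h : H) {Z : Ω → ℝ}
    (hZ : StronglyMeasurable[W.filtration s] Z) {K : ℝ} (hK : ∀ ω, |Z ω| ≤ K) :
    ∫ ω, Z ω * ((W.toFun t g ω - W.toFun s g ω) * (W.toFun t h ω - W.toFun s h ω)) ∂μ
      = (∫ ω, Z ω ∂μ) * ((t - s) * inner ℝ g h) := by
  have hm := (hZ.mono (W.filtration.le s)).aestronglyMeasurable (μ := μ)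
  have hI := fun h => integrable_mul_increment_sq W hst h hm hK
  have h1 : ∫ ω, Z ω * ((W.toFun t g ω - W.toFun s g ω) * (W.toFun t h ω - W.toFun s h ω)) ∂μ
      = ∫ ω, (1 / 2 : ℝ) * (Z ω * (W.toFun t (g + h) ω - W.toFun s (g + h) ω) ^ 2
        - Z ω * (W.toFun t g ω - W.toFun s g ω) ^ 2
        - Z ω * (W.toFun t h ω - W.toFun s h ω) ^ 2) ∂μ := by
    refine integral_congr_ae ?_
    filter_upwards [toFun_add W t g h, toFun_add W s g h] with ω h1 h2
    rw [h1, h2]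
    ring
  have e1 := integral_sub ((hI (g + h)).sub (hI g)) (hI h)
  have e2 := integral_sub (hI (g + h)) (hI g)
  simp only [Pi.sub_apply] at e1
  rw [h1, integral_const_mul, e1, e2, integral_mul_increment_sq W hst _ hZ,
    integral_mul_increment_sq W hst _ hZ, integral_mul_increment_sq W hst _ hZ,
    @norm_add_sq_real]
  ring

end Filtration

/-! ### Square integrals and L² norms -/

section LTwo

variable {α β E G : Type*} [MeasurableSpace α] [MeasurableSpace β] {μ : Measure α} {ν : Measure β}

theorem eLpNorm_two_sq [NormedAddCommGroup E] (f : α → E) (μ : Measure α) :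
    eLpNorm f 2 μ ^ 2 = ∫⁻ x, ‖f x‖ₑ ^ 2 ∂μ := by
  have := eLpNorm_nnreal_pow_eq_lintegral (f := f) (μ := μ) (p := 2) (by norm_num)
  simpa using this

theorem MemLp.integrable_inner_two [NormedAddCommGroup E] [InnerProductSpace ℝ E] {f g : α → E}
    (hf : MemLp f 2 μ) (hg : MemLp g 2 μ) : Integrable (fun x => inner ℝ (f x) (g x)) μ := by
  refine (hf.norm.integrable_mul hg.norm).mono (hf.1.inner hg.1) (Eventually.of_forall fun x => ?_)
  simpa using abs_real_inner_le_norm (f x) (g x)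

theorem MemLp.lintegral_enorm_sq [NormedAddCommGroup E] {f : α → E} (hf : MemLp f 2 μ) :
    ∫⁻ x, ‖f x‖ₑ ^ 2 ∂μ = ENNReal.ofReal (∫ x, ‖f x‖ ^ 2 ∂μ) := by
  rw [ofReal_integral_eq_lintegral_ofReal hf.norm.integrable_sq
    (Eventually.of_forall fun x => by positivity)]
  refine lintegral_congr fun x => ?_
  rw [ENNReal.ofReal_pow (norm_nonneg _), ofReal_norm]

theorem eLpNorm_two_eq_of_lintegral_eq [NormedAddCommGroup E] [NormedAddCommGroup G]
    {f : α → E} {g : β → G} (h : ∫⁻ x, ‖f x‖ₑ ^ 2 ∂μ = ∫⁻ x, ‖g x‖ₑ ^ 2 ∂ν) :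
    eLpNorm f 2 μ = eLpNorm g 2 ν := by
  rw [← eLpNorm_two_sq, ← eLpNorm_two_sq] at h
  exact (ENNReal.pow_right_strictMono two_ne_zero).injective h

end LTwo

/-! ### The Itô isometry for elementary integrands -/

section Elementary

variable {Ω : Type*} [mΩ : MeasurableSpace Ω] {μ : Measure Ω} [IsProbabilityMeasure μ]
  {H : Type*} [NormedAddCommGroup H] [InnerProductSpace ℝ H]
  {W : CylindricalWiener H μ}

theorem memLp_mul_increment {s t : ℝ≥0} (hst : s ≤ t) (h : H) {Z : Ω → ℝ}
    (hZ : AEStronglyMeasurable Z μ) {K : ℝ} (hK : ∀ ω, |Z ω| ≤ K) :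
    MemLp (fun ω => Z ω * (W.toFun t h ω - W.toFun s h ω)) 2 μ :=
  MemLp.mul (p := ∞) (q := 2) (memLp_increment W hst h (by norm_num))
    (memLp_top_of_bound hZ K (Eventually.of_forall hK))

/-- Orthogonality of increments, the left interval starting first. -/
theorem integral_mul_increments_of_le {l r l' r' : ℝ≥0} (hlr' : l' ≤ r')
    (hll : l ≤ l') (h h' : H) {c c' : Ω → ℝ}
    (hc : StronglyMeasurable[W.filtration l] c) (hc' : StronglyMeasurable[W.filtration l'] c')
    {K K' : ℝ} (hK : ∀ ω, |c ω| ≤ K) (hK' : ∀ ω, |c' ω| ≤ K') :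
    ∫ ω, (c ω * (W.toFun r h ω - W.toFun l h ω)) * (c' ω * (W.toFun r' h' ω - W.toFun l' h' ω)) ∂μ
      = (∫ ω, c ω * c' ω ∂μ) * (inner ℝ h h' * leb.real (Ioc l r ∩ Ioc l' r')) := by
  have hcl : StronglyMeasurable[W.filtration l'] c := hc.mono (W.filtration.mono hll)
  have hZ : StronglyMeasurable[W.filtration l'] fun ω => c ω * c' ω := hcl.mul hc'
  have hK0 : ∀ ω, |c ω * c' ω| ≤ K * K' := fun ω => by
    rw [abs_mul]
    exact mul_le_mul (hK ω) (hK' ω) (abs_nonneg _) ((abs_nonneg _).trans (hK ω))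
  have hZm : AEStronglyMeasurable (fun ω => c ω * c' ω) μ :=
    (hZ.mono (W.filtration.le l')).aestronglyMeasurable
  rw [Ioc_inter_Ioc, max_eq_right hll]
  change _ = _ * (_ * leb.real (Ioc l' (min r r')))
  rw [Measure.real, leb_Ioc]
  rcases le_or_gt r l' with hr | hr
  -- The intervals are disjoint: everything but the second increment is known at time `l'`.
  · have hX : StronglyMeasurable[W.filtration l'] fun ω =>
        c ω * c' ω * (W.toFun r h ω - W.toFun l h ω) :=
      hZ.mul ((stronglyMeasurable_toFun W hr h).sub (stronglyMeasurable_toFun W hll h))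
    have h0 := integral_mul_increment W hlr' h' hX
    rw [ENNReal.ofReal_of_nonpos, ENNReal.toReal_zero, mul_zero, mul_zero, ← h0]
    · exact integral_congr_ae (Eventually.of_forall fun ω => by ring)
    · rw [sub_nonpos, NNReal.coe_le_coe]
      exact (min_le_left _ _).trans hr
  -- The intervals overlap in (l', m]. Cutting the first increment at `l'` and `m`, and the second
  -- at `m`, leaves one product of increments over (l', m], which carries the whole expectation;
  -- each other product contains an increment independent of its remaining factors.
  · set m := min r r' with hm
    have hlm : l' ≤ m := le_min hr.le hlr'
    have hmr : m ≤ r := min_le_left _ _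
    have hmr' : m ≤ r' := min_le_right _ _
    have hZ' : StronglyMeasurable[W.filtration m] fun ω => c ω * c' ω :=
      hZ.mono (W.filtration.mono hlm)
    have hA : StronglyMeasurable[W.filtration l'] fun ω =>
        c ω * c' ω * (W.toFun l' h ω - W.toFun l h ω) :=
      hZ.mul ((stronglyMeasurable_toFun W le_rfl h).sub (stronglyMeasurable_toFun W hll h))
    have hD : ∀ g, StronglyMeasurable[W.filtration m] fun ω =>
        c ω * c' ω * (W.toFun m g ω - W.toFun l' g ω) := fun g =>
      hZ'.mul ((stronglyMeasurable_toFun W le_rfl g).sub (stronglyMeasurable_toFun W hlm g))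
    have e1 := integral_mul_increment W hlr' h' hA
    have e2 := integral_mul_increment_mul_increment W hlm h h' hZ hK0
    have e3 := integral_mul_increment W hmr' h' (hD h)
    have e4 := integral_mul_increment W hmr h (hD h')
    have two : (2 : ℝ≥0∞) ≠ ∞ := by norm_num
    have i1 : Integrable (fun ω => c ω * c' ω * (W.toFun l' h ω - W.toFun l h ω) *
        (W.toFun r' h' ω - W.toFun l' h' ω)) μ :=
      (memLp_mul_increment hll h hZm hK0).integrable_mul (memLp_increment W hlr' h' two)
    have i2 : Integrable (fun ω => c ω * c' ω * ((W.toFun m h ω - W.toFun l' h ω) *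
        (W.toFun m h' ω - W.toFun l' h' ω))) μ := by
      have := (memLp_mul_increment (W := W) hlm h hZm hK0).integrable_mul
        (memLp_increment W hlm h' two)
      refine this.congr (Eventually.of_forall fun ω => ?_)
      simp only [Pi.mul_apply]; ring
    have i3 : Integrable (fun ω => c ω * c' ω * (W.toFun m h ω - W.toFun l' h ω) *
        (W.toFun r' h' ω - W.toFun m h' ω)) μ :=
      (memLp_mul_increment hlm h hZm hK0).integrable_mul (memLp_increment W hmr' h' two)
    have i4 : Integrable (fun ω => c ω * c' ω * (W.toFun m h' ω - W.toFun l' h' ω) *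
        (W.toFun r h ω - W.toFun m h ω)) μ :=
      (memLp_mul_increment hlm h' hZm hK0).integrable_mul (memLp_increment W hmr h two)
    have hsplit : ∀ ω, (c ω * (W.toFun r h ω - W.toFun l h ω)) *
        (c' ω * (W.toFun r' h' ω - W.toFun l' h' ω))
        = (c ω * c' ω * (W.toFun l' h ω - W.toFun l h ω) *
            (W.toFun r' h' ω - W.toFun l' h' ω)
          + c ω * c' ω * ((W.toFun m h ω - W.toFun l' h ω) *
            (W.toFun m h' ω - W.toFun l' h' ω)))
          + (c ω * c' ω * (W.toFun m h ω - W.toFun l' h ω) *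
            (W.toFun r' h' ω - W.toFun m h' ω)
          + c ω * c' ω * (W.toFun m h' ω - W.toFun l' h' ω) *
            (W.toFun r h ω - W.toFun m h ω)) := by
      intro ω
      -- One of the two intervals ends at `m`, so one factor vanishes.
      have h0 : (W.toFun r h ω - W.toFun m h ω) * (W.toFun r' h' ω - W.toFun m h' ω) = 0 := by
        rcases min_choice r r' with h1 | h1
        · rw [hm, h1, sub_self, zero_mul]
        · rw [hm, h1, sub_self, mul_zero]
      linear_combination c ω * c' ω * h0
    have f1 := integral_add (i1.add i2) (i3.add i4)
    have f2 := integral_add i1 i2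
    have f3 := integral_add i3 i4
    simp only [Pi.add_apply] at f1
    rw [integral_congr_ae (Eventually.of_forall hsplit), f1, f2, f3, e1, e2, e3, e4,
      ENNReal.toReal_ofReal (sub_nonneg.2 (NNReal.coe_le_coe.2 hlm))]
    ring

theorem integral_mul_increments {l r l' r' : ℝ≥0} (hlr : l ≤ r) (hlr' : l' ≤ r')
    (h h' : H) {c c' : Ω → ℝ}
    (hc : StronglyMeasurable[W.filtration l] c) (hc' : StronglyMeasurable[W.filtration l'] c')
    {K K' : ℝ} (hK : ∀ ω, |c ω| ≤ K) (hK' : ∀ ω, |c' ω| ≤ K') :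
    ∫ ω, (c ω * (W.toFun r h ω - W.toFun l h ω)) * (c' ω * (W.toFun r' h' ω - W.toFun l' h' ω)) ∂μ
      = (∫ ω, c ω * c' ω ∂μ) * (inner ℝ h h' * leb.real (Ioc l r ∩ Ioc l' r')) := by
  rcases le_total l l' with hll | hll
  · exact integral_mul_increments_of_le (r := r) hlr' hll h h' hc hc' hK hK'
  · have := integral_mul_increments_of_le (r := r') hlr hll h' h hc' hc hK' hK
    rw [inter_comm, real_inner_comm, integral_congr_ae (Eventually.of_forall fun ω =>
      mul_comm (c ω * (W.toFun r h ω - W.toFun l h ω)) _), this]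
    simp only [mul_comm (c' _)]

variable [CompleteSpace H] {F : Type*} [NormedAddCommGroup F] [InnerProductSpace ℝ F]

theorem ElemTerm.aestronglyMeasurable_coef (e : ElemTerm W F) : AEStronglyMeasurable e.coef μ :=
  (e.coef_measurable.mono (W.filtration.le _)).aestronglyMeasurable

theorem ElemTerm.memLp_integral (e : ElemTerm W F) : MemLp e.integral 2 μ := by
  obtain ⟨K, hK⟩ := e.coef_bounded
  have h1 := memLp_mul_increment (W := W) e.left_le_right e.dir e.aestronglyMeasurable_coef hK
  exact MemLp.smul (p := 2) (q := ∞) (r := 2) (memLp_const e.val) h1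

theorem ElemTerm.integrand_eq (e : ElemTerm W F) (u : ℝ≥0) (ω : Ω) :
    e.integrand u ω = ((Ioc e.left e.right).indicator (fun _ => (1 : ℝ)) u * e.coef ω) •
      HS.rankOne e.dir e.val := by
  by_cases hu : u ∈ Ioc e.left e.right <;> simp [ElemTerm.integrand, hu]

theorem ElemTerm.memLp_integrand (e : ElemTerm W F) (a b : ℝ≥0) :
    MemLp (fun p : ℝ≥0 × Ω => e.integrand p.1 p.2) 2 (timeProd μ a b) := by
  obtain ⟨K, hK⟩ := e.coef_bounded
  simp_rw [ElemTerm.integrand_eq]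
  have h1 : StronglyMeasurable fun p : ℝ≥0 × Ω =>
      (Ioc e.left e.right).indicator (fun _ => (1 : ℝ)) p.1 :=
    (stronglyMeasurable_const.indicator measurableSet_Ioc).comp_measurable measurable_fst
  have h2 : StronglyMeasurable fun p : ℝ≥0 × Ω => e.coef p.2 :=
    (e.coef_measurable.mono (W.filtration.le _)).comp_measurable measurable_snd
  refine MemLp.of_bound ((h1.mul h2).smul stronglyMeasurable_const).aestronglyMeasurable
    (K * ‖(HS.rankOne e.dir e.val : HS H F)‖) (Eventually.of_forall fun p => ?_)
  rw [norm_smul, norm_mul]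
  have h3 : ‖(Ioc e.left e.right).indicator (fun _ => (1 : ℝ)) p.1‖ ≤ 1 := by
    by_cases hu : p.1 ∈ Ioc e.left e.right <;> simp [hu]
  refine mul_le_mul_of_nonneg_right ?_ (norm_nonneg _)
  calc _ ≤ 1 * ‖e.coef p.2‖ := mul_le_mul_of_nonneg_right h3 (norm_nonneg _)
    _ ≤ K := by rw [one_mul]; exact hK _

/-- The polarized isometry. Only `e` has to live in (a, b], because the overlap of the two intervals
is then inside (a, b]. -/
theorem ElemTerm.integral_inner_integral (e e' : ElemTerm W F) {a b : ℝ≥0}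
    (ha : a ≤ e.left) (hb : e.right ≤ b) :
    ∫ ω, inner ℝ (e.integral ω) (e'.integral ω) ∂μ
      = ∫ p, inner ℝ (e.integrand p.1 p.2) (e'.integrand p.1 p.2) ∂(timeProd μ a b) := by
  obtain ⟨K, hK⟩ := e.coef_bounded
  obtain ⟨K', hK'⟩ := e'.coef_bounded
  have h1 : ∫ ω, inner ℝ (e.integral ω) (e'.integral ω) ∂μ
      = (∫ ω, e.coef ω * e'.coef ω ∂μ) * (inner ℝ e.dir e'.dir *
        leb.real (Ioc e.left e.right ∩ Ioc e'.left e'.right)) * inner ℝ e.val e'.val := by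
    rw [← integral_mul_increments e.left_le_right e'.left_le_right _ _ e.coef_measurable
      e'.coef_measurable hK hK', ← integral_mul_const]
    refine integral_congr_ae (Eventually.of_forall fun ω => ?_)
    simp only [ElemTerm.integral, real_inner_smul_left, real_inner_smul_right]
    ring
  have h2 : ∀ p : ℝ≥0 × Ω, inner ℝ (e.integrand p.1 p.2) (e'.integrand p.1 p.2)
      = (Ioc e.left e.right ∩ Ioc e'.left e'.right).indicator (fun _ => (1 : ℝ)) p.1 *
        (e.coef p.2 * e'.coef p.2 * (inner ℝ e.dir e'.dir * inner ℝ e.val e'.val)) := by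
    intro p
    have h3 : (Ioc e.left e.right ∩ Ioc e'.left e'.right).indicator (fun _ => (1 : ℝ)) p.1
        = (Ioc e.left e.right).indicator (fun _ => (1 : ℝ)) p.1 *
          (Ioc e'.left e'.right).indicator (fun _ => (1 : ℝ)) p.1 := by
      rw [← inter_indicator_mul, mul_one]
    rw [ElemTerm.integrand_eq, ElemTerm.integrand_eq, real_inner_smul_left, real_inner_smul_right,
      HS.inner_rankOne_rankOne, h3]
    ring
  have h4 := integral_prod_mul (μ := leb.restrict (Ioc a b)) (ν := μ)
    ((Ioc e.left e.right ∩ Ioc e'.left e'.right).indicator (fun _ => (1 : ℝ)))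
    (fun ω => e.coef ω * e'.coef ω * (inner ℝ e.dir e'.dir * inner ℝ e.val e'.val))
  rw [h1, integral_congr_ae (Eventually.of_forall h2), timeProd, h4, integral_indicator_const _ (measurableSet_Ioc.inter measurableSet_Ioc),
    integral_mul_const, measureReal_restrict_apply (measurableSet_Ioc.inter measurableSet_Ioc),
    inter_eq_left.2 (inter_subset_left.trans (Ioc_subset_Ioc ha hb)), smul_eq_mul]
  ring

/-- The integrand of a list of elementary terms. -/
def elemIntegrand (L : List (ElemTerm W F)) (p : ℝ≥0 × Ω) : HS H F :=
  (L.map fun e => e.integrand p.1 p.2).sum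

/-- The stochastic integral of a list of elementary terms. -/
def elemIntegral (L : List (ElemTerm W F)) (ω : Ω) : F :=
  (L.map fun e => e.integral ω).sum

theorem elemIntegrand_cons (e : ElemTerm W F) (L : List (ElemTerm W F)) :
    elemIntegrand (e :: L) = fun p => e.integrand p.1 p.2 + elemIntegrand L p := by
  funext p; simp [elemIntegrand]

theorem elemIntegral_cons (e : ElemTerm W F) (L : List (ElemTerm W F)) :
    elemIntegral (e :: L) = fun ω => e.integral ω + elemIntegral L ω := by
  funext p; simp [elemIntegral]

theorem elemIntegrand_append (L L' : List (ElemTerm W F)) :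
    elemIntegrand (L ++ L') = fun p => elemIntegrand L p + elemIntegrand L' p := by
  funext p; simp [elemIntegrand]

theorem elemIntegral_append (L L' : List (ElemTerm W F)) :
    elemIntegral (L ++ L') = fun ω => elemIntegral L ω + elemIntegral L' ω := by
  funext p; simp [elemIntegral]

theorem memLp_elemIntegrand (L : List (ElemTerm W F)) (a b : ℝ≥0) :
    MemLp (elemIntegrand L) 2 (timeProd μ a b) := by
  induction L with
  | nil => exact MemLp.zero'
  | cons e L ih => rw [elemIntegrand_cons]; exact (e.memLp_integrand a b).add ih

theorem memLp_elemIntegral (L : List (ElemTerm W F)) : MemLp (elemIntegral L) 2 μ := by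
  induction L with
  | nil => exact MemLp.zero'
  | cons e L ih => rw [elemIntegral_cons]; exact e.memLp_integral.add ih

theorem integral_inner_elemIntegral_right (e : ElemTerm W F) {a b : ℝ≥0}
    (ha : a ≤ e.left) (hb : e.right ≤ b) (L : List (ElemTerm W F)) :
    ∫ ω, inner ℝ (e.integral ω) (elemIntegral L ω) ∂μ
      = ∫ p, inner ℝ (e.integrand p.1 p.2) (elemIntegrand L p) ∂(timeProd μ a b) := by
  induction L with
  | nil => simp [elemIntegral, elemIntegrand]
  | cons e' L ih =>
    simp only [elemIntegrand_cons, elemIntegral_cons, inner_add_right]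
    rw [integral_add (MemLp.integrable_inner_two e.memLp_integral e'.memLp_integral)
        (MemLp.integrable_inner_two e.memLp_integral (memLp_elemIntegral L)),
      integral_add (MemLp.integrable_inner_two (e.memLp_integrand a b) (e'.memLp_integrand a b))
        (MemLp.integrable_inner_two (e.memLp_integrand a b) (memLp_elemIntegrand L a b)), ih,
      e.integral_inner_integral e' ha hb]

theorem integral_inner_elemIntegral {a b : ℝ≥0} (L L' : List (ElemTerm W F))
    (hL : ∀ e ∈ L, a ≤ e.left ∧ e.right ≤ b) :
    ∫ ω, inner ℝ (elemIntegral L ω) (elemIntegral L' ω) ∂μ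
      = ∫ p, inner ℝ (elemIntegrand L p) (elemIntegrand L' p) ∂(timeProd μ a b) := by
  induction L with
  | nil => simp [elemIntegral, elemIntegrand]
  | cons e L ih =>
    have he := hL e (by simp)
    simp only [elemIntegrand_cons, elemIntegral_cons, inner_add_left]
    rw [integral_add (MemLp.integrable_inner_two e.memLp_integral (memLp_elemIntegral L'))
        (MemLp.integrable_inner_two (memLp_elemIntegral L) (memLp_elemIntegral L')),
      integral_add (MemLp.integrable_inner_two (e.memLp_integrand a b) (memLp_elemIntegrand L' a b))
        (MemLp.integrable_inner_two (memLp_elemIntegrand L a b) (memLp_elemIntegrand L' a b)),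
      ih fun e' he' => hL e' (by simp [he']), integral_inner_elemIntegral_right e he.1 he.2]

/-- The Itô isometry for elementary integrands. -/
theorem eLpNorm_elemIntegral {a b : ℝ≥0} (L : List (ElemTerm W F))
    (hL : ∀ e ∈ L, a ≤ e.left ∧ e.right ≤ b) :
    eLpNorm (elemIntegral L) 2 μ = eLpNorm (elemIntegrand L) 2 (timeProd μ a b) := by
  refine eLpNorm_two_eq_of_lintegral_eq ?_
  rw [MemLp.lintegral_enorm_sq (memLp_elemIntegral L),
    MemLp.lintegral_enorm_sq (memLp_elemIntegrand L a b)]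
  simp_rw [← real_inner_self_eq_norm_sq]
  rw [integral_inner_elemIntegral L L hL]

end Elementary

/-! ### Dominated convergence in L² -/

section Dominated

variable {α E : Type*} [MeasurableSpace α] {μ : Measure α} [NormedAddCommGroup E]

theorem tendsto_of_tendsto_sq_zero {ι : Type*} {l : Filter ι} {x : ι → ℝ≥0∞}
    (h : Tendsto (fun n => x n ^ 2) l (𝓝 0)) : Tendsto x l (𝓝 0) := by
  have h1 := (ENNReal.continuous_rpow_const (y := (1 / 2 : ℝ))).tendsto 0 |>.comp h
  rw [ENNReal.zero_rpow_of_pos (by norm_num)] at h1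
  refine h1.congr fun n => ?_
  simp only [Function.comp]
  rw [← ENNReal.rpow_natCast, ← ENNReal.rpow_mul]
  norm_num

theorem tendsto_eLpNorm_two_zero_of_dominated {f : ℕ → α → E} {g : α → ℝ}
    (hf : ∀ n, AEStronglyMeasurable (f n) μ) (hg : MemLp g 2 μ)
    (hb : ∀ n, ∀ᵐ x ∂μ, ‖f n x‖ ≤ g x)
    (hlim : ∀ᵐ x ∂μ, Tendsto (fun n => f n x) atTop (𝓝 0)) :
    Tendsto (fun n => eLpNorm (f n) 2 μ) atTop (𝓝 0) := by
  refine tendsto_of_tendsto_sq_zero ?_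
  simp_rw [eLpNorm_two_sq]
  rw [← lintegral_zero (μ := μ)]
  refine tendsto_lintegral_of_dominated_convergence' (fun x => ‖g x‖ₑ ^ 2)
    (fun n => (hf n).enorm.pow_const 2) (fun n => ?_) ?_ ?_
  · filter_upwards [hb n] with x hx
    have : ‖f n x‖ₑ ≤ ‖g x‖ₑ := by
      rw [enorm_le_iff_norm_le]
      exact hx.trans (le_abs_self _)
    gcongr
  · rw [← eLpNorm_two_sq]
    exact ENNReal.pow_ne_top hg.2.ne
  · filter_upwards [hlim] with x hx
    have h1 : Tendsto (fun n => ‖f n x‖ₑ) atTop (𝓝 0) := by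
      have := (continuous_enorm.tendsto (0 : E)).comp hx
      rwa [enorm_zero] at this
    simpa using ENNReal.Tendsto.pow (n := 2) h1

end Dominated

/-! ### Uniform time grids and averages over the preceding cell -/

section Grid

/-- The points `a + k (b - a) / (n + 1)`. -/
def gridPt (a b : ℝ≥0) (n k : ℕ) : ℝ≥0 := a + k * ((b - a) / (n + 1))

theorem gridPt_zero (a b : ℝ≥0) (n : ℕ) : gridPt a b n 0 = a := by simp [gridPt]

theorem gridPt_last {a b : ℝ≥0} (hab : a ≤ b) (n : ℕ) : gridPt a b n (n + 1) = b := by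
  have : ((n : ℝ≥0) + 1) ≠ 0 := by positivity
  rw [gridPt, Nat.cast_add, Nat.cast_one, mul_div_cancel₀ _ this, add_tsub_cancel_of_le hab]

theorem gridPt_mono (a b : ℝ≥0) (n : ℕ) : Monotone (gridPt a b n) := by
  intro k k' h
  unfold gridPt
  have : (k : ℝ≥0) ≤ k' := Nat.cast_le.2 h
  gcongr

theorem coe_gridPt {a b : ℝ≥0} (hab : a ≤ b) (n k : ℕ) :
    (gridPt a b n k : ℝ) = a + k * ((b - a) / (n + 1)) := by
  simp [gridPt, NNReal.coe_sub hab]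

theorem le_gridPt (a b : ℝ≥0) (n k : ℕ) : a ≤ gridPt a b n k := by
  simp [gridPt]

theorem gridPt_le {a b : ℝ≥0} (hab : a ≤ b) {n k : ℕ} (hk : k ≤ n + 1) : gridPt a b n k ≤ b :=
  (gridPt_mono a b n hk).trans (gridPt_last hab n).le

theorem exists_mem_Ioc_gridPt {a b u : ℝ≥0} (hab : a ≤ b) (hu : u ∈ Ioc a b) (n : ℕ) :
    ∃ k < n + 1, u ∈ Ioc (gridPt a b n k) (gridPt a b n (k + 1)) := by
  classical
  have hex : ∃ j, u ≤ gridPt a b n j := ⟨n + 1, by rw [gridPt_last hab]; exact hu.2⟩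
  have h0 : Nat.find hex ≠ 0 := by
    intro h
    have := Nat.find_spec hex
    rw [h, gridPt_zero] at this
    exact absurd hu.1 (not_lt.2 this)
  obtain ⟨k, hk⟩ := Nat.exists_eq_succ_of_ne_zero h0
  refine ⟨k, ?_, ?_, ?_⟩
  · have : Nat.find hex ≤ n + 1 := Nat.find_min' hex (by rw [gridPt_last hab]; exact hu.2)
    omega
  · exact not_le.1 (Nat.find_min hex (by omega))
  · have := Nat.find_spec hex
    rwa [hk] at this

theorem sum_indicator_gridPt {a b u : ℝ≥0} {n k : ℕ} (hk : k < n + 1)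
    (hu : u ∈ Ioc (gridPt a b n k) (gridPt a b n (k + 1))) (c : ℕ → ℝ) :
    ∑ j ∈ Finset.range (n + 1),
      (Ioc (gridPt a b n j) (gridPt a b n (j + 1))).indicator (fun _ => (1 : ℝ)) u * c j = c k := by
  rw [Finset.sum_eq_single k]
  · simp [hu]
  · intro j _ hj
    have := (gridPt_mono a b n).pairwise_disjoint_on_Ioc_succ hj
    have hu' : u ∉ Ioc (gridPt a b n j) (gridPt a b n (j + 1)) :=
      fun h => disjoint_left.1 this h hu
    simp [hu']
  · intro h
    exact absurd (Finset.mem_range.2 hk) h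

/-- The half mesh of the grid. -/
def halfMesh (a b : ℝ≥0) (n : ℕ) : ℝ := ((b : ℝ) - a) / (n + 1) / 2

theorem halfMesh_pos {a b : ℝ≥0} (hab : a < b) (n : ℕ) : 0 < halfMesh a b n := by
  have : (0 : ℝ) < (b : ℝ) - a := sub_pos.2 (NNReal.coe_lt_coe.2 hab)
  unfold halfMesh
  positivity

theorem tendsto_halfMesh {a b : ℝ≥0} (hab : a < b) :
    Tendsto (halfMesh a b) atTop (𝓝[>] 0) := by
  refine tendsto_nhdsWithin_iff.2 ⟨?_, Eventually.of_forall fun n => halfMesh_pos hab n⟩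
  have h1 := (tendsto_one_div_add_atTop_nhds_zero_nat (𝕜 := ℝ)).const_mul (((b : ℝ) - a) / 2)
  rw [mul_zero] at h1
  refine h1.congr fun n => ?_
  unfold halfMesh
  ring

/-- The interval preceding the `k`-th grid point. -/
def lagBall (a b : ℝ≥0) (n k : ℕ) : Set ℝ :=
  Metric.closedBall (gridPt a b n k - halfMesh a b n) (halfMesh a b n)

theorem le_of_mem_lagBall {a b : ℝ≥0} {n k : ℕ} {x : ℝ} (hx : x ∈ lagBall a b n k) :
    x ≤ gridPt a b n k := by
  rw [lagBall, Real.closedBall_eq_Icc] at hx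
  linarith [hx.2]

theorem ae_tendsto_lag_average {a b : ℝ≥0} (hab : a < b) {g : ℝ → ℝ}
    (hg : LocallyIntegrable g volume) :
    ∀ᵐ u ∂(leb.restrict (Ioc a b)), ∀ k : ℕ → ℕ,
      (∀ n, u ∈ Ioc (gridPt a b n (k n)) (gridPt a b n (k n + 1))) →
      Tendsto (fun n => ⨍ x in lagBall a b n (k n), g x) atTop (𝓝 (g u)) := by
  -- The balls do not contain `u`, but a point of the cell after a ball of radius r lies within 3r
  -- of its centre, and Lebesgue differentiation allows such off-centre balls. The exceptional null
  -- set does not depend on the choice of `k`.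
  have h1 := ae_restrict_of_ae (s := Ioc (a : ℝ) b)
    (IsUnifLocDoublingMeasure.ae_tendsto_average (μ := (volume : Measure ℝ)) hg 3)
  rw [← map_coe_leb_restrict, measurableEmbedding_coe_nnreal.ae_map_iff] at h1
  filter_upwards [h1] with u hu k hk
  refine hu _ _ (tendsto_halfMesh hab) (Eventually.of_forall fun n => ?_)
  have h2 := NNReal.coe_lt_coe.2 (hk n).1
  have h3 := NNReal.coe_le_coe.2 (hk n).2
  rw [coe_gridPt hab.le] at h2 h3
  have h4 := halfMesh_pos hab n
  rw [Metric.mem_closedBall, Real.dist_eq, coe_gridPt hab.le]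
  have h5 : ((b : ℝ) - a) / (n + 1) = 2 * halfMesh a b n := by unfold halfMesh; ring
  rw [h5] at h2 h3 ⊢
  push_cast at h3
  rw [abs_le]
  constructor <;> linarith

end Grid

/-! ### Measurability of time averages -/

section Average

variable {Ω : Type*} {m mΩ : MeasurableSpace Ω} {μ : Measure Ω} [IsProbabilityMeasure μ]

theorem abs_setAverage_le {g : ℝ → ℝ} {K : ℝ} (hK : ∀ x, |g x| ≤ K) (B : Set ℝ)
    (hB : volume B < ∞) : |⨍ x in B, g x| ≤ K := by
  have hK0 : 0 ≤ K := (abs_nonneg _).trans (hK 0)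
  rw [setAverage_eq, smul_eq_mul, abs_mul, abs_inv, abs_of_nonneg measureReal_nonneg]
  have h1 : |∫ x in B, g x| ≤ K * volume.real B :=
    norm_setIntegral_le_of_norm_le_const (f := g) hB fun x _ => hK x
  calc _ ≤ (volume.real B)⁻¹ * (K * volume.real B) := by gcongr
    _ = K * ((volume.real B)⁻¹ * volume.real B) := by ring
    _ ≤ K * 1 := by gcongr; exact inv_mul_le_one
    _ = K := mul_one K

theorem integral_mul_eq_zero_of_condExp (hm : m ≤ mΩ) {Z Y : Ω → ℝ} (hZ : Integrable Z μ)
    (h0 : μ[Z | m] =ᵐ[μ] 0) (hY : StronglyMeasurable[m] Y) (hYZ : Integrable (Y * Z) μ) :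
    ∫ ω, Y ω * Z ω ∂μ = 0 := by
  have h1 : ∫ ω, (μ[Y * Z | m]) ω ∂μ = ∫ ω, (Y * Z) ω ∂μ := integral_condExp hm
  have h2 := condExp_mul_of_stronglyMeasurable_left hY hYZ hZ
  have h3 : ∫ ω, (μ[Y * Z | m]) ω ∂μ = 0 := by
    rw [integral_eq_zero_of_ae]
    filter_upwards [h0, h2] with ω hω h2ω
    simp [h2ω, hω]
  rw [← h3, h1]
  rfl

/-- A time average of random variables that are a.s. `m`-measurable is a.s. `m`-measurable. -/
theorem average_ae_eq_condExp (hm : m ≤ mΩ) {G : ℝ × Ω → ℝ} (hG : StronglyMeasurable G) {K : ℝ}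
    (hK : ∀ p, |G p| ≤ K) {B : Set ℝ} (hBf : volume B < ∞)
    (hB : ∀ᵐ x ∂(volume.restrict B), ∃ Y : Ω → ℝ, StronglyMeasurable[m] Y ∧
      (fun ω => G (x, ω)) =ᵐ[μ] Y) :
    (fun ω => ⨍ x in B, G (x, ω)) =ᵐ[μ] μ[fun ω => ⨍ x in B, G (x, ω) | m] := by
  have : IsFiniteMeasure (volume.restrict B) := ⟨by rwa [Measure.restrict_apply_univ]⟩
  set c : Ω → ℝ := fun ω => ⨍ x in B, G (x, ω) with hc
  have hcK : ∀ ω, |c ω| ≤ K := fun ω => abs_setAverage_le (fun x => hK (x, ω)) B hBf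
  have hcm : StronglyMeasurable c := by
    have h1 : StronglyMeasurable fun ω => ∫ x in B, G (x, ω) :=
      StronglyMeasurable.integral_prod_left (f := fun x ω => G (x, ω)) hG
    simp_rw [hc, setAverage_eq]
    exact h1.const_smul (volume.real B)⁻¹
  have hci : Integrable c μ := Integrable.of_bound hcm.aestronglyMeasurable K
    (Eventually.of_forall hcK)
  set e := μ[c | m] with he
  have heK : ∀ᵐ ω ∂μ, |e ω| ≤ K := by
    exact ae_bdd_abs_condExp_of_ae_bdd_abs (Eventually.of_forall hcK)
  -- The aim is E[Z²] = 0. `Z` is orthogonal to bounded `m`-measurable variables, in particular to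
  -- `e`. By Fubini it is orthogonal to `c` as well, since almost every time slice of `G` is almost
  -- surely equal to such a variable.
  set Z : Ω → ℝ := c - e with hZ
  have hZi : Integrable Z μ := hci.sub integrable_condExp
  have hZm : AEStronglyMeasurable Z μ := hZi.1
  have hZK : ∀ᵐ ω ∂μ, ‖Z ω‖ ≤ K + K := by
    filter_upwards [heK] with ω h
    exact (norm_sub_le _ _).trans (add_le_add (hcK ω) h)
  have hZ0 : μ[Z | m] =ᵐ[μ] 0 := by
    have h1 := condExp_sub hci (integrable_condExp (f := c) (m := m) (μ := μ)) m
    have h2 : μ[e | m] = e := condExp_of_stronglyMeasurable hm stronglyMeasurable_condExp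
      integrable_condExp
    filter_upwards [h1] with ω hω
    rw [hω, h2]
    simp [he]
  have key : ∀ Y : Ω → ℝ, StronglyMeasurable[m] Y → (∀ᵐ ω ∂μ, |Y ω| ≤ K) →
      ∫ ω, Y ω * Z ω ∂μ = 0 := by
    intro Y hY hYK
    exact integral_mul_eq_zero_of_condExp hm hZi hZ0 hY
      (hZi.bdd_mul (hY.mono hm).aestronglyMeasurable hYK)
  have h1 : ∫ ω, e ω * Z ω ∂μ = 0 := key e stronglyMeasurable_condExp heK
  have h2 : ∫ ω, c ω * Z ω ∂μ = 0 := by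
    have hint : Integrable (fun p : Ω × ℝ => G (p.2, p.1) * Z p.1)
        (μ.prod (volume.restrict B)) := by
      have h3 : Integrable (fun p : Ω × ℝ => Z p.1) (μ.prod (volume.restrict B)) :=
        hZi.comp_fst _
      exact h3.bdd_mul (c := K) (hG.comp_measurable measurable_swap).aestronglyMeasurable
        (Eventually.of_forall fun p => hK _)
    have h4 : ∀ ω, c ω * Z ω = (volume.real B)⁻¹ * ∫ x in B, G (x, ω) * Z ω := by
      intro ω
      rw [integral_mul_const, hc]
      simp only [setAverage_eq, smul_eq_mul]
      ring
    simp_rw [h4]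
    rw [integral_const_mul, integral_integral_swap hint]
    have h5 : ∀ᵐ x ∂(volume.restrict B), ∫ ω, G (x, ω) * Z ω ∂μ = 0 := by
      filter_upwards [hB] with x ⟨Y, hY, hxY⟩
      rw [← key Y hY (by filter_upwards [hxY] with ω hω; rw [← hω]; exact hK _)]
      refine integral_congr_ae ?_
      filter_upwards [hxY] with ω hω
      rw [hω]
    rw [integral_congr_ae h5]
    simp
  have h3 : ∫ ω, Z ω * Z ω ∂μ = 0 := by
    have h4 : ∀ ω, Z ω * Z ω = c ω * Z ω - e ω * Z ω := fun ω => by simp [hZ]; ring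
    simp_rw [h4]
    rw [integral_sub (hZi.bdd_mul hcm.aestronglyMeasurable (Eventually.of_forall hcK))
      (hZi.bdd_mul integrable_condExp.1 heK), h1, h2, sub_zero]
  have h4 := (integral_eq_zero_iff_of_nonneg (fun ω => mul_self_nonneg (Z ω))
    (hZi.bdd_mul hZm hZK)).1 h3
  filter_upwards [h4] with ω hω
  have : Z ω = 0 := mul_self_eq_zero.1 hω
  simpa [hZ, sub_eq_zero] using this

end Average

/-! ### Approximation of bounded adapted processes by adapted step processes -/

section StepApprox

variable {Ω : Type*} [mΩ : MeasurableSpace Ω] {μ : Measure Ω} [IsProbabilityMeasure μ]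

/-- Truncation of a real number to `[-K, K]`. -/
def clamp (K x : ℝ) : ℝ := max (-K) (min K x)

theorem abs_clamp_le {K : ℝ} (hK : 0 ≤ K) (x : ℝ) : |clamp K x| ≤ K :=
  abs_le.2 ⟨le_max_left _ _, max_le (by linarith) (min_le_left _ _)⟩

theorem clamp_eq {K x : ℝ} (h : |x| ≤ K) : clamp K x = x := by
  rw [abs_le] at h
  rw [clamp, min_eq_right h.2, max_eq_right h.1]

theorem continuous_clamp (K : ℝ) : Continuous (clamp K) := by
  unfold clamp; fun_prop

/-- On each cell the process is replaced by its average over the preceding cell. The average looks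
only into the past, so the step process is adapted up to null sets. It converges almost everywhere
by Lebesgue differentiation, hence in L² by boundedness. -/
theorem exists_step_approx (ℱ : Filtration ℝ≥0 mΩ) {a b : ℝ≥0} (hab : a < b)
    {φ : ℝ≥0 × Ω → ℝ} {K : ℝ} (hK : ∀ p, |φ p| ≤ K)
    (hm : AEStronglyMeasurable φ (timeProd μ a b))
    (had : ∀ u ∈ Icc a b, StronglyMeasurable[ℱ u] fun ω => φ (u, ω)) :
    ∃ c : ℕ → ℕ → Ω → ℝ,
      (∀ n k, StronglyMeasurable[ℱ (gridPt a b n k)] (c n k)) ∧ (∀ n k ω, |c n k ω| ≤ K) ∧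
      Tendsto (fun n => eLpNorm (fun p => (∑ k ∈ Finset.range (n + 1),
        (Ioc (gridPt a b n k) (gridPt a b n (k + 1))).indicator (fun _ => (1 : ℝ)) p.1 *
          c n k p.2) - φ p) 2 (timeProd μ a b)) atTop (𝓝 0) := by
  rcases isEmpty_or_nonempty Ω with hΩ | hΩ
  · exact ⟨fun _ _ _ => 0, fun _ _ => stronglyMeasurable_const, fun _ _ ω => hΩ.elim ω, by
      simp [timeProd, Measure.eq_zero_of_isEmpty]⟩
  have hK0 : 0 ≤ K := (abs_nonneg _).trans (hK (0, Classical.arbitrary Ω))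
  set ψ : ℝ≥0 × Ω → ℝ := fun p => clamp K (hm.mk φ p) with hψ
  have hψm : StronglyMeasurable ψ := (continuous_clamp K).comp_stronglyMeasurable
    hm.stronglyMeasurable_mk
  have hψK : ∀ p, |ψ p| ≤ K := fun p => abs_clamp_le hK0 _
  have hψφ : ψ =ᵐ[timeProd μ a b] φ := by
    filter_upwards [hm.ae_eq_mk] with p hp
    rw [hψ]
    simp only
    rw [← hp, clamp_eq (hK p)]
  -- Extension by 0 before `a` makes the coefficient of the first cell vanish, which has no
  -- predecessor inside (a, b].
  set G : ℝ × Ω → ℝ := (Ioc (a : ℝ) b ×ˢ (univ : Set Ω)).indicator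
    fun p => ψ (p.1.toNNReal, p.2) with hGdef
  have hG : StronglyMeasurable G :=
    (hψm.comp_measurable (measurable_real_toNNReal.comp measurable_fst |>.prodMk
      measurable_snd)).indicator (measurableSet_Ioc.prod MeasurableSet.univ)
  have hGK : ∀ p, |G p| ≤ K := by
    intro p
    by_cases hp : p ∈ Ioc (a : ℝ) b ×ˢ (univ : Set Ω)
    · rw [hGdef, indicator_of_mem hp]; exact hψK _
    · rw [hGdef, indicator_of_notMem hp, abs_zero]; exact hK0
  have hGu : ∀ u ∈ Ioc a b, ∀ ω, G ((u : ℝ), ω) = ψ (u, ω) := by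
    intro u hu ω
    have : ((u : ℝ), ω) ∈ Ioc (a : ℝ) b ×ˢ (univ : Set Ω) :=
      ⟨⟨NNReal.coe_lt_coe.2 hu.1, NNReal.coe_le_coe.2 hu.2⟩, mem_univ _⟩
    rw [hGdef, indicator_of_mem this, Real.toNNReal_coe]
  have hGae : ∀ᵐ x ∂(volume.restrict (Ioc (a : ℝ) b)),
      (fun ω => G (x, ω)) =ᵐ[μ] fun ω => φ (x.toNNReal, ω) := by
    rw [← map_coe_leb_restrict, measurableEmbedding_coe_nnreal.ae_map_iff]
    have h1 : ∀ᵐ u ∂(leb.restrict (Ioc a b)), ∀ᵐ ω ∂μ, ψ (u, ω) = φ (u, ω) :=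
      Measure.ae_ae_of_ae_prod hψφ
    filter_upwards [h1, ae_restrict_mem measurableSet_Ioc] with u hu hu'
    filter_upwards [hu] with ω hω
    rw [hGu u hu', hω, Real.toNNReal_coe]
  set d : ℕ → ℕ → Ω → ℝ := fun n k ω => ⨍ x in lagBall a b n k, G (x, ω) with hd
  have hdm : ∀ n k, StronglyMeasurable (d n k) := by
    intro n k
    have h1 : StronglyMeasurable fun ω => ∫ x in lagBall a b n k, G (x, ω) :=
      StronglyMeasurable.integral_prod_left (f := fun x ω => G (x, ω)) hG
    simp_rw [hd, setAverage_eq]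
    exact h1.const_smul (volume.real (lagBall a b n k))⁻¹
  have hballfin : ∀ n k, volume (lagBall a b n k) < ∞ := fun n k =>
    measure_closedBall_lt_top
  have hdK : ∀ n k ω, |d n k ω| ≤ K := fun n k ω =>
    abs_setAverage_le (fun x => hGK (x, ω)) _ (hballfin n k)
  -- The conditional expectation replaces an average that is measurable only up to null sets by a
  -- truly measurable one; clamping makes its bound hold for every ω.
  set c : ℕ → ℕ → Ω → ℝ := fun n k ω => clamp K ((μ[d n k | ℱ (gridPt a b n k)]) ω) with hc
  have hdc : ∀ n k, k < n + 1 → d n k =ᵐ[μ] c n k := by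
    intro n k hk
    have h1 := average_ae_eq_condExp (μ := μ) (ℱ.le (gridPt a b n k)) hG hGK (hballfin n k) (by
      have h2 : ∀ᵐ x : ℝ, x ∈ Ioc (a : ℝ) b →
        (fun ω => G (x, ω)) =ᵐ[μ] fun ω => φ (x.toNNReal, ω) :=
        (ae_restrict_iff' measurableSet_Ioc).1 hGae
      filter_upwards [ae_restrict_of_ae h2, ae_restrict_mem
        (Metric.isClosed_closedBall.measurableSet)] with x hx hxB
      by_cases hxI : x ∈ Ioc (a : ℝ) b
      · refine ⟨_, ?_, hx hxI⟩
        have h3 : x.toNNReal ≤ gridPt a b n k :=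
          Real.toNNReal_le_iff_le_coe.2 (le_of_mem_lagBall hxB)
        refine (had _ ⟨?_, h3.trans (gridPt_le hab.le hk.le)⟩).mono (ℱ.mono h3)
        exact NNReal.le_toNNReal_of_coe_le hxI.1.le
      · refine ⟨0, stronglyMeasurable_zero, Eventually.of_forall fun ω => ?_⟩
        have : (x, ω) ∉ Ioc (a : ℝ) b ×ˢ (univ : Set Ω) := fun h => hxI h.1
        simp only [hGdef]
        rw [indicator_of_notMem this]
        rfl)
    filter_upwards [h1] with ω hω
    change d n k ω = (μ[d n k | ℱ (gridPt a b n k)]) ω at hω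
    change d n k ω = clamp K ((μ[d n k | ℱ (gridPt a b n k)]) ω)
    rw [← hω, clamp_eq (hdK n k ω)]
  refine ⟨c, fun n k => (continuous_clamp K).comp_stronglyMeasurable stronglyMeasurable_condExp,
    fun n k ω => abs_clamp_le hK0 _, ?_⟩
  set S : ℕ → ℝ≥0 × Ω → ℝ := fun n p => (∑ k ∈ Finset.range (n + 1),
        (Ioc (gridPt a b n k) (gridPt a b n (k + 1))).indicator (fun _ => (1 : ℝ)) p.1 *
          d n k p.2) with hS
  have hSm : ∀ n, StronglyMeasurable (S n) := by
    intro n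
    refine Finset.stronglyMeasurable_fun_sum _ fun k _ => ?_
    exact ((stronglyMeasurable_const.indicator measurableSet_Ioc).comp_measurable
      measurable_fst).mul ((hdm n k).comp_measurable measurable_snd)
  have hlim : ∀ᵐ p ∂(timeProd μ a b), Tendsto (fun n => S n p) atTop (𝓝 (ψ p)) := by
    -- Differentiation gives convergence for almost every time with ω fixed; measurability of the
    -- convergence set lets Fubini turn this into convergence almost everywhere on the product.
    have hmeas : MeasurableSet {p : ℝ≥0 × Ω | Tendsto (fun n => S n p - ψ p) atTop (𝓝 0)} :=
      measurableSet_tendsto _ fun n => ((hSm n).sub hψm).measurable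
    have hmain : ∀ᵐ ω ∂μ, ∀ᵐ u ∂(leb.restrict (Ioc a b)),
        Tendsto (fun n => S n (u, ω) - ψ (u, ω)) atTop (𝓝 0) := by
      refine Eventually.of_forall fun ω => ?_
      have hloc : LocallyIntegrable (fun x => G (x, ω)) volume := by
        refine (locallyIntegrable_const K).mono
          (hG.comp_measurable (measurable_id.prodMk measurable_const)).aestronglyMeasurable
          (Eventually.of_forall fun x => ?_)
        rw [Real.norm_eq_abs, Real.norm_eq_abs, abs_of_nonneg hK0]
        exact hGK _
      filter_upwards [ae_tendsto_lag_average hab hloc, ae_restrict_mem measurableSet_Ioc]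
        with u hu huI
      choose k hk1 hk2 using exists_mem_Ioc_gridPt hab.le huI
      have h1 := hu k hk2
      rw [hGu u huI] at h1
      have h2 : Tendsto (fun n => S n (u, ω)) atTop (𝓝 (ψ (u, ω))) := by
        refine h1.congr fun n => ?_
        simp only [hS]
        rw [sum_indicator_gridPt (hk1 n) (hk2 n) fun j => d n j ω]
      simpa using h2.sub_const (ψ (u, ω))
    have h1 : ∀ᵐ p ∂(timeProd μ a b), Tendsto (fun n => S n p - ψ p) atTop (𝓝 0) := by
      rw [timeProd, Measure.ae_prod_iff_ae_ae hmeas]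
      rw [Measure.ae_ae_comm hmeas]
      exact hmain
    filter_upwards [h1] with p hp
    simpa using hp.add_const (ψ p)
  have hbound : ∀ n, ∀ᵐ p ∂(timeProd μ a b), ‖S n p - ψ p‖ ≤ K + K := by
    intro n
    have hmemI : ∀ᵐ p ∂(timeProd μ a b), p.1 ∈ Ioc a b :=
      Measure.quasiMeasurePreserving_fst.ae (ae_restrict_mem measurableSet_Ioc)
    filter_upwards [hmemI] with p hp
    obtain ⟨k, hk1, hk2⟩ := exists_mem_Ioc_gridPt hab.le hp n
    refine (norm_sub_le _ _).trans (add_le_add ?_ (hψK p))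
    simp only [hS]
    rw [sum_indicator_gridPt hk1 hk2 fun j => d n j p.2]
    exact hdK n k p.2
  have hfin := tendsto_eLpNorm_two_zero_of_dominated (μ := timeProd μ a b)
    (f := fun n p => S n p - ψ p) (g := fun _ => K + K)
    (fun n => ((hSm n).sub hψm).aestronglyMeasurable) (memLp_const _) hbound (by
      filter_upwards [hlim] with p hp
      simpa using hp.sub_const (ψ p))
  refine hfin.congr fun n => eLpNorm_congr_ae ?_
  have hdc' : ∀ᵐ p ∂(timeProd μ a b), ∀ k ∈ Finset.range (n + 1), d n k p.2 = c n k p.2 := by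
    refine ae_all_iff.2 fun k => ?_
    by_cases hk : k < n + 1
    · filter_upwards [Measure.quasiMeasurePreserving_snd.ae (hdc n k hk)] with p hp _ using hp
    · exact Eventually.of_forall fun p h => absurd (Finset.mem_range.1 h) hk
  filter_upwards [hψφ, hdc'] with p hp1 hp2
  simp only [hS]
  rw [hp1]
  congr 1
  exact Finset.sum_congr rfl fun k hk => by rw [hp2 k hk]

end StepApprox

/-! ### Density of elementary integrands -/

section ElemApprox

variable {Ω : Type*} [mΩ : MeasurableSpace Ω] {μ : Measure Ω} [IsProbabilityMeasure μ]
  {H : Type*} [NormedAddCommGroup H] [InnerProductSpace ℝ H] [CompleteSpace H]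
  {F : Type*} [NormedAddCommGroup F] [InnerProductSpace ℝ F]
  {W : CylindricalWiener H μ} {a b : ℝ≥0}

/-- `Φ` is in the `L²((a, b] × Ω)` closure of the elementary integrands on `(a, b]`. -/
def ElemApprox (W : CylindricalWiener H μ) (a b : ℝ≥0) (Φ : ℝ≥0 × Ω → HS H F) : Prop :=
  ∀ ε : ℝ≥0∞, 0 < ε → ∃ L : List (ElemTerm W F), (∀ e ∈ L, a ≤ e.left ∧ e.right ≤ b) ∧
    eLpNorm (fun p => elemIntegrand L p - Φ p) 2 (timeProd μ a b) ≤ ε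

theorem ElemApprox.of_tendsto {Φ : ℝ≥0 × Ω → HS H F} {Ψ : ℕ → ℝ≥0 × Ω → HS H F}
    (hΨ : ∀ n, ElemApprox W a b (Ψ n)) (hΨm : ∀ n, AEStronglyMeasurable (Ψ n) (timeProd μ a b))
    (hΦm : AEStronglyMeasurable Φ (timeProd μ a b))
    (h : Tendsto (fun n => eLpNorm (fun p => Ψ n p - Φ p) 2 (timeProd μ a b)) atTop (𝓝 0)) :
    ElemApprox W a b Φ := by
  intro ε hε
  have hε2 : 0 < ε / 2 := ENNReal.half_pos hε.ne'
  obtain ⟨n, hn⟩ := (h.eventually_lt_const hε2).exists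
  obtain ⟨L, hL, hL2⟩ := hΨ n (ε / 2) hε2
  refine ⟨L, hL, ?_⟩
  have h1 : (fun p => elemIntegrand L p - Φ p)
      = (fun p => elemIntegrand L p - Ψ n p) + fun p => Ψ n p - Φ p := by
    funext p; simp
  rw [h1]
  calc _ ≤ _ := eLpNorm_add_le ((memLp_elemIntegrand L a b).1.sub (hΨm n)) ((hΨm n).sub hΦm)
        (by norm_num)
    _ ≤ ε / 2 + ε / 2 := add_le_add hL2 hn.le
    _ = ε := ENNReal.add_halves ε

theorem ElemApprox.zero : ElemApprox W a b (fun _ => (0 : HS H F)) := by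
  intro ε hε
  refine ⟨[], by simp, ?_⟩
  simp [elemIntegrand]

theorem ElemApprox.add {Φ Ψ : ℝ≥0 × Ω → HS H F} (hΦ : ElemApprox W a b Φ)
    (hΨ : ElemApprox W a b Ψ) (hΦm : AEStronglyMeasurable Φ (timeProd μ a b))
    (hΨm : AEStronglyMeasurable Ψ (timeProd μ a b)) :
    ElemApprox W a b fun p => Φ p + Ψ p := by
  intro ε hε
  have hε2 : 0 < ε / 2 := ENNReal.half_pos hε.ne'
  obtain ⟨L, hL, hL2⟩ := hΦ (ε / 2) hε2
  obtain ⟨L', hL', hL2'⟩ := hΨ (ε / 2) hε2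
  refine ⟨L ++ L', fun e he => (List.mem_append.1 he).elim (hL e) (hL' e), ?_⟩
  have h1 : (fun p => elemIntegrand (L ++ L') p - (Φ p + Ψ p))
      = (fun p => elemIntegrand L p - Φ p) + fun p => elemIntegrand L' p - Ψ p := by
    funext p; simp only [elemIntegrand_append, Pi.add_apply]; abel
  rw [h1]
  calc _ ≤ _ := eLpNorm_add_le ((memLp_elemIntegrand L a b).1.sub hΦm)
        ((memLp_elemIntegrand L' a b).1.sub hΨm) (by norm_num)
    _ ≤ ε / 2 + ε / 2 := add_le_add hL2 hL2'
    _ = ε := ENNReal.add_halves ε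

theorem ElemApprox.sum {ι : Type*} (S : Finset ι) {Φ : ι → ℝ≥0 × Ω → HS H F}
    (hΦ : ∀ i, ElemApprox W a b (Φ i))
    (hΦm : ∀ i, AEStronglyMeasurable (Φ i) (timeProd μ a b)) :
    ElemApprox W a b fun p => ∑ i ∈ S, Φ i p := by
  classical
  induction S using Finset.induction_on with
  | empty => simpa using ElemApprox.zero
  | insert i S hi ih =>
    simp_rw [Finset.sum_insert hi]
    exact (hΦ i).add ih (hΦm i) (Finset.aestronglyMeasurable_fun_sum _ fun i _ => hΦm i)

theorem ElemApprox.smul_rankOne_of_bounded (hab : a ≤ b) (h : H) (y : F) {φ : ℝ≥0 × Ω → ℝ} {K : ℝ}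
    (hK : ∀ p, |φ p| ≤ K) (hm : AEStronglyMeasurable φ (timeProd μ a b))
    (had : ∀ u ∈ Icc a b, StronglyMeasurable[W.filtration u] fun ω => φ (u, ω)) :
    ElemApprox W a b fun p => φ p • HS.rankOne h y := by
  rcases hab.eq_or_lt with rfl | hab
  · intro ε hε
    exact ⟨[], by simp, by simp [timeProd]⟩
  obtain ⟨c, hc1, hc2, hc3⟩ := exists_step_approx W.filtration hab hK hm had
  intro ε hε
  have h1 : Tendsto (fun n => eLpNorm (fun p => (∑ k ∈ Finset.range (n + 1),
        (Ioc (gridPt a b n k) (gridPt a b n (k + 1))).indicator (fun _ => (1 : ℝ)) p.1 *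
          c n k p.2) - φ p) 2 (timeProd μ a b) * ‖(HS.rankOne h y : HS H F)‖ₑ) atTop (𝓝 0) := by
    have := ENNReal.Tendsto.mul_const (b := ‖(HS.rankOne h y : HS H F)‖ₑ) hc3
      (Or.inr enorm_ne_top)
    rwa [zero_mul] at this
  obtain ⟨n, hn⟩ := (h1.eventually_lt_const hε).exists
  let term : ℕ → ElemTerm W F := fun k =>
    { left := gridPt a b n k
      right := gridPt a b n (k + 1)
      left_le_right := gridPt_mono a b n (Nat.le_succ k)
      coef := c n k
      coef_measurable := hc1 n k
      coef_bounded := ⟨K, hc2 n k⟩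
      dir := h
      val := y }
  refine ⟨(Finset.range (n + 1)).toList.map term, ?_, ?_⟩
  · intro e he
    obtain ⟨k, hk, rfl⟩ := List.mem_map.1 he
    rw [Finset.mem_toList, Finset.mem_range] at hk
    exact ⟨le_gridPt a b n k, gridPt_le hab.le hk⟩
  · set R : ℝ≥0 × Ω → ℝ := fun p => (∑ k ∈ Finset.range (n + 1),
        (Ioc (gridPt a b n k) (gridPt a b n (k + 1))).indicator (fun _ => (1 : ℝ)) p.1 *
          c n k p.2) - φ p with hR
    have h2 : (fun p => elemIntegrand ((Finset.range (n + 1)).toList.map term) p -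
        φ p • HS.rankOne h y) = fun p => R p • (HS.rankOne h y : HS H F) := by
      funext p
      rw [elemIntegrand, List.map_map, Finset.sum_map_toList, hR]
      simp only
      rw [sub_smul, Finset.sum_smul]
      congr 1
      refine Finset.sum_congr rfl fun k _ => ?_
      rw [Function.comp_apply, ElemTerm.integrand_eq]
    rw [h2]
    refine (eLpNorm_le_mul_eLpNorm_of_ae_le_mul (f := fun p => R p • (HS.rankOne h y : HS H F))
      (g := R) (c := ‖(HS.rankOne h y : HS H F)‖) (Eventually.of_forall fun p => ?_) 2).trans ?_
    · rw [norm_smul, mul_comm]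
    · rw [ofReal_norm, mul_comm]
      exact hn.le

/-- Truncation at level n is eventually exact at each point and never increases |φ|, so the bounded
case passes to the limit. -/
theorem ElemApprox.smul_rankOne (hab : a ≤ b) (h : H) (y : F) {φ : ℝ≥0 × Ω → ℝ}
    (hm : MemLp φ 2 (timeProd μ a b))
    (had : ∀ u ∈ Icc a b, StronglyMeasurable[W.filtration u] fun ω => φ (u, ω)) :
    ElemApprox W a b fun p => φ p • HS.rankOne h y := by
  have hcm : ∀ n : ℕ, AEStronglyMeasurable (fun p => clamp n (φ p)) (timeProd μ a b) := fun n =>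
    (continuous_clamp n).comp_aestronglyMeasurable hm.1
  refine ElemApprox.of_tendsto (Ψ := fun (n : ℕ) p => clamp n (φ p) • HS.rankOne h y)
    (fun n => smul_rankOne_of_bounded hab h y (fun p => abs_clamp_le n.cast_nonneg _) (hcm n)
      fun u hu => (continuous_clamp n).comp_stronglyMeasurable (had u hu))
    (fun n => (hcm n).smul_const _) (hm.1.smul_const _) ?_
  refine tendsto_eLpNorm_two_zero_of_dominated
    (g := fun p => 2 * ‖φ p‖ * ‖(HS.rankOne h y : HS H F)‖)
    (fun n => ((hcm n).smul_const _).sub (hm.1.smul_const _))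
    ((hm.norm.const_mul 2).mul_const _)
    (fun n => Eventually.of_forall fun p => ?_) (Eventually.of_forall fun p => ?_)
  · rw [← sub_smul, norm_smul]
    gcongr
    have h1 : |clamp n (φ p)| ≤ |φ p| := by
      have h0 : (0 : ℝ) ≤ n := n.cast_nonneg
      rcases abs_cases (φ p) with h2 | h2 <;> rw [abs_le, clamp] <;> constructor
      all_goals first
        | (refine le_max_of_le_right (le_min ?_ ?_) <;> linarith)
        | (refine max_le ?_ ?_ <;> first | linarith | (refine (min_le_right _ _).trans ?_; linarith))
    calc _ ≤ ‖clamp n (φ p)‖ + ‖φ p‖ := norm_sub_le _ _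
      _ ≤ ‖φ p‖ + ‖φ p‖ := by gcongr; exact h1
      _ = _ := by ring
  · refine tendsto_const_nhds.congr' ?_
    filter_upwards [eventually_ge_atTop ⌈|φ p|⌉₊] with n hn
    rw [clamp_eq ((Nat.le_ceil _).trans (Nat.cast_le.2 hn)), sub_self]

variable [CompleteSpace F] [TopologicalSpace.SeparableSpace H] [TopologicalSpace.SeparableSpace F]

/-- Expand Φ in the basis eᵢ ⊗ fⱼ. The coefficients are scalar adapted processes, and the partial
sums converge pointwise with error at most ‖Φ‖. -/
theorem ElemApprox.of_adapted (hab : a ≤ b) {Φ : ℝ≥0 × Ω → HS H F}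
    (hm : MemLp Φ 2 (timeProd μ a b))
    (had : ∀ u ∈ Icc a b, StronglyMeasurable[W.filtration u] fun ω => Φ (u, ω)) :
    ElemApprox W a b Φ := by
  have := basisIndex_countable (F := H)
  have := basisIndex_countable (F := F)
  obtain ⟨S, hS⟩ := exists_seq_tendsto (atTop : Filter (Finset (basisIndex H × basisIndex F)))
  have hcm : ∀ q, MemLp (fun p => inner ℝ (HS.basisVec q) (Φ p)) 2 (timeProd μ a b) := fun q =>
    hm.const_inner _
  have hterm : ∀ q, ElemApprox W a b fun p => inner ℝ (HS.basisVec q) (Φ p) • HS.basisVec q :=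
    fun q => ElemApprox.smul_rankOne hab _ _ (hcm q)
      fun u hu => stronglyMeasurable_const.inner (had u hu)
  have htm : ∀ q, AEStronglyMeasurable (fun p => inner ℝ (HS.basisVec q) (Φ p) • HS.basisVec q)
      (timeProd μ a b) := fun q => (hcm q).1.smul_const _
  refine ElemApprox.of_tendsto
    (Ψ := fun n p => ∑ q ∈ S n, inner ℝ (HS.basisVec q) (Φ p) • HS.basisVec q)
    (fun n => ElemApprox.sum _ hterm htm)
    (fun n => Finset.aestronglyMeasurable_fun_sum _ fun i _ => htm i) hm.1 ?_
  refine tendsto_eLpNorm_two_zero_of_dominated (g := fun p => ‖Φ p‖)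
    (fun n => (Finset.aestronglyMeasurable_fun_sum _ fun i _ => htm i).sub hm.1) hm.norm
    (fun n => Eventually.of_forall fun p => ?_) (Eventually.of_forall fun p => ?_)
  · rw [norm_sub_rev]
    exact HS.norm_sub_sum_le _ _
  · have h1 := (HS.tendsto_sum_basisVec (Φ p)).comp hS
    simpa using h1.sub_const (Φ p)

end ElemApprox

/-! ### Continuous square-integrable martingales and their L² limits -/

section L2Martingale

variable {Ω : Type*} [mΩ : MeasurableSpace Ω] {μ : Measure Ω} [IsProbabilityMeasure μ]
  {F : Type*} [NormedAddCommGroup F] [InnerProductSpace ℝ F] [CompleteSpace F]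
  {ℱ : Filtration ℝ≥0 mΩ} {a b : ℝ≥0}

/-- `M` is a square-integrable continuous martingale on `[a, b]`. -/
structure IsL2Martingale (ℱ : Filtration ℝ≥0 mΩ) (μ : Measure Ω) (a b : ℝ≥0)
    (M : ℝ≥0 → Ω → F) : Prop where
  adapted : ∀ s ∈ Icc a b, StronglyMeasurable[ℱ s] (M s)
  memLp : ∀ s ∈ Icc a b, MemLp (M s) 2 μ
  continuous : ∀ᵐ ω ∂μ, ContinuousOn (fun s => M s ω) (Icc a b)
  condExp : ∀ s ∈ Icc a b, ∀ s' ∈ Icc a b, s ≤ s' → μ[M s' | ℱ s] =ᵐ[μ] M s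

theorem IsL2Martingale.add {M N : ℝ≥0 → Ω → F} (hM : IsL2Martingale ℱ μ a b M)
    (hN : IsL2Martingale ℱ μ a b N) : IsL2Martingale ℱ μ a b fun s ω => M s ω + N s ω where
  adapted s hs := (hM.adapted s hs).add (hN.adapted s hs)
  memLp s hs := (hM.memLp s hs).add (hN.memLp s hs)
  continuous := by
    filter_upwards [hM.continuous, hN.continuous] with ω h1 h2 using h1.add h2
  condExp s hs s' hs' hss' := by
    refine (condExp_add ((hM.memLp s' hs').integrable (by norm_num))
      ((hN.memLp s' hs').integrable (by norm_num)) _).trans ?_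
    exact (hM.condExp s hs s' hs' hss').add (hN.condExp s hs s' hs' hss')

theorem IsL2Martingale.const_smul {M : ℝ≥0 → Ω → F} (hM : IsL2Martingale ℱ μ a b M) (c : ℝ) :
    IsL2Martingale ℱ μ a b fun s ω => c • M s ω where
  adapted s hs := (hM.adapted s hs).const_smul c
  memLp s hs := (hM.memLp s hs).const_smul c
  continuous := by
    filter_upwards [hM.continuous] with ω h1 using h1.const_smul c
  condExp s hs s' hs' hss' := by
    refine (condExp_smul c (M s') _).trans ?_
    exact (hM.condExp s hs s' hs' hss').const_smul c

theorem IsL2Martingale.sub {M N : ℝ≥0 → Ω → F} (hM : IsL2Martingale ℱ μ a b M)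
    (hN : IsL2Martingale ℱ μ a b N) : IsL2Martingale ℱ μ a b fun s ω => M s ω - N s ω := by
  have := hM.add (hN.const_smul (-1))
  simpa [sub_eq_add_neg] using this

theorem IsL2Martingale.const (x : F) : IsL2Martingale ℱ μ a b fun _ _ => x where
  adapted _ _ := stronglyMeasurable_const
  memLp _ _ := memLp_const x
  continuous := Eventually.of_forall fun _ => continuousOn_const
  condExp s _ _ _ _ := by rw [condExp_const (ℱ.le s)]

/-- Doob's maximal inequality on a grid. -/
theorem IsL2Martingale.maximal_grid {M : ℝ≥0 → Ω → F} (hab : a ≤ b)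
    (hM : IsL2Martingale ℱ μ a b M) (ε : ℝ≥0) (n : ℕ) :
    ε * μ {ω | ∃ k ≤ n + 1, (ε : ℝ) ≤ ‖M (gridPt a b n k) ω‖} ≤ eLpNorm (M b) 2 μ := by
  -- Capping the index keeps all times in [a, b], so the sampled norms form a discrete-time
  -- submartingale indexed by all of ℕ.
  let g : ℕ → ℝ≥0 := fun k => gridPt a b n (min k (n + 1))
  have hg : Monotone g := fun i j h => gridPt_mono a b n (min_le_min_right _ h)
  have hgI : ∀ k, g k ∈ Icc a b := fun k => ⟨le_gridPt a b n _, gridPt_le hab (min_le_right _ _)⟩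
  let 𝒢 : Filtration ℕ mΩ :=
    { seq := fun k => ℱ (g k)
      mono' := fun i j h => ℱ.mono (hg h)
      le' := fun k => ℱ.le _ }
  let f : ℕ → Ω → ℝ := fun k ω => ‖M (g k) ω‖
  have hfi : ∀ k, Integrable (f k) μ := fun k =>
    ((hM.memLp _ (hgI k)).integrable (by norm_num)).norm
  have hsub : Submartingale f 𝒢 μ := by
    refine submartingale_nat (fun k => (hM.adapted _ (hgI k)).norm) hfi fun k => ?_
    have h1 := hM.condExp _ (hgI k) _ (hgI (k + 1)) (hg (Nat.le_succ k))
    have h2 := norm_condExp_le (m := ℱ (g k)) (μ := μ) (M (g (k + 1)))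
    filter_upwards [h1, h2] with ω hω1 hω2
    rw [hω1] at hω2
    exact hω2
  have h1 := maximal_ineq hsub (fun k ω => norm_nonneg _) (ε := ε) (n + 1)
  have hset : {ω | ∃ k ≤ n + 1, (ε : ℝ) ≤ ‖M (gridPt a b n k) ω‖} ⊆
      {ω | (ε : ℝ) ≤ (Finset.range (n + 1 + 1)).sup' Finset.nonempty_range_add_one
        fun k => f k ω} := by
    rintro ω ⟨k, hk, hω⟩
    refine le_trans hω ?_
    have : f k ω = ‖M (gridPt a b n k) ω‖ := by simp only [f, g, min_eq_left hk]
    rw [← this]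
    exact Finset.le_sup' (fun k => f k ω) (Finset.mem_range.2 (Nat.lt_succ_of_le hk))
  have hfb : f (n + 1) = fun ω => ‖M b ω‖ := by
    funext ω; simp only [f, g, min_self, gridPt_last hab]
  have hMb := hM.memLp b ⟨hab, le_rfl⟩
  calc ε * μ {ω | ∃ k ≤ n + 1, (ε : ℝ) ≤ ‖M (gridPt a b n k) ω‖}
      ≤ ε * μ {ω | (ε : ℝ) ≤ (Finset.range (n + 1 + 1)).sup' Finset.nonempty_range_add_one
        fun k => f k ω} := by gcongr
    _ ≤ _ := h1
    _ ≤ ENNReal.ofReal (∫ ω, f (n + 1) ω ∂μ) := by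
        refine ENNReal.ofReal_le_ofReal (setIntegral_le_integral (hfi _)
          (Eventually.of_forall fun ω => norm_nonneg _))
    _ = eLpNorm (M b) 1 μ := by
        rw [hfb, eLpNorm_one_eq_lintegral_enorm, ofReal_integral_norm_eq_lintegral_enorm
          (hMb.integrable (by norm_num))]
    _ ≤ eLpNorm (M b) 2 μ := eLpNorm_le_eLpNorm_of_exponent_le (by norm_num) hMb.1

/-- Doob's maximal inequality for continuous martingales. -/
theorem IsL2Martingale.maximal {M : ℝ≥0 → Ω → F} (hab : a ≤ b)
    (hM : IsL2Martingale ℱ μ a b M) {ε : ℝ≥0} (hε : ε ≠ 0) :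
    μ {ω | ∃ s ∈ Icc a b, (ε : ℝ) < ‖M s ω‖} ≤ eLpNorm (M b) 2 μ / ε := by
  let A : ℕ → Set Ω := fun n => {ω | ∃ k ≤ n + 1, (ε : ℝ) ≤ ‖M (gridPt a b n k) ω‖}
  have hA : ∀ n, μ (A n) ≤ eLpNorm (M b) 2 μ / ε := fun n => by
    rw [ENNReal.le_div_iff_mul_le (by simp [hε]) (by simp), mul_comm]
    exact hM.maximal_grid hab ε n
  -- By continuity a strict excess at time s persists at nearby grid points, so ω lies in every `A
  -- n` with n large. The increasing union of the sets `B N` thus captures the event, with the same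
  -- bound on its probability.
  let B : ℕ → Set Ω := fun N => ⋂ n ≥ N, A n
  have hB : Monotone B := fun N N' h => biInter_mono (fun n hn => le_trans h hn) fun _ _ => subset_rfl
  have hBle : ∀ N, μ (B N) ≤ eLpNorm (M b) 2 μ / ε := fun N =>
    (measure_mono (biInter_subset_of_mem (le_refl N))).trans (hA N)
  have hsub : {ω | ∃ s ∈ Icc a b, (ε : ℝ) < ‖M s ω‖} ≤ᵐ[μ] ⋃ N, B N := by
    filter_upwards [hM.continuous] with ω hω
    rintro ⟨s, hs, hsε⟩
    have hev : ∀ᶠ x in 𝓝[Icc a b] s, (ε : ℝ) < ‖M x ω‖ :=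
      (hω s hs).norm.eventually_const_lt hsε
    obtain ⟨x, hx1, hx2, hx3⟩ : ∃ x : ℕ → ℝ≥0, (∀ n, ∃ k ≤ n + 1, x n = gridPt a b n k) ∧
        (∀ n, x n ∈ Icc a b) ∧ Tendsto x atTop (𝓝 s) := by
      rcases hs.1.eq_or_lt with rfl | hlt
      · exact ⟨fun _ => a, fun n => ⟨0, by omega, (gridPt_zero a b n).symm⟩, fun _ => hs,
          tendsto_const_nhds⟩
      · choose k hk1 hk2 using exists_mem_Ioc_gridPt hab (u := s) ⟨hlt, hs.2⟩
        have hab' : a < b := hlt.trans_le hs.2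
        refine ⟨fun n => gridPt a b n (k n + 1), fun n => ⟨k n + 1, hk1 n, rfl⟩,
          fun n => ⟨le_gridPt _ _ _ _, gridPt_le hab (hk1 n)⟩, ?_⟩
        rw [← NNReal.tendsto_coe]
        have h1 : Tendsto (fun n => (s : ℝ) + 2 * halfMesh a b n) atTop (𝓝 (s : ℝ)) := by
          have := ((tendsto_nhdsWithin_iff.1 (tendsto_halfMesh hab')).1.const_mul 2).const_add
            (s : ℝ)
          simpa using this
        refine tendsto_of_tendsto_of_tendsto_of_le_of_le tendsto_const_nhds h1
          (fun n => NNReal.coe_le_coe.2 (hk2 n).2) (fun n => ?_)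
        have h2 := NNReal.coe_lt_coe.2 (hk2 n).1
        rw [coe_gridPt hab] at h2 ⊢
        unfold halfMesh
        push_cast
        have : ((b : ℝ) - a) / (n + 1) / 2 * 2 = (b - a) / (n + 1) := by ring
        linarith
    have hx4 : Tendsto x atTop (𝓝[Icc a b] s) :=
      tendsto_nhdsWithin_iff.2 ⟨hx3, Eventually.of_forall hx2⟩
    obtain ⟨N, hN⟩ := eventually_atTop.1 (hx4.eventually hev)
    refine mem_iUnion.2 ⟨N, mem_iInter₂.2 fun n hn => ?_⟩
    obtain ⟨k, hk, hxk⟩ := hx1 n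
    exact ⟨k, hk, by rw [← hxk]; exact (hN n hn).le⟩
  calc _ ≤ μ (⋃ N, B N) := measure_mono_ae hsub
    _ = ⨆ N, μ (B N) := hB.measure_iUnion
    _ ≤ _ := iSup_le hBle

/-- Geometric bounds on successive differences, uniform in time, make the sequence uniformly Cauchy.
-/
theorem continuousOn_limit_of_geometric {g : ℕ → ℝ≥0 → F} {S : Set ℝ≥0} {N : ℕ}
    (hc : ∀ k, ContinuousOn (g k) S)
    (h : ∀ k ≥ N, ∀ s ∈ S, ‖g (k + 1) s - g k s‖ ≤ (1 / 2 : ℝ) ^ k) :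
    (∀ s ∈ S, Tendsto (fun k => g k s) atTop (𝓝 (limUnder atTop fun k => g k s))) ∧
      ContinuousOn (fun s => limUnder atTop fun k => g k s) S := by
  have hd : ∀ s ∈ S, ∀ n, dist (g (n + N) s) (g (n + 1 + N) s) ≤ 2 / 2 / 2 ^ n := by
    intro s hs n
    rw [dist_comm, dist_eq_norm, show n + 1 + N = n + N + 1 by ring]
    refine (h (n + N) (by omega) s hs).trans ?_
    rw [div_self two_ne_zero, one_div_pow]
    gcongr
    · norm_num
    · omega
  have h1 : ∀ s ∈ S, Tendsto (fun k => g k s) atTop (𝓝 (limUnder atTop fun k => g k s)) := by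
    intro s hs
    obtain ⟨l, h2⟩ := cauchySeq_tendsto_of_complete (cauchySeq_of_le_geometric_two (hd s hs))
    have h3 := (tendsto_add_atTop_iff_nat (f := fun k => g k s) N).1 h2
    exact tendsto_nhds_limUnder ⟨_, h3⟩
  refine ⟨h1, ?_⟩
  have hu : TendstoUniformlyOn (fun n => g (n + N)) (fun s => limUnder atTop fun k => g k s)
      atTop S := by
    rw [Metric.tendstoUniformlyOn_iff]
    intro ε hε
    have hlim : Tendsto (fun n : ℕ => (2 : ℝ) / 2 ^ n) atTop (𝓝 0) := by
      have := (tendsto_pow_atTop_nhds_zero_of_lt_one (r := (1 / 2 : ℝ)) (by norm_num)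
        (by norm_num)).const_mul 2
      rw [mul_zero] at this
      refine this.congr fun n => ?_
      rw [one_div_pow]; ring
    filter_upwards [hlim.eventually_lt_const hε] with n hn s hs
    rw [dist_comm]
    exact (dist_le_of_le_geometric_two_of_tendsto (hd s hs)
      ((tendsto_add_atTop_iff_nat N).2 (h1 s hs)) n).trans_lt hn
  exact hu.continuousOn (Frequently.of_forall fun n => hc _)

/-- Fatou's lemma: the norm of g - h is at most the lower limit of the norms of f n - h. -/
theorem ae_eq_of_tendsto_eLpNorm {f : ℕ → Ω → F} {g h : Ω → F}
    (hf : ∀ n, AEStronglyMeasurable (f n) μ) (hh : AEStronglyMeasurable h μ)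
    (hg : ∀ᵐ ω ∂μ, Tendsto (fun n => f n ω) atTop (𝓝 (g ω)))
    (hfh : Tendsto (fun n => eLpNorm (fun ω => f n ω - h ω) 2 μ) atTop (𝓝 0)) : g =ᵐ[μ] h := by
  have h1 : eLpNorm (fun ω => g ω - h ω) 2 μ ≤ 0 := by
    refine (Lp.eLpNorm_lim_le_liminf_eLpNorm (f := fun n ω => f n ω - h ω)
      (fun n => (hf n).sub hh) _ ?_).trans hfh.liminf_eq.le
    filter_upwards [hg] with ω hω using hω.sub_const _
  have h2 : AEStronglyMeasurable (fun ω => g ω - h ω) μ :=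
    (aestronglyMeasurable_of_tendsto_ae _ hf hg).sub hh
  have h3 := (eLpNorm_eq_zero_iff h2 (by norm_num)).1 (le_antisymm h1 bot_le)
  filter_upwards [h3] with ω hω using sub_eq_zero.1 hω

/-- An `L²` limit of continuous martingales has a continuous version. -/
theorem IsL2Martingale.exists_limit (hab : a ≤ b) {M : ℕ → ℝ≥0 → Ω → F}
    (hM : ∀ n, IsL2Martingale ℱ μ a b (M n))
    (hnull : ∀ N : Set Ω, MeasurableSet N → μ N = 0 → ∀ s, MeasurableSet[ℱ s] N)
    {I : Ω → F} (hI : MemLp I 2 μ)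
    (hlim : Tendsto (fun n => eLpNorm (fun ω => M n b ω - I ω) 2 μ) atTop (𝓝 0)) :
    ∃ N : ℝ≥0 → Ω → F, IsL2Martingale ℱ μ a b N ∧ (∀ ω, Continuous fun s => N s ω) ∧
      (∀ s, StronglyMeasurable (N s)) ∧
      ∀ n, ∀ s ∈ Icc a b, eLpNorm (fun ω => M n s ω - N s ω) 2 μ ≤
        eLpNorm (fun ω => M n b ω - I ω) 2 μ := by
  have hbI : b ∈ Icc a b := ⟨hab, le_rfl⟩
  -- With errors 4⁻ᵏ, Doob's inequality at level 2⁻ᵏ bounds the probability of a large deviation by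
  -- 2 · 2⁻ᵏ, which is summable as Borel–Cantelli requires.
  obtain ⟨φ, hφmono, hφ⟩ : ∃ φ : ℕ → ℕ, StrictMono φ ∧
      ∀ k, eLpNorm (fun ω => M (φ k) b ω - I ω) 2 μ ≤ (1 / 4 : ℝ≥0∞) ^ k := by
    have hpos : ∀ k : ℕ, (0 : ℝ≥0∞) < (1 / 4 : ℝ≥0∞) ^ k := fun k =>
      ENNReal.pow_pos (by simp) k
    exact extraction_forall_of_eventually fun k => hlim.eventually_le_const (hpos k)
  have hD : ∀ k, eLpNorm (fun ω => M (φ (k + 1)) b ω - M (φ k) b ω) 2 μ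
      ≤ 2 * (1 / 4 : ℝ≥0∞) ^ k := by
    intro k
    have h1 : (fun ω => M (φ (k + 1)) b ω - M (φ k) b ω)
        = (fun ω => M (φ (k + 1)) b ω - I ω) - fun ω => M (φ k) b ω - I ω := by
      funext ω; simp
    rw [h1]
    refine (eLpNorm_sub_le (((hM _).memLp b hbI).sub hI).1 (((hM _).memLp b hbI).sub hI).1
      (by norm_num)).trans ?_
    rw [two_mul]
    refine add_le_add ((hφ (k + 1)).trans ?_) (hφ k)
    exact pow_le_pow_right_of_le_one' (by
      rw [one_div]; exact ENNReal.inv_le_one.2 (by norm_num)) (Nat.le_succ k)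
  have hBC : ∀ᵐ ω ∂μ, ∀ᶠ k in atTop, ω ∉ {ω | ∃ s ∈ Icc a b,
      (((1 / 2 : ℝ≥0) ^ k : ℝ≥0) : ℝ) < ‖M (φ (k + 1)) s ω - M (φ k) s ω‖} := by
    refine ae_eventually_notMem ?_
    have h1 : ∀ k, μ {ω | ∃ s ∈ Icc a b,
        (((1 / 2 : ℝ≥0) ^ k : ℝ≥0) : ℝ) < ‖M (φ (k + 1)) s ω - M (φ k) s ω‖}
        ≤ 2 * (1 / 2 : ℝ≥0∞) ^ k := by
      intro k
      refine (((hM (φ (k + 1))).sub (hM (φ k))).maximal hab (by positivity)).trans ?_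
      refine (ENNReal.div_le_div_right (hD k) _).trans ?_
      rw [ENNReal.div_le_iff_le_mul (by simp) (by simp)]
      rw [mul_assoc]
      refine mul_le_mul_right (le_of_eq ?_) 2
      rw [ENNReal.coe_pow, ← mul_pow]
      congr 1
      rw [ENNReal.coe_div two_ne_zero, ENNReal.coe_one, ENNReal.coe_ofNat, one_div, one_div,
        ← ENNReal.mul_inv (by simp) (by simp)]
      norm_num
    refine ne_top_of_le_ne_top ?_ (ENNReal.tsum_le_tsum h1)
    rw [ENNReal.tsum_mul_left, ENNReal.tsum_geometric]
    refine ENNReal.mul_ne_top (by simp) (ENNReal.inv_ne_top.2 ?_)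
    rw [ne_eq, tsub_eq_zero_iff_le, not_le, one_div]
    exact ENNReal.inv_lt_one.2 (by norm_num)
  have hgood : ∀ᵐ ω ∂μ, (∀ s ∈ Icc a b, Tendsto (fun k => M (φ k) s ω) atTop
      (𝓝 (limUnder atTop fun k => M (φ k) s ω))) ∧
      ContinuousOn (fun s => limUnder atTop fun k => M (φ k) s ω) (Icc a b) := by
    have hc : ∀ᵐ ω ∂μ, ∀ k, ContinuousOn (fun s => M (φ k) s ω) (Icc a b) :=
      ae_all_iff.2 fun k => (hM (φ k)).continuous
    filter_upwards [hBC, hc] with ω h1 h2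
    obtain ⟨N, hN⟩ := eventually_atTop.1 h1
    refine continuousOn_limit_of_geometric (g := fun k s => M (φ k) s ω) (N := N) h2 ?_
    intro k hk s hs
    have h3 := hN k hk
    simp only [not_exists, not_and, not_lt] at h3
    simpa using h3 s hs
  -- A measurable null set containing all bad ω. It belongs to every ℱ_s, so setting the limit to 0
  -- there preserves adaptedness and makes every path continuous.
  set B : Set Ω := toMeasurable μ {ω | ¬ ((∀ s ∈ Icc a b, Tendsto (fun k => M (φ k) s ω) atTop
      (𝓝 (limUnder atTop fun k => M (φ k) s ω))) ∧
      ContinuousOn (fun s => limUnder atTop fun k => M (φ k) s ω) (Icc a b))} with hB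
  have hBm : MeasurableSet B := measurableSet_toMeasurable _ _
  have hB0 : μ B = 0 := by rw [hB, measure_toMeasurable]; exact hgood
  have hBgood : ∀ ω ∉ B, (∀ s ∈ Icc a b, Tendsto (fun k => M (φ k) s ω) atTop
      (𝓝 (limUnder atTop fun k => M (φ k) s ω))) ∧
      ContinuousOn (fun s => limUnder atTop fun k => M (φ k) s ω) (Icc a b) := by
    intro ω hω
    by_contra h
    exact hω (subset_toMeasurable _ _ h)
  -- Freezing time outside [a, b] makes the paths continuous on all of ℝ₊, which later yields joint
  -- measurability.
  let pr : ℝ≥0 → ℝ≥0 := fun s => max a (min s b)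
  have hpr : ∀ s, pr s ∈ Icc a b := fun s => ⟨le_max_left _ _, max_le hab (min_le_right _ _)⟩
  have hprc : Continuous pr := by fun_prop
  have hpr' : ∀ s ∈ Icc a b, pr s = s := fun s hs => by
    simp only [pr]; rw [min_eq_left hs.2, max_eq_right hs.1]
  let N : ℝ≥0 → Ω → F := fun s => Bᶜ.indicator fun ω => limUnder atTop fun k => M (φ k) (pr s) ω
  have hNcont : ∀ ω, Continuous fun s => N s ω := by
    intro ω
    by_cases hω : ω ∈ B
    · have : (fun s => N s ω) = fun _ => 0 := by
        funext s; exact indicator_of_notMem (by simpa using hω) _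
      rw [this]; exact continuous_const
    · have : (fun s => N s ω) = fun s => limUnder atTop fun k => M (φ k) (pr s) ω := by
        funext s; exact indicator_of_mem (by simpa using hω) _
      rw [this]
      exact (hBgood ω hω).2.comp_continuous hprc hpr
  have hNad : ∀ s, StronglyMeasurable[ℱ (pr s)] (N s) := by
    intro s
    refine stronglyMeasurable_of_tendsto (u := atTop)
      (f := fun k => Bᶜ.indicator (M (φ k) (pr s)))
      (fun k => ((hM (φ k)).adapted (pr s) (hpr s)).indicator (hnull B hBm hB0 _).compl) ?_
    rw [tendsto_pi_nhds]
    intro ω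
    by_cases hω : ω ∈ B
    · simp only [N, indicator_of_notMem (show ω ∉ Bᶜ by simpa using hω)]
      exact tendsto_const_nhds
    · simp only [N, indicator_of_mem (show ω ∈ Bᶜ by simpa using hω)]
      exact (hBgood ω hω).1 _ (hpr s)
  have hNlim : ∀ s ∈ Icc a b, ∀ᵐ ω ∂μ, Tendsto (fun k => M (φ k) s ω) atTop (𝓝 (N s ω)) := by
    intro s hs
    filter_upwards [measure_eq_zero_iff_ae_notMem.1 hB0] with ω hω
    simp only [N, indicator_of_mem (show ω ∈ Bᶜ by simpa using hω), hpr' s hs]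
    exact (hBgood ω hω).1 s hs
  have hcond : ∀ n, ∀ s ∈ Icc a b, (fun ω => M n s ω - (μ[I | ℱ s]) ω) =ᵐ[μ]
      μ[fun ω => M n b ω - I ω | ℱ s] := by
    intro n s hs
    have h1 := condExp_sub (((hM n).memLp b hbI).integrable (by norm_num))
      (hI.integrable (by norm_num)) (ℱ s)
    have h2 := (hM n).condExp s hs b hbI hs.2
    filter_upwards [h1, h2] with ω hω1 hω2
    rw [← hω2]
    exact hω1.symm
  have hbound : ∀ n, ∀ s ∈ Icc a b, eLpNorm (fun ω => M n s ω - (μ[I | ℱ s]) ω) 2 μ ≤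
      eLpNorm (fun ω => M n b ω - I ω) 2 μ := by
    intro n s hs
    rw [eLpNorm_congr_ae (hcond n s hs)]
    exact eLpNorm_condExp_le_eLpNorm _ (by norm_num)
  -- Identifying the limit as the martingale closed by `I` gives its integrability and martingale
  -- property at once.
  have hNI : ∀ s ∈ Icc a b, N s =ᵐ[μ] μ[I | ℱ s] := by
    intro s hs
    refine ae_eq_of_tendsto_eLpNorm (f := fun k => M (φ k) s)
      (fun k => ((hM _).memLp s hs).1) integrable_condExp.1 (hNlim s hs) ?_
    exact tendsto_of_tendsto_of_tendsto_of_le_of_le tendsto_const_nhds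
      (hlim.comp hφmono.tendsto_atTop) (fun _ => bot_le) fun k => hbound (φ k) s hs
  refine ⟨N, ⟨fun s hs => ?_, fun s hs => ?_, Eventually.of_forall fun ω =>
    (hNcont ω).continuousOn, fun s hs s' hs' hss' => ?_⟩, hNcont,
    fun s => (hNad s).mono (ℱ.le _), fun n s hs => ?_⟩
  · have := hNad s
    rwa [hpr' s hs] at this
  · exact (memLp_congr_ae (hNI s hs)).2 (hI.condExp (by norm_num))
  · refine (condExp_congr_ae (hNI s' hs')).trans ?_
    exact (condExp_condExp_of_le (ℱ.mono hss') (ℱ.le s')).trans (hNI s hs).symm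
  · refine le_of_eq_of_le (eLpNorm_congr_ae ?_) (hbound n s hs)
    filter_upwards [hNI s hs] with ω hω
    rw [hω]

end L2Martingale

/-! ### Limits and the triangle inequality in L² -/

section LpLimits

variable {α E : Type*} [MeasurableSpace α] {μ : Measure α} [NormedAddCommGroup E]

theorem memLp_of_tendsto_eLpNorm_sub {f : ℕ → α → E} {g : α → E} (hf : ∀ n, MemLp (f n) 2 μ)
    (hg : AEStronglyMeasurable g μ)
    (h : Tendsto (fun n => eLpNorm (fun x => f n x - g x) 2 μ) atTop (𝓝 0)) : MemLp g 2 μ := by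
  obtain ⟨n, hn⟩ := (h.eventually_lt_const (zero_lt_one' ℝ≥0∞)).exists
  have h1 : MemLp (fun x => f n x - g x) 2 μ :=
    ⟨(hf n).1.sub hg, hn.trans ENNReal.one_lt_top⟩
  have h2 : g = f n - fun x => f n x - g x := by funext x; simp
  rw [h2]
  exact (hf n).sub h1

theorem tendsto_eLpNorm_of_tendsto_sub {f : ℕ → α → E} {g : α → E} (hf : ∀ n, MemLp (f n) 2 μ)
    (hg : MemLp g 2 μ)
    (h : Tendsto (fun n => eLpNorm (fun x => f n x - g x) 2 μ) atTop (𝓝 0)) :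
    Tendsto (fun n => eLpNorm (f n) 2 μ) atTop (𝓝 (eLpNorm g 2 μ)) := by
  have h1 : Tendsto (fun n => eLpNorm g 2 μ - eLpNorm (fun x => f n x - g x) 2 μ) atTop
      (𝓝 (eLpNorm g 2 μ)) := by
    have := ENNReal.Tendsto.sub (tendsto_const_nhds (x := eLpNorm g 2 μ)) h (Or.inl hg.2.ne)
    rwa [tsub_zero] at this
  have h2 : Tendsto (fun n => eLpNorm g 2 μ + eLpNorm (fun x => f n x - g x) 2 μ) atTop
      (𝓝 (eLpNorm g 2 μ)) := by
    have := (tendsto_const_nhds (x := eLpNorm g 2 μ)).add h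
    rwa [add_zero] at this
  refine tendsto_of_tendsto_of_tendsto_of_le_of_le h1 h2 (fun n => ?_) fun n => ?_
  · rw [tsub_le_iff_right]
    have h3 : g = f n - fun x => f n x - g x := by funext x; simp
    conv_lhs => rw [h3]
    exact eLpNorm_sub_le (hf n).1 ((hf n).sub hg).1 (by norm_num)
  · have h3 : f n = g + fun x => f n x - g x := by funext x; simp
    conv_lhs => rw [h3]
    exact eLpNorm_add_le hg.1 ((hf n).sub hg).1 (by norm_num)

theorem eLpNorm_triangle {f g h : α → E} (hf : MemLp f 2 μ) (hg : MemLp g 2 μ)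
    (hh : MemLp h 2 μ) : eLpNorm (fun x => f x - h x) 2 μ ≤
      eLpNorm (fun x => f x - g x) 2 μ + eLpNorm (fun x => g x - h x) 2 μ := by
  have h1 : (fun x => f x - h x) = (fun x => f x - g x) + fun x => g x - h x := by
    funext x; simp
  rw [h1]
  exact eLpNorm_add_le (hf.sub hg).1 (hg.sub hh).1 (by norm_num)

theorem eLpNorm_sub_swap (f g : α → E) :
    eLpNorm (fun x => f x - g x) 2 μ = eLpNorm (fun x => g x - f x) 2 μ := by
  refine eLpNorm_congr_norm_ae (Eventually.of_forall fun x => ?_)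
  rw [norm_sub_rev]

end LpLimits

/-! ### Elementary integrals as martingales in their upper limit -/

section Truncate

variable {Ω : Type*} [mΩ : MeasurableSpace Ω] {μ : Measure Ω} [IsProbabilityMeasure μ]
  {H : Type*} [NormedAddCommGroup H] [InnerProductSpace ℝ H] [CompleteSpace H]
  {F : Type*} [NormedAddCommGroup F] [InnerProductSpace ℝ F]
  {W : CylindricalWiener H μ}

/-- An elementary term stopped at time `s`. -/
def ElemTerm.truncate (e : ElemTerm W F) (s : ℝ≥0) : ElemTerm W F where
  left := min e.left s
  right := min e.right s
  left_le_right := min_le_min_right _ e.left_le_right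
  -- If `s` precedes the interval, the stopped term lives on the empty (s, s] and `e.coef` need not
  -- be known at time `s`, so 0 is used.
  coef := if s < e.left then 0 else e.coef
  coef_measurable := by
    split_ifs with h
    · exact stronglyMeasurable_zero
    · rw [min_eq_left (not_lt.1 h)]; exact e.coef_measurable
  coef_bounded := by
    split_ifs with h
    · exact ⟨0, fun ω => by simp⟩
    · exact e.coef_bounded
  dir := e.dir
  val := e.val

theorem ElemTerm.truncate_integrand (e : ElemTerm W F) {s u : ℝ≥0} (hu : u ≤ s) (ω : Ω) :
    (e.truncate s).integrand u ω = e.integrand u ω := by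
  rw [ElemTerm.integrand_eq, ElemTerm.integrand_eq]
  by_cases h : s < e.left
  · have h1 : u ∉ Ioc e.left e.right := fun h' => absurd (hu.trans_lt h) (not_lt.2 h'.1.le)
    simp [ElemTerm.truncate, h, h1]
  · have h1 : u ∈ Ioc (min e.left s) (min e.right s) ↔ u ∈ Ioc e.left e.right := by
      rw [min_eq_left (not_lt.1 h)]
      exact ⟨fun h' => ⟨h'.1, h'.2.trans (min_le_left _ _)⟩, fun h' => ⟨h'.1, le_min h'.2 hu⟩⟩
    simp only [ElemTerm.truncate, h, if_false, indicator_apply, h1]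

theorem ElemTerm.truncate_integral (e : ElemTerm W F) (s : ℝ≥0) (ω : Ω) :
    (e.truncate s).integral ω =
      (e.coef ω * (W.toFun (min e.right s) e.dir ω - W.toFun (min e.left s) e.dir ω)) • e.val := by
  by_cases h : s < e.left
  · have h1 : min e.right s = s := min_eq_right (h.le.trans e.left_le_right)
    simp [ElemTerm.truncate, ElemTerm.integral, h1, min_eq_right h.le]
  · simp [ElemTerm.truncate, ElemTerm.integral, h]

theorem ElemTerm.stronglyMeasurable_integral (e : ElemTerm W F) :
    StronglyMeasurable[W.filtration e.right] e.integral :=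
  ((e.coef_measurable.mono (W.filtration.mono e.left_le_right)).mul
    ((stronglyMeasurable_toFun W le_rfl _).sub
      (stronglyMeasurable_toFun W e.left_le_right _))).smul_const _

/-- Writes the change from s to s' through one Wiener increment starting no earlier than s or
`e.left`. The outer maximum collapses it to 0 when (s, s'] misses the interval of `e`. -/
theorem ElemTerm.truncate_integral_sub (e : ElemTerm W F) {s s' : ℝ≥0} (hs : s ≤ s') (ω : Ω) :
    (e.truncate s').integral ω - (e.truncate s).integral ω =
      (e.coef ω * (W.toFun (max (max e.left s) (min e.right s')) e.dir ω
        - W.toFun (max e.left s) e.dir ω)) • e.val := by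
  rw [ElemTerm.truncate_integral, ElemTerm.truncate_integral, ← sub_smul, ← mul_sub]
  have hlr := e.left_le_right
  congr 2
  rcases le_total s e.left with h1 | h1
  · rw [max_eq_left h1, min_eq_right h1, min_eq_right (h1.trans hlr), sub_self, sub_zero]
    rcases le_total s' e.left with h2 | h2
    · rw [min_eq_right h2, min_eq_right (h2.trans hlr), max_eq_left h2, sub_self, sub_self]
    · rw [min_eq_left h2, max_eq_right (le_min hlr h2)]
  · rw [max_eq_right h1, min_eq_left h1, min_eq_left (h1.trans hs)]
    rcases le_total e.right s with h2 | h2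
    · rw [min_eq_left h2, min_eq_left (h2.trans hs), max_eq_left h2]; ring
    · rw [min_eq_right h2, max_eq_right (le_min h2 hs)]; ring

variable [CompleteSpace F]

theorem ElemTerm.isL2Martingale (e : ElemTerm W F) (a b : ℝ≥0) :
    IsL2Martingale W.filtration μ a b fun s ω => (e.truncate s).integral ω where
  adapted s _ := (e.truncate s).stronglyMeasurable_integral.mono
    (W.filtration.mono (min_le_right _ _))
  memLp s _ := (e.truncate s).memLp_integral
  continuous := by
    filter_upwards [W.continuous e.dir] with ω hω
    simp_rw [ElemTerm.truncate_integral]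
    refine Continuous.continuousOn ?_
    have h1 : ∀ r, Continuous fun s => W.toFun (min r s) e.dir ω := fun r =>
      hω.comp (continuous_const.min continuous_id)
    exact (continuous_const.mul ((h1 _).sub (h1 _))).smul continuous_const
  condExp s _ s' _ hss' := by
    have hi : ∀ r, Integrable (e.truncate r).integral μ := fun r =>
      (e.truncate r).memLp_integral.integrable (by norm_num)
    symm
    refine ae_eq_condExp_of_forall_setIntegral_eq (W.filtration.le s) (hi s')
      (fun A _ _ => (hi s).integrableOn) (fun A hA _ => ?_)
      ((e.truncate s).stronglyMeasurable_integral.mono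
        (W.filtration.mono (min_le_right _ _))).aestronglyMeasurable
    have hA' := W.filtration.le s A hA
    rw [← sub_eq_zero, ← integral_sub (hi s).integrableOn (hi s').integrableOn, ← neg_eq_zero,
      ← integral_neg]
    simp_rw [neg_sub, e.truncate_integral_sub hss']
    rw [integral_smul_const]
    -- The test set lies in ℱ_s, so it can be absorbed into the coefficient, which is still known
    -- when the increment starts.
    have hZ : StronglyMeasurable[W.filtration (max e.left s)] (A.indicator e.coef) :=
      (e.coef_measurable.mono (W.filtration.mono (le_max_left _ _))).indicator
        (W.filtration.mono (le_max_right _ _) A hA)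
    have h0 := integral_mul_increment W (le_max_left (max e.left s) (min e.right s')) e.dir hZ
    rw [← integral_indicator hA']
    have h1 : ∀ ω, A.indicator (fun ω => e.coef ω *
        (W.toFun (max (max e.left s) (min e.right s')) e.dir ω - W.toFun (max e.left s) e.dir ω)) ω
        = A.indicator e.coef ω * (W.toFun (max (max e.left s) (min e.right s')) e.dir ω
          - W.toFun (max e.left s) e.dir ω) := by
      intro ω
      by_cases hω : ω ∈ A <;> simp [hω]
    rw [integral_congr_ae (Eventually.of_forall h1), h0, zero_smul]

theorem isL2Martingale_elemIntegral_truncate (L : List (ElemTerm W F)) (a b : ℝ≥0) :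
    IsL2Martingale W.filtration μ a b fun s => elemIntegral (L.map fun e => e.truncate s) := by
  induction L with
  | nil => exact IsL2Martingale.const 0
  | cons e L ih =>
    simp only [List.map_cons, elemIntegral_cons]
    exact (e.isL2Martingale a b).add ih

theorem elemIntegrand_truncate (L : List (ElemTerm W F)) {s u : ℝ≥0} (hu : u ≤ s) (ω : Ω) :
    elemIntegrand (L.map fun e => e.truncate s) (u, ω) = elemIntegrand L (u, ω) := by
  simp only [elemIntegrand, List.map_map]
  congr 1
  refine List.map_congr_left fun e _ => ?_
  exact e.truncate_integrand hu ω

theorem truncate_bounds {L : List (ElemTerm W F)} {a b s : ℝ≥0} (has : a ≤ s)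
    (hL : ∀ e ∈ L, a ≤ e.left ∧ e.right ≤ b) :
    ∀ e ∈ L.map fun e => e.truncate s, a ≤ e.left ∧ e.right ≤ s := by
  intro e he
  obtain ⟨e', he', rfl⟩ := List.mem_map.1 he
  exact ⟨le_min (hL e' he').1 has, min_le_right _ _⟩

theorem elemIntegral_truncate_last {L : List (ElemTerm W F)} {a b : ℝ≥0}
    (hL : ∀ e ∈ L, a ≤ e.left ∧ e.right ≤ b) (ω : Ω) :
    elemIntegral (L.map fun e => e.truncate b) ω = elemIntegral L ω := by
  simp only [elemIntegral, List.map_map]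
  congr 1
  refine List.map_congr_left fun e he => ?_
  have h1 := (hL e he).2
  rw [Function.comp_apply, ElemTerm.truncate_integral, min_eq_left h1,
    min_eq_left (e.left_le_right.trans h1)]
  rfl

/-- Multiplication of the coefficient of an elementary term by a bounded `ℱ_a`-measurable random
variable (terms that start before `a` are discarded). -/
def ElemTerm.mulCoef (e : ElemTerm W F) (a : ℝ≥0) (g : Ω → ℝ)
    (hg : StronglyMeasurable[W.filtration a] g) (hb : ∃ K, ∀ ω, |g ω| ≤ K) : ElemTerm W F where
  left := e.left
  right := e.right
  left_le_right := e.left_le_right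
  coef := if a ≤ e.left then fun ω => g ω * e.coef ω else 0
  coef_measurable := by
    split_ifs with h
    · exact (hg.mono (W.filtration.mono h)).mul e.coef_measurable
    · exact stronglyMeasurable_zero
  coef_bounded := by
    split_ifs with h
    · obtain ⟨K, hK⟩ := hb
      obtain ⟨K', hK'⟩ := e.coef_bounded
      refine ⟨K * K', fun ω => ?_⟩
      rw [abs_mul]
      exact mul_le_mul (hK ω) (hK' ω) (abs_nonneg _) ((abs_nonneg _).trans (hK ω))
    · exact ⟨0, fun ω => by simp⟩
  dir := e.dir
  val := e.val

theorem elemIntegrand_mulCoef {L : List (ElemTerm W F)} {a : ℝ≥0} (hL : ∀ e ∈ L, a ≤ e.left)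
    {g : Ω → ℝ} (hg : StronglyMeasurable[W.filtration a] g) (hb : ∃ K, ∀ ω, |g ω| ≤ K)
    (p : ℝ≥0 × Ω) :
    elemIntegrand (L.map fun e => e.mulCoef a g hg hb) p = g p.2 • elemIntegrand L p := by
  simp only [elemIntegrand, List.map_map, List.smul_sum]
  congr 1
  refine List.map_congr_left fun e he => ?_
  rw [Function.comp_apply, Function.comp_apply, ElemTerm.integrand_eq, ElemTerm.integrand_eq,
    smul_smul]
  simp only [ElemTerm.mulCoef, hL e he, if_true]
  congr 1
  ring

theorem elemIntegral_mulCoef {L : List (ElemTerm W F)} {a : ℝ≥0} (hL : ∀ e ∈ L, a ≤ e.left)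
    {g : Ω → ℝ} (hg : StronglyMeasurable[W.filtration a] g) (hb : ∃ K, ∀ ω, |g ω| ≤ K) (ω : Ω) :
    elemIntegral (L.map fun e => e.mulCoef a g hg hb) ω = g ω • elemIntegral L ω := by
  simp only [elemIntegral, List.map_map, List.smul_sum]
  congr 1
  refine List.map_congr_left fun e he => ?_
  rw [Function.comp_apply, Function.comp_apply, ElemTerm.integral, ElemTerm.integral, smul_smul]
  simp only [ElemTerm.mulCoef, hL e he, if_true]
  congr 1
  ring

end Truncate

/-! ### The Itô integral: isometry, linearity, existence as a continuous martingale -/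

section Ito

variable {Ω : Type*} [mΩ : MeasurableSpace Ω] {μ : Measure Ω} [IsProbabilityMeasure μ]
  {H : Type*} [NormedAddCommGroup H] [InnerProductSpace ℝ H] [CompleteSpace H]
  {F : Type*} [NormedAddCommGroup F] [InnerProductSpace ℝ F] [CompleteSpace F]
  {W : CylindricalWiener H μ} {a b : ℝ≥0} {Φ Ψ : ℝ≥0 → Ω → HS H F} {I J : Ω → F}

theorem IsItoIntegral.memLp (h : IsItoIntegral W Φ a b I) : MemLp I 2 μ := by
  obtain ⟨-, hI, L, -, -, hlim⟩ := h
  exact memLp_of_tendsto_eLpNorm_sub (f := fun n => elemIntegral (L n))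
    (fun n => memLp_elemIntegral _) hI hlim

/-- The Itô isometry. -/
theorem IsItoIntegral.eLpNorm_eq (h : IsItoIntegral W Φ a b I) :
    eLpNorm I 2 μ = eLpNorm (fun p : ℝ≥0 × Ω => Φ p.1 p.2) 2 (timeProd μ a b) := by
  have hI := h.memLp
  obtain ⟨hΦ, -, L, hL, hlim1, hlim2⟩ := h
  have h1 := tendsto_eLpNorm_of_tendsto_sub (f := fun n => elemIntegral (L n))
    (fun n => memLp_elemIntegral _) hI hlim2
  have h2 := tendsto_eLpNorm_of_tendsto_sub (f := fun n => elemIntegrand (L n))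
    (fun n => memLp_elemIntegrand _ a b) hΦ.memLp hlim1
  refine tendsto_nhds_unique h1 (h2.congr fun n => ?_)
  exact (eLpNorm_elemIntegral (L n) (hL n)).symm

theorem ItoIntegrable.add (hΦ : ItoIntegrable W Φ a b) (hΨ : ItoIntegrable W Ψ a b) :
    ItoIntegrable W (fun u ω => Φ u ω + Ψ u ω) a b where
  adapted u hu := (hΦ.adapted u hu).add (hΨ.adapted u hu)
  memLp := hΦ.memLp.add hΨ.memLp

theorem IsItoIntegral.add (hI : IsItoIntegral W Φ a b I) (hJ : IsItoIntegral W Ψ a b J) :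
    IsItoIntegral W (fun u ω => Φ u ω + Ψ u ω) a b fun ω => I ω + J ω := by
  have hIm := hI.memLp
  have hJm := hJ.memLp
  obtain ⟨hΦ, -, L, hL, hlim1, hlim2⟩ := hI
  obtain ⟨hΨ, -, L', hL', hlim1', hlim2'⟩ := hJ
  refine ⟨hΦ.add hΨ, (hIm.add hJm).1, fun n => L n ++ L' n,
    fun n e he => (List.mem_append.1 he).elim (hL n e) (hL' n e), ?_, ?_⟩
  · have h0 := hlim1.add hlim1'
    rw [add_zero] at h0
    refine tendsto_of_tendsto_of_tendsto_of_le_of_le tendsto_const_nhds h0 (fun _ => bot_le)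
      fun n => ?_
    refine le_of_eq_of_le (congrArg (fun f => eLpNorm f 2 (timeProd μ a b)) ?_)
      (eLpNorm_add_le (f := fun p : ℝ≥0 × Ω => elemIntegrand (L n) p - Φ p.1 p.2)
        (g := fun p : ℝ≥0 × Ω => elemIntegrand (L' n) p - Ψ p.1 p.2)
        ((memLp_elemIntegrand _ a b).sub hΦ.memLp).1
        ((memLp_elemIntegrand _ a b).sub hΨ.memLp).1 (by norm_num))
    funext p
    change elemIntegrand (L n ++ L' n) p - _ = _
    simp only [elemIntegrand_append, Pi.add_apply]
    abel
  · have h0 := hlim2.add hlim2'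
    rw [add_zero] at h0
    refine tendsto_of_tendsto_of_tendsto_of_le_of_le tendsto_const_nhds h0 (fun _ => bot_le)
      fun n => ?_
    refine le_of_eq_of_le (congrArg (fun f => eLpNorm f 2 μ) ?_)
      (eLpNorm_add_le (f := fun ω => elemIntegral (L n) ω - I ω)
        (g := fun ω => elemIntegral (L' n) ω - J ω)
        ((memLp_elemIntegral _).sub hIm).1 ((memLp_elemIntegral _).sub hJm).1 (by norm_num))
    funext p
    change elemIntegral (L n ++ L' n) p - _ = _
    simp only [elemIntegral_append, Pi.add_apply]
    abel

theorem tendsto_eLpNorm_smul_of_bounded {α E : Type*} [MeasurableSpace α] {ν : Measure α}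
    [NormedAddCommGroup E] [NormedSpace ℝ E] {f : ℕ → α → E} {h : α → E} {g : α → ℝ} {K : ℝ}
    (hK : ∀ x, |g x| ≤ K)
    (hlim : Tendsto (fun n => eLpNorm (fun x => f n x - h x) 2 ν) atTop (𝓝 0)) :
    Tendsto (fun n => eLpNorm (fun x => g x • f n x - g x • h x) 2 ν) atTop (𝓝 0) := by
  have h0 := ENNReal.Tendsto.const_mul (a := ENNReal.ofReal K) hlim (Or.inr ENNReal.ofReal_ne_top)
  rw [mul_zero] at h0
  refine tendsto_of_tendsto_of_tendsto_of_le_of_le tendsto_const_nhds h0 (fun _ => bot_le)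
    fun n => ?_
  refine eLpNorm_le_mul_eLpNorm_of_ae_le_mul (Eventually.of_forall fun x => ?_) 2
  rw [← smul_sub, norm_smul]
  exact mul_le_mul_of_nonneg_right (hK x) (norm_nonneg _)

theorem ItoIntegrable.smul (hΦ : ItoIntegrable W Φ a b) {g : Ω → ℝ}
    (hg : StronglyMeasurable[W.filtration a] g) {K : ℝ} (hK : ∀ ω, |g ω| ≤ K) :
    ItoIntegrable W (fun u ω => g ω • Φ u ω) a b where
  adapted u hu := (hg.mono (W.filtration.mono hu.1)).smul (hΦ.adapted u hu)
  memLp := by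
    have hg' : StronglyMeasurable fun p : ℝ≥0 × Ω => g p.2 :=
      (hg.mono (W.filtration.le a)).comp_measurable measurable_snd
    exact MemLp.smul (p := ∞) (q := 2) (r := 2) hΦ.memLp
      (memLp_top_of_bound hg'.aestronglyMeasurable K (Eventually.of_forall fun p => hK p.2))

/-- A bounded factor known at time `a` can be moved into every elementary coefficient. With g = 1_B
this localizes the isometry to an event of ℱ_a. -/
theorem IsItoIntegral.smul (hI : IsItoIntegral W Φ a b I) {g : Ω → ℝ}
    (hg : StronglyMeasurable[W.filtration a] g) {K : ℝ} (hK : ∀ ω, |g ω| ≤ K) :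
    IsItoIntegral W (fun u ω => g ω • Φ u ω) a b fun ω => g ω • I ω := by
  obtain ⟨hΦ, hIm, L, hL, hlim1, hlim2⟩ := hI
  refine ⟨hΦ.smul hg hK, (hg.mono (W.filtration.le a)).aestronglyMeasurable.smul hIm,
    fun n => (L n).map fun e => e.mulCoef a g hg ⟨K, hK⟩, fun n e he => ?_, ?_, ?_⟩
  · obtain ⟨e', he', rfl⟩ := List.mem_map.1 he
    exact hL n e' he'
  · refine (tendsto_eLpNorm_smul_of_bounded (g := fun p : ℝ≥0 × Ω => g p.2)
      (fun p => hK p.2) hlim1).congr fun n => ?_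
    refine congrArg (fun f => eLpNorm f 2 (timeProd μ a b)) (funext fun p => ?_)
    rw [← elemIntegrand, ← elemIntegrand,
      elemIntegrand_mulCoef (fun e he => (hL n e he).1) hg ⟨K, hK⟩]
  · refine (tendsto_eLpNorm_smul_of_bounded (g := g) hK hlim2).congr fun n => ?_
    refine congrArg (fun f => eLpNorm f 2 μ) (funext fun p => ?_)
    rw [← elemIntegral, ← elemIntegral,
      elemIntegral_mulCoef (fun e he => (hL n e he).1) hg ⟨K, hK⟩]

theorem IsItoIntegral.const_smul (hI : IsItoIntegral W Φ a b I) (c : ℝ) :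
    IsItoIntegral W (fun u ω => c • Φ u ω) a b fun ω => c • I ω :=
  hI.smul (g := fun _ => c) stronglyMeasurable_const (K := |c|) fun _ => le_rfl

theorem IsItoIntegral.sub (hI : IsItoIntegral W Φ a b I) (hJ : IsItoIntegral W Ψ a b J) :
    IsItoIntegral W (fun u ω => Φ u ω - Ψ u ω) a b fun ω => I ω - J ω := by
  have := hI.add (hJ.const_smul (-1))
  simpa [sub_eq_add_neg] using this

theorem IsItoIntegral.zero : IsItoIntegral W (fun _ _ => (0 : HS H F)) a b fun _ => 0 := by
  refine ⟨⟨fun _ _ => stronglyMeasurable_const, MemLp.zero'⟩, aestronglyMeasurable_const,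
    fun _ => [], by simp, ?_, ?_⟩ <;> simp

/-- A diagonal choice: for each n, one elementary integrand serving `Ψ n` and `J n` simultaneously
within 1/(n + 1). -/
theorem IsItoIntegral.of_tendsto {Ψ : ℕ → ℝ≥0 → Ω → HS H F} {J : ℕ → Ω → F}
    (hJ : ∀ n, IsItoIntegral W (Ψ n) a b (J n)) (hΦ : ItoIntegrable W Φ a b)
    (hIm : AEStronglyMeasurable I μ)
    (h1 : Tendsto (fun n => eLpNorm (fun p : ℝ≥0 × Ω => Ψ n p.1 p.2 - Φ p.1 p.2) 2
      (timeProd μ a b)) atTop (𝓝 0))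
    (h2 : Tendsto (fun n => eLpNorm (fun ω => J n ω - I ω) 2 μ) atTop (𝓝 0)) :
    IsItoIntegral W Φ a b I := by
  have hJm := fun n => (hJ n).memLp
  have hI : MemLp I 2 μ := memLp_of_tendsto_eLpNorm_sub hJm hIm h2
  have key : ∀ n : ℕ, ∃ L : List (ElemTerm W F), (∀ e ∈ L, a ≤ e.left ∧ e.right ≤ b) ∧
      eLpNorm (fun p : ℝ≥0 × Ω => elemIntegrand L p - Ψ n p.1 p.2) 2 (timeProd μ a b) ≤
        ((n : ℝ≥0∞) + 1)⁻¹ ∧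
      eLpNorm (fun ω => elemIntegral L ω - J n ω) 2 μ ≤ ((n : ℝ≥0∞) + 1)⁻¹ := by
    intro n
    obtain ⟨-, -, L, hL, hl1, hl2⟩ := hJ n
    have hpos : (0 : ℝ≥0∞) < ((n : ℝ≥0∞) + 1)⁻¹ := ENNReal.inv_pos.2 (by finiteness)
    obtain ⟨m, hm1, hm2⟩ := ((hl1.eventually_le_const hpos).and
      (hl2.eventually_le_const hpos)).exists
    exact ⟨L m, hL m, hm1, hm2⟩
  choose L hL hL1 hL2 using key
  have h0 : Tendsto (fun n : ℕ => ((n : ℝ≥0∞) + 1)⁻¹) atTop (𝓝 0) := by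
    have := ENNReal.tendsto_inv_nat_nhds_zero.comp (tendsto_add_atTop_nat 1)
    refine this.congr fun n => ?_
    simp
  refine ⟨hΦ, hIm, L, hL, ?_, ?_⟩
  · have h3 := h0.add h1
    rw [add_zero] at h3
    refine tendsto_of_tendsto_of_tendsto_of_le_of_le tendsto_const_nhds h3 (fun _ => bot_le)
      fun n => ?_
    exact (eLpNorm_triangle (memLp_elemIntegrand (L n) a b) (hJ n).1.memLp hΦ.memLp).trans
      (add_le_add_left (hL1 n) _)
  · have h3 := h0.add h2
    rw [add_zero] at h3
    refine tendsto_of_tendsto_of_tendsto_of_le_of_le tendsto_const_nhds h3 (fun _ => bot_le)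
      fun n => ?_
    exact (eLpNorm_triangle (memLp_elemIntegral (L n)) (hJm n) hI).trans
      (add_le_add_left (hL2 n) _)

theorem ItoIntegrable.mono (hΦ : ItoIntegrable W Φ a b) {s : ℝ≥0} (hs : s ≤ b) :
    ItoIntegrable W Φ a s where
  adapted u hu := hΦ.adapted u ⟨hu.1, hu.2.trans hs⟩
  memLp := hΦ.memLp.mono_measure (timeProd_mono le_rfl hs)

theorem eLpNorm_elemIntegral_sub {L L' : List (ElemTerm W F)}
    (hL : ∀ e ∈ L, a ≤ e.left ∧ e.right ≤ b) (hL' : ∀ e ∈ L', a ≤ e.left ∧ e.right ≤ b) :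
    eLpNorm (fun ω => elemIntegral L ω - elemIntegral L' ω) 2 μ =
      eLpNorm (fun p => elemIntegrand L p - elemIntegrand L' p) 2 (timeProd μ a b) := by
  have hc : StronglyMeasurable[W.filtration a] fun _ : Ω => (-1 : ℝ) := stronglyMeasurable_const
  have hb : ∃ K, ∀ _ : Ω, |(-1 : ℝ)| ≤ K := ⟨1, fun _ => by simp⟩
  -- A difference is again elementary: append the second list with its coefficients multiplied by
  -- -1.
  have h1 := eLpNorm_elemIntegral (a := a) (b := b)
    (L ++ L'.map fun e => e.mulCoef a (fun _ => -1) hc hb) (by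
      intro e he
      rcases List.mem_append.1 he with he | he
      · exact hL e he
      · obtain ⟨e', he', rfl⟩ := List.mem_map.1 he
        exact hL' e' he')
  rw [elemIntegral_append, elemIntegrand_append] at h1
  simp_rw [elemIntegral_mulCoef (fun e he => (hL' e he).1) hc hb,
    elemIntegrand_mulCoef (fun e he => (hL' e he).1) hc hb] at h1
  simpa [sub_eq_add_neg] using h1

variable [TopologicalSpace.SeparableSpace H] [TopologicalSpace.SeparableSpace F]

/-- Every admissible integrand has a stochastic integral process that is a continuous
martingale. -/
theorem ItoIntegrable.exists_integral_process (hab : a ≤ b) (hΦ : ItoIntegrable W Φ a b) :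
    ∃ N : ℝ≥0 → Ω → F, IsL2Martingale W.filtration μ a b N ∧
      (∀ ω, Continuous fun s => N s ω) ∧ (∀ s, StronglyMeasurable (N s)) ∧
      ∀ s ∈ Icc a b, IsItoIntegral W Φ a s (N s) := by
  have hA := ElemApprox.of_adapted hab hΦ.memLp hΦ.adapted
  have hpos : ∀ n : ℕ, (0 : ℝ≥0∞) < (1 / 2) ^ n := fun n => ENNReal.pow_pos (by simp) n
  choose L hL hL2 using fun n : ℕ => hA ((1 / 2) ^ n) (hpos n)
  have hpow : Tendsto (fun n : ℕ => (1 / 2 : ℝ≥0∞) ^ n) atTop (𝓝 0) := by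
    refine ENNReal.tendsto_pow_atTop_nhds_zero_of_lt_one ?_
    rw [one_div]; exact ENNReal.inv_lt_one.2 (by norm_num)
  have hlimΦ : Tendsto (fun n => eLpNorm (fun p : ℝ≥0 × Ω => elemIntegrand (L n) p - Φ p.1 p.2) 2
      (timeProd μ a b)) atTop (𝓝 0) :=
    tendsto_of_tendsto_of_tendsto_of_le_of_le tendsto_const_nhds hpow (fun _ => bot_le) hL2
  have hmono : ∀ {N n : ℕ}, N ≤ n → (1 / 2 : ℝ≥0∞) ^ n ≤ (1 / 2) ^ N := fun h =>
    pow_le_pow_right_of_le_one' (by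
      rw [one_div]; exact ENNReal.inv_le_one.2 (by norm_num)) h
  obtain ⟨I, hI, hIlim⟩ := Lp.cauchy_complete_eLpNorm (p := 2) (μ := μ) (by norm_num)
    (f := fun n => elemIntegral (L n)) (fun n => memLp_elemIntegral _)
    -- The isometry bounds the distance by 2 · 2⁻ᴺ; the constant 3 supplies the strict inequality
    -- demanded by the completeness criterion.
    (B := fun N => 3 * (1 / 2 : ℝ≥0∞) ^ N) (by
      rw [ENNReal.tsum_mul_left, ENNReal.tsum_geometric]
      refine ENNReal.mul_ne_top (by simp) (ENNReal.inv_ne_top.2 ?_)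
      rw [ne_eq, tsub_eq_zero_iff_le, not_le, one_div]
      exact ENNReal.inv_lt_one.2 (by norm_num))
    (by
      intro N n m hn hm
      change eLpNorm (fun ω => elemIntegral (L n) ω - elemIntegral (L m) ω) 2 μ < _
      rw [eLpNorm_elemIntegral_sub (hL n) (hL m)]
      refine (eLpNorm_triangle (memLp_elemIntegrand _ a b) hΦ.memLp
        (memLp_elemIntegrand _ a b)).trans_lt ?_
      rw [eLpNorm_sub_swap (fun p : ℝ≥0 × Ω => Φ p.1 p.2)]
      calc _ ≤ (1 / 2 : ℝ≥0∞) ^ N + (1 / 2) ^ N :=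
            add_le_add ((hL2 n).trans (hmono hn)) ((hL2 m).trans (hmono hm))
        _ = 2 * (1 / 2) ^ N := (two_mul _).symm
        _ < 3 * (1 / 2) ^ N := by
            refine (ENNReal.mul_lt_mul_iff_left (hpos N).ne' ?_).2 (by norm_num)
            exact ENNReal.pow_ne_top (by simp))
  obtain ⟨N, hN, hNc, hNm, hNlim⟩ := IsL2Martingale.exists_limit hab
    (fun n => isL2Martingale_elemIntegral_truncate (L n) a b)
    (fun B hB h0 s => measurableSet_filtration_of_null W s hB h0) hI (by
      refine hIlim.congr fun n => ?_
      refine congrArg (fun f => eLpNorm f 2 μ) (funext fun ω => ?_)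
      rw [elemIntegral_truncate_last (hL n)]
      rfl)
  -- The approximating lists for (a, b], stopped at s, witness the integral over (a, s]: their
  -- integrands are unchanged up to time s, and the error in the integrals is controlled by that at
  -- `b`.
  refine ⟨N, hN, hNc, hNm, fun s hs => ⟨hΦ.mono hs.2, (hN.memLp s hs).1,
    fun n => (L n).map fun e => e.truncate s, fun n => truncate_bounds hs.1 (hL n), ?_, ?_⟩⟩
  · refine tendsto_of_tendsto_of_tendsto_of_le_of_le tendsto_const_nhds hlimΦ (fun _ => bot_le)
      fun n => ?_
    refine le_trans (le_of_eq (eLpNorm_congr_ae ?_))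
      (eLpNorm_mono_measure _ (timeProd_mono le_rfl hs.2))
    have hmemI : ∀ᵐ p ∂(timeProd μ a s), p.1 ∈ Ioc a s :=
      Measure.quasiMeasurePreserving_fst.ae (ae_restrict_mem measurableSet_Ioc)
    filter_upwards [hmemI] with p hp
    rw [← elemIntegrand_truncate (L n) hp.2]
    rfl
  · refine tendsto_of_tendsto_of_tendsto_of_le_of_le tendsto_const_nhds hIlim (fun _ => bot_le)
      fun n => ?_
    refine (hNlim n s hs).trans (le_of_eq ?_)
    refine congrArg (fun f => eLpNorm f 2 μ) (funext fun ω => ?_)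
    rw [elemIntegral_truncate_last (hL n)]
    rfl

end Ito

/-! ### Measurability of a strongly measurable operator applied to a random vector -/

section Apply

variable {α F G : Type*} [NormedAddCommGroup F] [NormedSpace ℝ F] [NormedAddCommGroup G]
  [NormedSpace ℝ G]

/-- The operator is measurable only after evaluation at fixed vectors. This suffices for simple `g`,
and continuity of each operator handles the limit. -/
theorem stronglyMeasurable_apply {m : MeasurableSpace α} {f : α → F →L[ℝ] G}
    (hf : ∀ x, StronglyMeasurable fun a => f a x) {g : α → F} (hg : StronglyMeasurable g) :
    StronglyMeasurable fun a => f a (g a) := by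
  have h1 : ∀ s : SimpleFunc α F, StronglyMeasurable fun a => f a (s a) := by
    intro s
    induction s using SimpleFunc.induction with
    | const c hs =>
      rename_i S
      convert (hf c).indicator hs using 1
      ext a
      by_cases h : a ∈ S <;> simp [h]
    | add hd h1 h2 =>
      convert h1.add h2 using 1
      ext a
      simp
  refine stronglyMeasurable_of_tendsto atTop (fun n => h1 (hg.approx n))
    (tendsto_pi_nhds.2 fun a => ((f a).continuous.tendsto _).comp (hg.tendsto_approx a))

theorem aestronglyMeasurable_apply {m : MeasurableSpace α} {ν : Measure α} {f : α → F →L[ℝ] G}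
    (hf : ∀ x, AEStronglyMeasurable (fun a => f a x) ν) {g : α → F} (hg : StronglyMeasurable g) :
    AEStronglyMeasurable (fun a => f a (g a)) ν := by
  have h1 : ∀ s : SimpleFunc α F, AEStronglyMeasurable (fun a => f a (s a)) ν := by
    intro s
    induction s using SimpleFunc.induction with
    | const c hs =>
      rename_i S
      convert (hf c).indicator hs using 1
      ext a
      by_cases h : a ∈ S <;> simp [h]
    | add hd h1 h2 =>
      convert h1.add h2 using 1
      ext a
      simp
  exact aestronglyMeasurable_of_tendsto_ae atTop (fun n => h1 (hg.approx n))
    (Eventually.of_forall fun a => ((f a).continuous.tendsto _).comp (hg.tendsto_approx a))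

end Apply

/-! ### Volterra operators and Gronwall's inequality -/

section Gronwall

/-- `c ∫_t^s e^{m c (u - t)} du = (e^{m c (s - t)} - 1) / m`. -/
theorem mul_setLIntegral_exp {c m : ℝ} (hc : 0 < c) (hm : 0 < m) {t s : ℝ≥0} (hts : t ≤ s) :
    ENNReal.ofReal c * ∫⁻ u in Ioc t s, ENNReal.ofReal (Real.exp (m * c * ((u : ℝ) - t))) ∂leb =
      ENNReal.ofReal ((Real.exp (m * c * ((s : ℝ) - t)) - 1) / m) := by
  have hts' : (t : ℝ) ≤ s := NNReal.coe_le_coe.2 hts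
  rw [setLIntegral_leb t s fun x => ENNReal.ofReal (Real.exp (m * c * (x - t)))]
  have hcont : Continuous fun x : ℝ => Real.exp (m * c * (x - t)) := by fun_prop
  rw [← ofReal_integral_eq_lintegral_ofReal
    ((hcont.integrableOn_Icc (a := (t : ℝ)) (b := s)).mono_set Ioc_subset_Icc_self)
    (Eventually.of_forall fun x => (Real.exp_pos _).le),
    ← intervalIntegral.integral_of_le hts', ← ENNReal.ofReal_mul hc.le]
  congr 1
  have hd : ∀ x ∈ uIcc (t : ℝ) s, HasDerivAt (fun x : ℝ => Real.exp (m * c * (x - t)) / (m * c))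
      (Real.exp (m * c * (x - t))) x := by
    intro x _
    have h1 : HasDerivAt (fun x : ℝ => m * c * (x - t)) (m * c * 1) x :=
      ((hasDerivAt_id x).sub_const _).const_mul _
    have h2 := h1.exp.div_const (m * c)
    refine h2.congr_deriv ?_
    rw [mul_one, mul_div_assoc, div_self (mul_pos hm hc).ne', mul_one]
  rw [intervalIntegral.integral_eq_sub_of_hasDerivAt hd (hcont.intervalIntegrable _ _), sub_self,
    mul_zero, Real.exp_zero]
  field_simp

theorem measurable_expWeight (m c : ℝ) (t : ℝ≥0) :
    Measurable fun u : ℝ≥0 => ENNReal.ofReal (Real.exp (m * c * ((u : ℝ) - t))) := by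
  fun_prop

/-- In the weight e^{mc(s-t)}, integration with factor c contracts by 1/m. It is used with m = 4 for
the Picard iteration and m = 2 for Gronwall. -/
theorem volterra_step {c m : ℝ} (hc : 0 < c) (hm : 0 < m) {t T : ℝ≥0} {φ : ℝ≥0 → ℝ≥0∞}
    {K : ℝ≥0∞} 
    (hφ : ∀ u ∈ Icc t T, φ u ≤ K * ENNReal.ofReal (Real.exp (m * c * ((u : ℝ) - t)))) {s : ℝ≥0}
    (hs : s ∈ Icc t T) :
    ENNReal.ofReal c * ∫⁻ u in Ioc t s, φ u ∂leb ≤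
      K * ENNReal.ofReal (1 / m) * ENNReal.ofReal (Real.exp (m * c * ((s : ℝ) - t))) := by
  calc _ ≤ ENNReal.ofReal c * ∫⁻ u in Ioc t s,
        K * ENNReal.ofReal (Real.exp (m * c * ((u : ℝ) - t))) ∂leb := by
        refine mul_le_mul_right ?_ _
        exact setLIntegral_mono' measurableSet_Ioc fun u hu => hφ u ⟨hu.1.le, hu.2.trans hs.2⟩
    _ = K * ENNReal.ofReal ((Real.exp (m * c * ((s : ℝ) - t)) - 1) / m) := by
        rw [lintegral_const_mul _ (measurable_expWeight m c t), ← mul_setLIntegral_exp hc hm hs.1]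
        ring
    _ ≤ _ := by
        rw [mul_assoc K, ← ENNReal.ofReal_mul (by positivity)]
        refine mul_le_mul_right (ENNReal.ofReal_le_ofReal ?_) _
        rw [one_div, inv_mul_eq_div]
        gcongr
        linarith

/-- K e^{c(s-t)} is a fixed point of φ ↦ K + c∫φ. Starting from the crude bound `B`, each use of the
hypothesis halves the excess in the weight e^{2c(s-t)}. Measurability of φ is not needed, since only
the explicit exponential bounds are split under the integral. -/
theorem gronwall {c : ℝ} (hc : 0 < c) {t T : ℝ≥0} {φ : ℝ≥0 → ℝ≥0∞} {K B : ℝ≥0∞} (hB : B ≠ ∞)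
    (hφB : ∀ s ∈ Icc t T, φ s ≤ B)
    (hφ : ∀ s ∈ Icc t T, φ s ≤ K + ENNReal.ofReal c * ∫⁻ u in Ioc t s, φ u ∂leb) {s : ℝ≥0}
    (hs : s ∈ Icc t T) : φ s ≤ K * ENNReal.ofReal (Real.exp (c * ((s : ℝ) - t))) := by
  have hexp1 : ∀ (m : ℝ), 0 ≤ m → ∀ s ∈ Icc t T,
      1 ≤ ENNReal.ofReal (Real.exp (m * c * ((s : ℝ) - t))) := by
    intro m hm s hs
    rw [ENNReal.one_le_ofReal, Real.one_le_exp_iff]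
    have : (t : ℝ) ≤ s := NNReal.coe_le_coe.2 hs.1
    have := sub_nonneg.2 this
    positivity
  have key : ∀ n : ℕ, ∀ s ∈ Icc t T, φ s ≤
      K * ENNReal.ofReal (Real.exp (1 * c * ((s : ℝ) - t))) +
        B * ENNReal.ofReal (1 / 2) ^ n * ENNReal.ofReal (Real.exp (2 * c * ((s : ℝ) - t))) := by
    intro n
    induction n with
    | zero =>
      intro s hs
      rw [pow_zero, mul_one]
      refine (hφB s hs).trans (le_add_left ?_)
      exact le_mul_of_one_le_right bot_le (hexp1 2 (by norm_num) s hs)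
    | succ n ih =>
      intro s hs
      refine (hφ s hs).trans ?_
      have h1 : ∫⁻ u in Ioc t s, φ u ∂leb ≤
          (∫⁻ u in Ioc t s, K * ENNReal.ofReal (Real.exp (1 * c * ((u : ℝ) - t))) ∂leb) +
          ∫⁻ u in Ioc t s, B * ENNReal.ofReal (1 / 2) ^ n *
            ENNReal.ofReal (Real.exp (2 * c * ((u : ℝ) - t))) ∂leb := by
        rw [← lintegral_add_left ((measurable_expWeight 1 c t).const_mul K)]
        exact setLIntegral_mono' measurableSet_Ioc fun u hu => ih u ⟨hu.1.le, hu.2.trans hs.2⟩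
      have h2 := volterra_step hc (m := 2) (by norm_num) (T := T) (K := B * ENNReal.ofReal (1 / 2) ^ n)
        (fun u _ => le_rfl) hs
      have h3 : K + ENNReal.ofReal c *
          ∫⁻ u in Ioc t s, K * ENNReal.ofReal (Real.exp (1 * c * ((u : ℝ) - t))) ∂leb =
          K * ENNReal.ofReal (Real.exp (1 * c * ((s : ℝ) - t))) := by
        rw [lintegral_const_mul _ (measurable_expWeight 1 c t), mul_left_comm,
          mul_setLIntegral_exp hc one_pos hs.1, div_one]
        nth_rw 1 [← mul_one K]
        rw [← mul_add, ← ENNReal.ofReal_one, ← ENNReal.ofReal_add zero_le_one, add_sub_cancel]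
        have := hexp1 1 zero_le_one s hs
        rw [ENNReal.one_le_ofReal] at this
        linarith
      calc _ ≤ K + ENNReal.ofReal c * (_ + _) := by gcongr
        _ ≤ _ := by
          rw [mul_add, ← add_assoc, h3, pow_succ, ← mul_assoc B]
          gcongr
  have hlim : Tendsto (fun n : ℕ => K * ENNReal.ofReal (Real.exp (1 * c * ((s : ℝ) - t))) +
        B * ENNReal.ofReal (1 / 2) ^ n * ENNReal.ofReal (Real.exp (2 * c * ((s : ℝ) - t)))) atTop
      (𝓝 (K * ENNReal.ofReal (Real.exp (1 * c * ((s : ℝ) - t))) +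
        B * 0 * ENNReal.ofReal (Real.exp (2 * c * ((s : ℝ) - t))))) := by
    refine tendsto_const_nhds.add (ENNReal.Tendsto.mul_const (ENNReal.Tendsto.const_mul
      (ENNReal.tendsto_pow_atTop_nhds_zero_of_lt_one ?_) (Or.inr hB))
      (Or.inr ENNReal.ofReal_ne_top))
    rw [ENNReal.ofReal_lt_one]; norm_num
  have := ge_of_tendsto' hlim fun n => key n s hs
  simpa using this

end Gronwall

/-! ### The linear equation with bounded coefficient -/

section LinearEquation

variable {Ω : Type*} [mΩ : MeasurableSpace Ω] {μ : Measure Ω} [IsProbabilityMeasure μ]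
  {H : Type*} [NormedAddCommGroup H] [InnerProductSpace ℝ H] [CompleteSpace H]
  {F : Type*} [NormedAddCommGroup F] [InnerProductSpace ℝ F] [CompleteSpace F]
  {W : CylindricalWiener H μ} {t T : ℝ≥0} {A : ℝ≥0 → Ω → F →L[ℝ] HS H F} {c : ℝ≥0}

/-- `A` is an adapted measurable operator process on `[t, T]`, with `‖A_u‖ ≤ c` almost surely for
each `u`. -/
structure IsBoundedCoefficient (W : CylindricalWiener H μ) (c t T : ℝ≥0)
    (A : ℝ≥0 → Ω → F →L[ℝ] HS H F) : Prop where
  adapted : ∀ u ∈ Icc t T, ∀ x, StronglyMeasurable[W.filtration u] fun ω => A u ω x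
  measurable : ∀ x, AEStronglyMeasurable (fun p : ℝ≥0 × Ω => A p.1 p.2 x) (timeProd μ t T)
  norm_le : ∀ u ∈ Icc t T, ∀ᵐ ω ∂μ, ‖A u ω‖ ≤ c

/-- The norm bound holds almost surely for each fixed time, so Tonelli is applied with time outside.
Combined with the isometry this is the Volterra inequality behind both existence and the estimate.
-/
theorem IsBoundedCoefficient.lintegral_le (hA : IsBoundedCoefficient W c t T A)
    {Z : ℝ≥0 → Ω → F} {s : ℝ≥0} (hs : s ≤ T)
    (hm : AEStronglyMeasurable (fun p : ℝ≥0 × Ω => A p.1 p.2 (Z p.1 p.2)) (timeProd μ t s)) :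
    ∫⁻ p, ‖A p.1 p.2 (Z p.1 p.2)‖ₑ ^ 2 ∂(timeProd μ t s) ≤
      ENNReal.ofReal ((c : ℝ) ^ 2) * ∫⁻ u in Ioc t s, ∫⁻ ω, ‖Z u ω‖ₑ ^ 2 ∂μ ∂leb := by
  have hcc : ENNReal.ofReal ((c : ℝ) ^ 2) = (c : ℝ≥0∞) ^ 2 := by
    rw [ENNReal.ofReal_pow (NNReal.coe_nonneg c), ENNReal.ofReal_coe_nnreal]
  rw [hcc, ← lintegral_const_mul' _ _ (by simp), timeProd,
    lintegral_prod _ (hm.enorm.pow_const 2)]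
  refine setLIntegral_mono' measurableSet_Ioc fun u hu => ?_
  rw [← lintegral_const_mul' _ _ (by simp)]
  refine lintegral_mono_ae ?_
  filter_upwards [hA.norm_le u ⟨hu.1.le, hu.2.trans hs⟩] with ω hω
  rw [← mul_pow]
  have h1 : ‖A u ω (Z u ω)‖ₑ ≤ c * ‖Z u ω‖ₑ := by
    have h2 : ‖A u ω (Z u ω)‖₊ ≤ c * ‖Z u ω‖₊ :=
      ((A u ω).le_opNorm _).trans (mul_le_mul_of_nonneg_right hω (norm_nonneg _))
    rw [enorm_eq_nnnorm, enorm_eq_nnnorm, ← ENNReal.coe_mul]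
    exact ENNReal.coe_le_coe.2 h2
  gcongr

theorem IsL2Martingale.eLpNorm_le {M : ℝ≥0 → Ω → F} {ℱ : Filtration ℝ≥0 mΩ} {a b s : ℝ≥0}
    (hM : IsL2Martingale ℱ μ a b M) (hs : s ∈ Icc a b) : eLpNorm (M s) 2 μ ≤ eLpNorm (M b) 2 μ := by
  rw [← eLpNorm_congr_ae (hM.condExp s hs b ⟨hs.1.trans hs.2, le_rfl⟩ hs.2)]
  exact eLpNorm_condExp_le_eLpNorm _ (by norm_num)

/-- Square-integrable martingales on `[t, T]` all of whose paths are continuous on `ℝ₊`. -/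
structure IsRegularMartingale (W : CylindricalWiener H μ) (t T : ℝ≥0) (M : ℝ≥0 → Ω → F) :
    Prop where
  isL2Martingale : IsL2Martingale W.filtration μ t T M
  path_continuous : ∀ ω, Continuous fun s => M s ω
  stronglyMeasurable : ∀ s, StronglyMeasurable (M s)

theorem IsRegularMartingale.uncurry {M : ℝ≥0 → Ω → F} (hM : IsRegularMartingale W t T M) :
    StronglyMeasurable fun p : ℝ≥0 × Ω => M p.1 p.2 :=
  stronglyMeasurable_uncurry_of_continuous_of_stronglyMeasurable hM.path_continuous
    hM.stronglyMeasurable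

theorem IsBoundedCoefficient.itoIntegrable (hA : IsBoundedCoefficient W c t T A)
    {M : ℝ≥0 → Ω → F} (hM : IsRegularMartingale W t T M) :
    ItoIntegrable W (fun u ω => A u ω (M u ω)) t T := by
  have hm : AEStronglyMeasurable (fun p : ℝ≥0 × Ω => A p.1 p.2 (M p.1 p.2)) (timeProd μ t T) :=
    aestronglyMeasurable_apply hA.measurable hM.uncurry
  refine ⟨fun u hu => stronglyMeasurable_apply (hA.adapted u hu)
    (hM.isL2Martingale.adapted u hu), hm, ?_⟩
  rcases lt_or_ge T t with hTt | htT
  · have : timeProd μ t T = 0 := by simp [timeProd, Ioc_eq_empty_of_le hTt.le]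
    simp [this]
  refine (ENNReal.pow_lt_top_iff.1 ?_).resolve_right two_ne_zero
  rw [eLpNorm_two_sq]
  refine (hA.lintegral_le le_rfl hm).trans_lt (ENNReal.mul_lt_top ENNReal.ofReal_lt_top ?_)
  calc _ ≤ ∫⁻ _ in Ioc t T, eLpNorm (M T) 2 μ ^ 2 ∂leb := by
        refine setLIntegral_mono' measurableSet_Ioc fun u hu => ?_
        rw [← eLpNorm_two_sq]
        exact pow_le_pow_left' (hM.isL2Martingale.eLpNorm_le ⟨hu.1.le, hu.2⟩) 2
    _ < ∞ := by
        rw [setLIntegral_const, leb_Ioc]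
        exact ENNReal.mul_lt_top (ENNReal.pow_lt_top
          (hM.isL2Martingale.memLp T ⟨htT, le_rfl⟩).2) ENNReal.ofReal_lt_top

/-- `Z` is a continuous martingale that solves `Z_s = x + ∫_t^s A_u Z_u dW_u` on `[t, T]`. -/
structure IsMartingaleSolution (W : CylindricalWiener H μ) (A : ℝ≥0 → Ω → F →L[ℝ] HS H F)
    (t T : ℝ≥0) (x : F) (Z : ℝ≥0 → Ω → F) : Prop where
  isL2Martingale : IsL2Martingale W.filtration μ t T Z
  equation : ∀ s ∈ Icc t T, IsItoIntegral W (fun u ω => A u ω (Z u ω)) t s fun ω => Z s ω - x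

theorem IsMartingaleSolution.zero :
    IsMartingaleSolution W A t T (0 : F) fun _ _ => 0 where
  isL2Martingale := IsL2Martingale.const 0
  equation s _ := by simpa using IsItoIntegral.zero

theorem IsMartingaleSolution.add {x y : F} {Z Z' : ℝ≥0 → Ω → F}
    (hZ : IsMartingaleSolution W A t T x Z) (hZ' : IsMartingaleSolution W A t T y Z') :
    IsMartingaleSolution W A t T (x + y) fun s ω => Z s ω + Z' s ω where
  isL2Martingale := hZ.isL2Martingale.add hZ'.isL2Martingale
  equation s hs := by
    have h := (hZ.equation s hs).add (hZ'.equation s hs)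
    simpa only [map_add, add_sub_add_comm] using h

theorem IsMartingaleSolution.const_smul {x : F} {Z : ℝ≥0 → Ω → F}
    (hZ : IsMartingaleSolution W A t T x Z) (r : ℝ) :
    IsMartingaleSolution W A t T (r • x) fun s ω => r • Z s ω where
  isL2Martingale := hZ.isL2Martingale.const_smul r
  equation s hs := by
    have h := (hZ.equation s hs).const_smul r
    simpa only [map_smul, smul_sub] using h

theorem IsItoIntegral.ae_eq_zero {Φ : ℝ≥0 → Ω → HS H F} {I : Ω → F}
    (h : IsItoIntegral W Φ t t I) : I =ᵐ[μ] 0 := by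
  have h1 := h.eLpNorm_eq
  have h2 : timeProd μ t t = 0 := by simp [timeProd]
  rw [h2, eLpNorm_measure_zero] at h1
  exact (eLpNorm_eq_zero_iff h.memLp.1 (by norm_num)).1 h1

/-- `E[1_B ‖Z_s‖²] = P(B) ‖x‖² + E[1_B ‖Z_s - x‖²]` for `B ∈ ℱ_t`. -/
theorem IsMartingaleSolution.setLIntegral_eq {x : F} {Z : ℝ≥0 → Ω → F}
    (hZ : IsMartingaleSolution W A t T x Z) {B : Set Ω} (hB : MeasurableSet[W.filtration t] B)
    {s : ℝ≥0} (hs : s ∈ Icc t T) :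
    ∫⁻ ω in B, ‖Z s ω‖ₑ ^ 2 ∂μ = ‖x‖ₑ ^ 2 * μ B + ∫⁻ ω in B, ‖Z s ω - x‖ₑ ^ 2 ∂μ := by
  have ht : t ∈ Icc t T := ⟨le_rfl, hs.1.trans hs.2⟩
  have hB' := W.filtration.le t B hB
  have hZs : MemLp (Z s) 2 (μ.restrict B) := (hZ.isL2Martingale.memLp s hs).restrict B
  have hJ : MemLp (fun ω => Z s ω - x) 2 (μ.restrict B) := hZs.sub (memLp_const x)
  have hx : MemLp (fun _ : Ω => x) 2 (μ.restrict B) := memLp_const x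
  -- The martingale property and Z_t = x give E[1_B Z_s] = P(B) x.
  have hcross : ∫ ω in B, inner ℝ x (Z s ω - x) ∂μ = 0 := by
    rw [integral_inner (hJ.integrable (by norm_num)),
      integral_sub (hZs.integrable (by norm_num)) (integrable_const x)]
    have h1 : ∫ ω in B, Z s ω ∂μ = ∫ ω in B, x ∂μ := by
      rw [← setIntegral_condExp (W.filtration.le t)
        ((hZ.isL2Martingale.memLp s hs).integrable (by norm_num)) hB]
      refine integral_congr_ae (ae_restrict_of_ae ?_)
      filter_upwards [hZ.isL2Martingale.condExp t ht s hs hs.1, (hZ.equation t ht).ae_eq_zero]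
        with ω h1 h2
      rw [h1]
      exact sub_eq_zero.1 h2
    rw [h1, sub_self, inner_zero_right]
  have hsq : ∀ ω, ‖Z s ω‖ ^ 2 = ‖x‖ ^ 2 + 2 * inner ℝ x (Z s ω - x) + ‖Z s ω - x‖ ^ 2 := by
    intro ω
    rw [← norm_add_sq_real, add_sub_cancel]
  have hi := MemLp.integrable_inner_two hx hJ
  have key : ∫ ω in B, ‖Z s ω‖ ^ 2 ∂μ =
      ∫ _ in B, ‖x‖ ^ 2 ∂μ + ∫ ω in B, ‖Z s ω - x‖ ^ 2 ∂μ := by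
    simp_rw [hsq]
    have h1 := (integrable_const (μ := μ.restrict B) (‖x‖ ^ 2)).add (hi.const_mul 2)
    rw [integral_add (f := fun ω => ‖x‖ ^ 2 + 2 * inner ℝ x (Z s ω - x)) h1
      hJ.norm.integrable_sq, integral_add (integrable_const _) (hi.const_mul 2), integral_const_mul, hcross, mul_zero,
      add_zero]
  rw [MemLp.lintegral_enorm_sq hZs, key, ENNReal.ofReal_add (by positivity) (by positivity),
    ← MemLp.lintegral_enorm_sq hJ, ← MemLp.lintegral_enorm_sq hx, setLIntegral_const]

/-- The a priori estimate: `E[1_B ‖Z_s‖²] ≤ P(B) ‖x‖² e^{c² (s - t)}` for `B ∈ ℱ_t`. -/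
theorem IsMartingaleSolution.setLIntegral_le (hc : 0 < c) (hA : IsBoundedCoefficient W c t T A)
    {x : F} {Z : ℝ≥0 → Ω → F} (hZ : IsMartingaleSolution W A t T x Z) {B : Set Ω}
    (hB : MeasurableSet[W.filtration t] B) {s : ℝ≥0} (hs : s ∈ Icc t T) :
    ∫⁻ ω in B, ‖Z s ω‖ₑ ^ 2 ∂μ ≤
      ‖x‖ₑ ^ 2 * μ B * ENNReal.ofReal (Real.exp ((c : ℝ) ^ 2 * ((s : ℝ) - t))) := by
  have htT : t ≤ T := hs.1.trans hs.2
  have hB' := W.filtration.le t B hB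
  refine gronwall (c := (c : ℝ) ^ 2) (T := T) (φ := fun s => ∫⁻ ω in B, ‖Z s ω‖ₑ ^ 2 ∂μ)
    (B := eLpNorm (Z T) 2 μ ^ 2) (pow_pos hc 2)
    (ENNReal.pow_ne_top (hZ.isL2Martingale.memLp T ⟨htT, le_rfl⟩).2.ne) (fun s hs => ?_)
    (fun s hs => ?_) hs
  · refine (setLIntegral_le_lintegral _ _).trans ?_
    rw [← eLpNorm_two_sq]
    exact pow_le_pow_left' (hZ.isL2Martingale.eLpNorm_le hs) 2
  · rw [hZ.setLIntegral_eq hB hs]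
    refine add_le_add_right ?_ _
    have hg : StronglyMeasurable[W.filtration t] (B.indicator fun _ => (1 : ℝ)) :=
      stronglyMeasurable_const.indicator hB
    have hgK : ∀ ω, |B.indicator (fun _ => (1 : ℝ)) ω| ≤ 1 := by
      intro ω
      by_cases h : ω ∈ B <;> simp [h]
    -- Multiplying by 1_B keeps an Itô integral, with integrand 1_B A_u Z_u = A_u (1_B Z_u), so the
    -- isometry sees only the event `B`.
    have h1 := (hZ.equation s hs).smul hg hgK
    have hgv : ∀ (ω : Ω) (v : F), ‖B.indicator (fun _ => (1 : ℝ)) ω • v‖ₑ ^ 2 =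
        B.indicator (fun _ => ‖v‖ₑ ^ 2) ω := by
      intro ω v
      by_cases h : ω ∈ B <;> simp [h]
    have h2 : ∀ f : Ω → F, ∫⁻ ω, ‖B.indicator (fun _ => (1 : ℝ)) ω • f ω‖ₑ ^ 2 ∂μ =
        ∫⁻ ω in B, ‖f ω‖ₑ ^ 2 ∂μ := by
      intro f
      rw [← lintegral_indicator hB']
      refine lintegral_congr fun ω => ?_
      by_cases h : ω ∈ B <;> simp [h]
    have h3 := congrArg (fun r => r ^ 2) h1.eLpNorm_eq
    simp only [eLpNorm_two_sq, h2, ← map_smul] at h3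
    rw [h3]
    refine (hA.lintegral_le hs.2
      (Z := fun u ω => B.indicator (fun _ => (1 : ℝ)) ω • Z u ω) ?_).trans (le_of_eq ?_)
    · have := h1.1.memLp.1
      simpa only [← map_smul] using this
    · simp only [h2]

theorem IsMartingaleSolution.eLpNorm_le (hc : 0 < c) (hA : IsBoundedCoefficient W c t T A)
    {x : F} {Z : ℝ≥0 → Ω → F} (hZ : IsMartingaleSolution W A t T x Z) {s : ℝ≥0}
    (hs : s ∈ Icc t T) :
    eLpNorm (Z s) 2 μ ≤ (Real.exp ((c : ℝ) ^ 2 * ((T : ℝ) - t))).toNNReal * ‖x‖ₑ := by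
  have h1 := hZ.setLIntegral_le hc hA MeasurableSet.univ hs
  rw [Measure.restrict_univ, measure_univ, mul_one, ← eLpNorm_two_sq] at h1
  refine (ENNReal.pow_right_strictMono two_ne_zero).le_iff_le.1 (h1.trans ?_)
  change _ ≤ (ENNReal.ofReal (Real.exp ((c : ℝ) ^ 2 * ((T : ℝ) - t))) * ‖x‖ₑ) ^ 2
  rw [mul_pow, mul_comm]
  gcongr ?_ * _
  rw [← ENNReal.ofReal_pow (Real.exp_pos _).le]
  refine ENNReal.ofReal_le_ofReal ?_
  have hst : (s : ℝ) ≤ T := NNReal.coe_le_coe.2 hs.2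
  have htT : (t : ℝ) ≤ T := NNReal.coe_le_coe.2 (hs.1.trans hs.2)
  -- The exponential is at least 1, hence at most its square: a constant independent of s, not the
  -- sharp one with the square root.
  calc Real.exp ((c : ℝ) ^ 2 * ((s : ℝ) - t)) ≤ Real.exp ((c : ℝ) ^ 2 * ((T : ℝ) - t)) := by gcongr
    _ ≤ _ := le_self_pow₀ (Real.one_le_exp (mul_nonneg (sq_nonneg _) (sub_nonneg.2 htT)))
        two_ne_zero

/-- Comparison of integrals over all B ∈ ℱ_t implies the pointwise inequality, because both sides
are ℱ_t-measurable; this is argued on the measure trimmed to ℱ_t. -/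
theorem IsMartingaleSolution.condExp_le (hc : 0 < c) (hA : IsBoundedCoefficient W c t T A)
    {x : F} {Z : ℝ≥0 → Ω → F} (hZ : IsMartingaleSolution W A t T x Z) {s : ℝ≥0}
    (hs : s ∈ Icc t T) :
    μ[fun ω => ‖Z s ω‖ ^ 2 | W.filtration t] ≤ᵐ[μ]
      fun _ => ‖x‖ ^ 2 * Real.exp ((c : ℝ) ^ 2 * ((s : ℝ) - t)) := by
  have hm := W.filtration.le t
  have hi : Integrable (fun ω => ‖Z s ω‖ ^ 2) μ :=
    (hZ.isL2Martingale.memLp s hs).norm.integrable_sq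
  refine ae_le_of_ae_le_trim (hm := hm) (ae_le_of_forall_setIntegral_le
    (integrable_condExp.trim hm stronglyMeasurable_condExp) (integrable_const _)
    fun B hB _ => ?_)
  rw [← setIntegral_trim hm stronglyMeasurable_condExp hB, setIntegral_condExp hm hi hB,
    ← setIntegral_trim hm stronglyMeasurable_const hB]
  have h1 := hZ.setLIntegral_le hc hA hB hs
  rw [MemLp.lintegral_enorm_sq ((hZ.isL2Martingale.memLp s hs).restrict B)] at h1
  rw [setIntegral_const, smul_eq_mul, ← ENNReal.ofReal_le_ofReal_iff (by positivity)]
  refine h1.trans (le_of_eq ?_)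
  rw [ENNReal.ofReal_mul (by positivity), ENNReal.ofReal_mul (by positivity), ofReal_measureReal,
    ENNReal.ofReal_pow (norm_nonneg x), ofReal_norm]
  ring

variable [TopologicalSpace.SeparableSpace H] [TopologicalSpace.SeparableSpace F]

/-- One step of the Picard iteration. -/
theorem exists_picard_step (htT : t ≤ T) (hA : IsBoundedCoefficient W c t T A) (x : F)
    {M : ℝ≥0 → Ω → F} (hM : IsRegularMartingale W t T M) :
    ∃ N : ℝ≥0 → Ω → F, IsRegularMartingale W t T N ∧
      ∀ s ∈ Icc t T, IsItoIntegral W (fun u ω => A u ω (M u ω)) t s fun ω => N s ω - x := by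
  obtain ⟨J, hJ, hJc, hJm, hJI⟩ := (hA.itoIntegrable hM).exists_integral_process htT
  refine ⟨fun s ω => x + J s ω, ⟨(IsL2Martingale.const x).add hJ, fun ω => continuous_const.add
    (hJc ω), fun s => stronglyMeasurable_const.add (hJm s)⟩, fun s hs => ?_⟩
  simpa only [add_sub_cancel_left] using hJI s hs

theorem exists_isMartingaleSolution (hc : 0 < c) (htT : t ≤ T)
    (hA : IsBoundedCoefficient W c t T A) (x : F) :
    ∃ Z : ℝ≥0 → Ω → F, IsMartingaleSolution W A t T x Z := by
  choose! S hSreg hSeq using fun (M : ℝ≥0 → Ω → F) (hM : IsRegularMartingale W t T M) =>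
    exists_picard_step htT hA x hM
  let Y : ℕ → ℝ≥0 → Ω → F := fun n => S^[n] fun _ _ => x
  have hYs : ∀ n, Y (n + 1) = S (Y n) := fun n => Function.iterate_succ_apply' _ _ _
  have hY : ∀ n, IsRegularMartingale W t T (Y n) := by
    intro n
    induction n with
    | zero => exact ⟨IsL2Martingale.const x, fun _ => continuous_const,
        fun _ => stronglyMeasurable_const⟩
    | succ n ih => rw [hYs]; exact hSreg _ ih
  have hEq : ∀ n, ∀ s ∈ Icc t T,
      IsItoIntegral W (fun u ω => A u ω (Y n u ω)) t s fun ω => Y (n + 1) s ω - x := by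
    intro n s hs
    rw [hYs]
    exact hSeq _ (hY n) s hs
  have hc2 : (0 : ℝ) < (c : ℝ) ^ 2 := pow_pos hc 2
  have hTT : T ∈ Icc t T := ⟨htT, le_rfl⟩
  set K := eLpNorm (fun ω => Y 1 T ω - Y 0 T ω) 2 μ with hK
  have hK' : K ≠ ∞ :=
    (((hY 1).isL2Martingale.memLp T hTT).sub ((hY 0).isL2Martingale.memLp T hTT)).2.ne
  -- The weight with m = 4 yields the ratio 1/4 for squared norms, that is 1/2 in L².
  have hD : ∀ n, ∀ s ∈ Icc t T, ∫⁻ ω, ‖Y (n + 1) s ω - Y n s ω‖ₑ ^ 2 ∂μ ≤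
      K ^ 2 * ENNReal.ofReal (1 / 4) ^ n *
        ENNReal.ofReal (Real.exp (4 * (c : ℝ) ^ 2 * ((s : ℝ) - t))) := by
    intro n
    induction n with
    | zero =>
      intro s hs
      have hts : (t : ℝ) ≤ s := NNReal.coe_le_coe.2 hs.1
      rw [← eLpNorm_two_sq, pow_zero, mul_one]
      refine (pow_le_pow_left' (((hY 1).isL2Martingale.sub (hY 0).isL2Martingale).eLpNorm_le hs)
        2).trans (le_mul_of_one_le_right bot_le ?_)
      rw [ENNReal.one_le_ofReal]
      exact Real.one_le_exp (mul_nonneg (by positivity) (sub_nonneg.2 hts))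
    | succ n ih =>
      intro s hs
      have h1 := (hEq (n + 1) s hs).sub (hEq n s hs)
      simp only [sub_sub_sub_cancel_right, ← map_sub] at h1
      rw [← eLpNorm_two_sq, h1.eLpNorm_eq, eLpNorm_two_sq]
      refine (hA.lintegral_le hs.2 (Z := fun u ω => Y (n + 1) u ω - Y n u ω)
        h1.1.memLp.1).trans ((volterra_step hc2 (m := 4) (by norm_num) ih hs).trans (le_of_eq ?_))
      rw [pow_succ (ENNReal.ofReal (1 / 4)), mul_assoc (K ^ 2)]
  have hstep : ∀ n, eLpNorm (fun ω => Y n T ω - Y (n + 1) T ω) 2 μ ≤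
      K * ENNReal.ofReal (Real.exp (4 * (c : ℝ) ^ 2 * ((T : ℝ) - t))) *
        ENNReal.ofReal (1 / 2) ^ n := by
    intro n
    have hts : (t : ℝ) ≤ T := NNReal.coe_le_coe.2 htT
    rw [eLpNorm_sub_swap]
    refine (ENNReal.pow_right_strictMono two_ne_zero).le_iff_le.1 ?_
    simp only [eLpNorm_two_sq]
    refine (hD n T hTT).trans ?_
    have h4 : ENNReal.ofReal (1 / 4) ^ n = (ENNReal.ofReal (1 / 2) ^ n) ^ 2 := by
      rw [← pow_mul, mul_comm n, pow_mul, ← ENNReal.ofReal_pow (p := 1 / 2) (by norm_num)]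
      norm_num
    rw [h4, mul_pow, mul_pow, mul_right_comm (K ^ 2)]
    refine mul_le_mul_left (mul_le_mul_right ?_ _) _
    refine le_self_pow₀ ?_ two_ne_zero
    rw [ENNReal.one_le_ofReal]
    exact Real.one_le_exp (mul_nonneg (by positivity) (sub_nonneg.2 hts))
  have hYT : ∀ n, MemLp (Y n T) 2 μ := fun n => (hY n).isL2Martingale.memLp T hTT
  -- Only the terminal values need a limit; the martingale property recovers the whole process from
  -- it.
  obtain ⟨I, hI⟩ := cauchySeq_tendsto_of_complete (cauchySeq_of_edist_le_geometric
    (f := fun n => (hYT n).toLp (Y n T)) (ENNReal.ofReal (1 / 2)) _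
    (by rw [ENNReal.ofReal_lt_one]; norm_num) (ENNReal.mul_ne_top hK' ENNReal.ofReal_ne_top)
    fun n => by
      rw [Lp.edist_toLp_toLp]
      exact hstep n)
  have hIlim : Tendsto (fun n => eLpNorm (fun ω => Y n T ω - I ω) 2 μ) atTop (𝓝 0) := by
    refine ((Lp.tendsto_Lp_iff_tendsto_eLpNorm' _ _).1 hI).congr fun n => eLpNorm_congr_ae ?_
    filter_upwards [(hYT n).coeFn_toLp] with ω hω
    simp [hω]
  obtain ⟨Z, hZ, hZc, hZm, hZlim⟩ := IsL2Martingale.exists_limit htT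
    (fun n => (hY n).isL2Martingale)
    (fun B hB h0 s => measurableSet_filtration_of_null W s hB h0) (Lp.memLp I) hIlim
  have hAZ := hA.itoIntegrable ⟨hZ, hZc, hZm⟩
  -- Both sides of the Picard recursion converge: the error at any time is at most the error at `T`,
  -- and A is bounded.
  refine ⟨Z, hZ, fun s hs => IsItoIntegral.of_tendsto (fun n => hEq n s hs) (hAZ.mono hs.2)
    ((hZ.memLp s hs).1.sub aestronglyMeasurable_const) ?_ ?_⟩
  · refine tendsto_of_tendsto_sq_zero ?_
    have h0 : Tendsto (fun n => ENNReal.ofReal ((c : ℝ) ^ 2) *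
        (eLpNorm (fun ω => Y n T ω - I ω) 2 μ ^ 2 * leb (Ioc t s))) atTop
        (𝓝 (ENNReal.ofReal ((c : ℝ) ^ 2) * (0 ^ 2 * leb (Ioc t s)))) :=
      ENNReal.Tendsto.const_mul (ENNReal.Tendsto.mul_const (ENNReal.Tendsto.pow hIlim)
        (Or.inr (by rw [leb_Ioc]; exact ENNReal.ofReal_ne_top))) (Or.inr ENNReal.ofReal_ne_top)
    rw [zero_pow two_ne_zero, zero_mul, mul_zero] at h0
    refine tendsto_of_tendsto_of_tendsto_of_le_of_le tendsto_const_nhds h0 (fun _ => bot_le)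
      fun n => ?_
    have hm := ((hEq n s hs).1.memLp.1.sub (hAZ.mono hs.2).memLp.1)
    simp only [eLpNorm_two_sq, ← map_sub]
    refine (hA.lintegral_le hs.2 (Z := fun u ω => Y n u ω - Z u ω) ?_).trans ?_
    · simp only [map_sub]
      exact hm
    · refine mul_le_mul_right ?_ _
      rw [← setLIntegral_const]
      refine setLIntegral_mono' measurableSet_Ioc fun u hu => ?_
      simp only [← eLpNorm_two_sq]
      exact pow_le_pow_left' (hZlim n u ⟨hu.1.le, hu.2.trans hs.2⟩) 2
  · have h1 := (tendsto_add_atTop_iff_nat 1).2 hIlim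
    refine tendsto_of_tendsto_of_tendsto_of_le_of_le tendsto_const_nhds h1 (fun _ => bot_le)
      fun n => ?_
    simpa only [sub_sub_sub_cancel_right] using hZlim (n + 1) s hs

/-- Linear extension from an algebraic basis makes x ↦ Y_s x linear for every ω. Each vector is a
finite combination of basis vectors, so `Y x` solves the equation by linearity, and the a priori
estimate bounds it by a constant independent of x and s. -/
theorem exists_isStrongMartingaleSolution (hc : 0 < c) (htT : t ≤ T)
    (hA : IsBoundedCoefficient W c t T A) :
    ∃ Y : ℝ≥0 → Ω → F →ₗ[ℝ] F, IsStrongMartingaleSolution W A t T Y ∧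
      ∀ x, IsMartingaleSolution W A t T x fun s ω => Y s ω x := by
  choose Z hZ using exists_isMartingaleSolution (A := A) hc htT hA
  let b := Module.Basis.ofVectorSpace ℝ F
  let Y : ℝ≥0 → Ω → F →ₗ[ℝ] F := fun s ω => b.constr ℝ fun i => Z (b i) s ω
  have hY : ∀ x, IsMartingaleSolution W A t T x fun s ω => Y s ω x := by
    intro x
    have hx : x ∈ Submodule.span ℝ (range b) := by rw [b.span_eq]; trivial
    induction hx using Submodule.span_induction with
    | mem x hx =>
      obtain ⟨i, rfl⟩ := hx
      simpa only [Y, b.constr_basis] using hZ (b i)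
    | zero => simpa only [map_zero] using IsMartingaleSolution.zero
    | add x y _ _ h1 h2 => simpa only [map_add] using h1.add h2
    | smul r x _ h => simpa only [map_smul] using h.const_smul r
  refine ⟨Y, ⟨⟨_, fun s hs x => (hY x).eLpNorm_le hc hA hs⟩,
    fun x => (hY x).isL2Martingale.continuous, fun x => ⟨fun s => ?_, fun s s' hss' => ?_⟩,
    fun x => (hY x).equation⟩, hY⟩
  · exact (hY x).isL2Martingale.adapted s s.2
  · exact (hY x).isL2Martingale.condExp s s.2 s' s'.2 hss'

end LinearEquation

theorem IsGradientProcess.isBoundedCoefficient {Ω : Type*} [MeasurableSpace Ω] {μ : Measure Ω}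
    [IsProbabilityMeasure μ] {H : Type*} [NormedAddCommGroup H] [InnerProductSpace ℝ H]
    [CompleteSpace H] {F : Type*} [NormedAddCommGroup F] [InnerProductSpace ℝ F] [CompleteSpace F]
    {W : CylindricalWiener H μ} {σ : ℝ≥0 → F → HS H F} {c : ℝ≥0}
    (hσ : ∀ t, LipschitzWith c (σ t)) {P : ℝ≥0 → Ω → F} {t T : ℝ≥0}
    {A : ℝ≥0 → Ω → F →L[ℝ] HS H F} (hA : IsGradientProcess W T σ P A) :
    IsBoundedCoefficient W c t T A where
  adapted u hu := hA.adapted u ⟨bot_le, hu.2⟩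
  measurable x := (hA.measurable x).mono_measure (timeProd_mono bot_le le_rfl)
  norm_le u hu := (hA.gradient u ⟨bot_le, hu.2⟩).norm_le c (hσ u)

end HJM

end

theorem proposition5p4 {Ω : Type*} [MeasurableSpace Ω] {μ : Measure Ω} [IsProbabilityMeasure μ]
    {H : Type*} [NormedAddCommGroup H] [InnerProductSpace ℝ H] [CompleteSpace H]
    [TopologicalSpace.SeparableSpace H]
    {F : Type*} [NormedAddCommGroup F] [InnerProductSpace ℝ F] [CompleteSpace F]
    [TopologicalSpace.SeparableSpace F]
    (W : HJM.CylindricalWiener H μ)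
    (σ : ℝ≥0 → F → HJM.HS H F) (C : ℝ) (hC : 0 < C)
    (hσ : ∀ t x y, ‖σ t x - σ t y‖ ≤ C * ‖x - y‖)
    (p₀ : F) (P : ℝ≥0 → Ω → F) (hP : HJM.IsPriceProcess W σ p₀ P)
    (T : ℝ≥0) (gradσ : ℝ≥0 → Ω → F →L[ℝ] HJM.HS H F)
    (hgrad : HJM.IsGradientProcess W T σ P gradσ)
    (t : ℝ≥0) (htT : t ≤ T) :
    ∃ Y : ℝ≥0 → Ω → F →ₗ[ℝ] F,
      HJM.IsStrongMartingaleSolution W gradσ t T Y ∧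
      ∀ x : F, μ[fun ω => ‖Y T ω x‖ ^ 2 | W.filtration t] ≤ᵐ[μ]
        fun _ => ‖x‖ ^ 2 * Real.exp (C ^ 2 * ((T : ℝ) - t)) := by
  lift C to ℝ≥0 using hC.le
  have hC' : 0 < C := NNReal.coe_pos.1 hC
  have hL : ∀ u, LipschitzWith C (σ u) := fun u =>
    LipschitzWith.of_dist_le_mul fun x y => by simpa only [dist_eq_norm] using hσ u x y
  have hA : HJM.IsBoundedCoefficient W C t T gradσ := hgrad.isBoundedCoefficient hL
  obtain ⟨Y, hY, hsol⟩ := HJM.exists_isStrongMartingaleSolution hC' htT hA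
  exact ⟨Y, hY, fun x => (hsol x).condExp_le hC' hA ⟨htT, le_rfl⟩⟩
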